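/- Let $\mathfrak g=\mathfrak{spin}(3,1)$, $K=\mathrm{SU}(2)$; $\mathfrak g_{\mathbb C}$ has generators $J_0,J_1,J_2,K_0,K_1,K_2$ with $[J_a,J_b]=\mathrm i\varepsilon_{abc}J_c$, $[J_a,K_b]=\mathrm i\varepsilon_{abc}K_c$, $[K_a,K_b]=-\mathrm i\varepsilon_{abc}J_c$, and Casimirs $\mathcal C_1=\vec J\cdot\vec K$, $\mathcal C_2=J^2-K^2$. Put $J_\pm=J_1\pm\mathrm iJ_2$, $K_\pm=K_1\pm\mathrm iK_2$, $\mathcal M_j=\{-j,-j+1,\dots,j\}$ and $C_\pm(j,m)=\sqrt{j\mp m}\sqrt{j\pm m+1}$. For $\lambda\in\mathbb Z/2$, $\rho\in\mathbb C$ let $V_{\lambda,\rho}$ be the $(\mathfrak g,K)$-module with basis $|j,m\rangle$, $m\in\mathcal M_j$, where $j$ runs through $|\lambda|+\mathbb N_0$ up to the first zero $j_{\max}$ of $P^+$ (up to $\infty$ if there is none), on which $J_0|j,m\rangle=m|j,m\rangle$, $J_\pm|j,m\rangle=C_\pm(j,m)|j,m\pm1\rangle$, $$K_0|j,m\rangle=P^+(j)\sqrt{j+m+1}\sqrt{j-m+1}\,|j+1,m\rangle+P(j)\,m\,|j,m\rangle+P^-(j)\sqrt{j+m}\sqrt{j-m}\,|j-1,m\rangle,$$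 $$K_\pm|j,m\rangle=\mp P^+(j)\sqrt{j\pm m+1}\sqrt{j\pm m+2}\,|j+1,m\pm1\rangle+P(j)C_\pm(j,m)|j,m\pm1\rangle\pm P^-(j)\sqrt{j\mp m}\sqrt{j\mp m-1}\,|j-1,m\pm1\rangle,$$ with $P^-(j)=\frac{\sqrt{j+\lambda}\sqrt{j-\lambda}\sqrt{j+\rho}\sqrt{j-\rho}}{j\sqrt{2j+1}\sqrt{2j-1}}$ (and $P^-(|\lambda|)=0$), $P^+(j)=P^-(j+1)$, $P(j)=\frac{\mathrm i\lambda\rho}{j(j+1)}$ for $j\ne0$ and $P(0)=0$. For $\gamma\in\mathbb N_0/2$ and $A=\pm1$ let $F^A_\gamma$ be the $(2\gamma+1)$-dimensional module on which $\vec J$ acts by the spin-$\gamma$ representation and $\vec K=\mathrm iA\vec J$. **Proposition.** Let $\gamma\in\mathbb N_0/2$ with $\gamma\ge\frac12$, $A=\pm1$, $\lambda\in\mathbb Z/2$, $\rho\in\mathbb C$, and let $V_{\lambda,\rho}$ be infinite-dimensional. If $\rho+A\lambda\notin(-2\gamma,2\gamma)\cap\mathbb Z$, then the two Casimirs are simultaneously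 diagonalisable on $F^A_\gamma\otimes V_{\lambda,\rho}$. Their joint eigenvalues are exactly the pairs $(\mathrm i\Lambda\mathrm P,\ \Lambda^2+\mathrm P^2-1)$ with $(\Lambda,\mathrm P)=(\lambda+\nu,\rho+A\nu)$, $\nu\in\mathcal M_\gamma$. Moreover $F^A_\gamma\otimes V_{\lambda,\rho}$ is the direct sum over $\nu\in\mathcal M_\gamma$ of the joint eigenspaces with these labels, these are submodules, and the one with label $\nu$ is isomorphic to $V_{\lambda+\nu,\rho+A\nu}$. -/

import Mathlib

open scoped TensorProduct Matrix

namespace Lorentz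

/-- The complexified Lie algebra `spin(3,1)_ℂ`. Its six generators are `J 0, J 1, J 2, K 0, K 1, K 2`
(defined below); the element `x` stands for `∑ a, x.1 a • J a + ∑ a, x.2 a • K a`. -/
def Spin31 : Type := (Fin 3 → ℂ) × (Fin 3 → ℂ)

namespace Spin31

noncomputable instance : AddCommGroup Spin31 := inferInstanceAs (AddCommGroup ((Fin 3 → ℂ) × (Fin 3 → ℂ)))

noncomputable instance : Module ℂ Spin31 := inferInstanceAs (Module ℂ ((Fin 3 → ℂ) × (Fin 3 → ℂ)))

/-- The rotation generator `J_a`. -/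
noncomputable def J (a : Fin 3) : Spin31 := (Pi.single a 1, 0)

/-- The boost generator `K_a`. -/
noncomputable def K (a : Fin 3) : Spin31 := (0, Pi.single a 1)

/-- The bracket with `[J_a, J_b] = i ε_{abc} J_c`, `[J_a, K_b] = i ε_{abc} K_c` and
`[K_a, K_b] = -i ε_{abc} J_c`, written with the cross product. -/
noncomputable instance : Bracket Spin31 Spin31 where
  bracket x y := (Complex.I • (x.1 ⨯₃ y.1 - x.2 ⨯₃ y.2), Complex.I • (x.1 ⨯₃ y.2 + x.2 ⨯₃ y.1))

theorem lie_def (x y : Spin31) : ⁅x, y⁆ =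
    ((Complex.I • (x.1 ⨯₃ y.1 - x.2 ⨯₃ y.2), Complex.I • (x.1 ⨯₃ y.2 + x.2 ⨯₃ y.1)) : Spin31) := rfl

theorem add_fst (x y : Spin31) (a : Fin 3) : (x + y).1 a = x.1 a + y.1 a := rfl
theorem add_snd (x y : Spin31) (a : Fin 3) : (x + y).2 a = x.2 a + y.2 a := rfl
theorem smul_fst (c : ℂ) (x : Spin31) (a : Fin 3) : (c • x).1 a = c * x.1 a := rfl
theorem smul_snd (c : ℂ) (x : Spin31) (a : Fin 3) : (c • x).2 a = c * x.2 a := rfl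
theorem zero_fst (a : Fin 3) : (0 : Spin31).1 a = 0 := rfl
theorem zero_snd (a : Fin 3) : (0 : Spin31).2 a = 0 := rfl

theorem lie_coord (x y : Spin31) :
    (⁅x, y⁆.1 0 = Complex.I * (x.1 1 * y.1 2 - x.1 2 * y.1 1 - (x.2 1 * y.2 2 - x.2 2 * y.2 1)) ∧
     ⁅x, y⁆.1 1 = Complex.I * (x.1 2 * y.1 0 - x.1 0 * y.1 2 - (x.2 2 * y.2 0 - x.2 0 * y.2 2)) ∧
     ⁅x, y⁆.1 2 = Complex.I * (x.1 0 * y.1 1 - x.1 1 * y.1 0 - (x.2 0 * y.2 1 - x.2 1 * y.2 0))) ∧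
    ⁅x, y⁆.2 0 = Complex.I * (x.1 1 * y.2 2 - x.1 2 * y.2 1 + (x.2 1 * y.1 2 - x.2 2 * y.1 1)) ∧
     ⁅x, y⁆.2 1 = Complex.I * (x.1 2 * y.2 0 - x.1 0 * y.2 2 + (x.2 2 * y.1 0 - x.2 0 * y.1 2)) ∧
     ⁅x, y⁆.2 2 = Complex.I * (x.1 0 * y.2 1 - x.1 1 * y.2 0 + (x.2 0 * y.1 1 - x.2 1 * y.1 0)) := by
  rw [lie_def]
  refine ⟨⟨?_, ?_, ?_⟩, ?_, ?_, ?_⟩ <;> simp [cross_apply]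

theorem ext3 {x y : Spin31} (h1 : x.1 0 = y.1 0) (h2 : x.1 1 = y.1 1) (h3 : x.1 2 = y.1 2)
    (h4 : x.2 0 = y.2 0) (h5 : x.2 1 = y.2 1) (h6 : x.2 2 = y.2 2) : x = y :=
  Prod.ext (funext fun a => by fin_cases a <;> assumption)
    (funext fun a => by fin_cases a <;> assumption)

noncomputable instance : LieRing Spin31 where
  add_lie x y z := by
    apply ext3 <;> simp only [lie_coord, add_fst, add_snd] <;> ring
  lie_add x y z := by
    apply ext3 <;> simp only [lie_coord, add_fst, add_snd] <;> ring
  lie_self x := by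
    apply ext3 <;> simp only [lie_coord, zero_fst, zero_snd] <;> ring
  leibniz_lie x y z := by
    apply ext3 <;> simp only [lie_coord, add_fst, add_snd] <;> ring

noncomputable instance : LieAlgebra ℂ Spin31 where
  lie_smul c x y := by
    apply ext3 <;> simp only [lie_coord, smul_fst, smul_snd] <;> ring

end Spin31

open Spin31

attribute [local instance] LieRing.ofAssociativeRing

/-- Operators `J₀, J± = J₁ ± i J₂, K₀, K± = K₁ ± i K₂` on a vector space that satisfy the commutation
relations of `spin(3,1)_ℂ`. This is an auxiliary device to construct modules. -/
structure LadderRep (V : Type*) [AddCommGroup V] [Module ℂ V] where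
  J₀ : Module.End ℂ V
  Jp : Module.End ℂ V
  Jm : Module.End ℂ V
  K₀ : Module.End ℂ V
  Kp : Module.End ℂ V
  Km : Module.End ℂ V
  J₀_Jp : ⁅J₀, Jp⁆ = Jp
  J₀_Jm : ⁅J₀, Jm⁆ = -Jm
  Jp_Jm : ⁅Jp, Jm⁆ = (2 : ℂ) • J₀
  J₀_K₀ : ⁅J₀, K₀⁆ = 0
  J₀_Kp : ⁅J₀, Kp⁆ = Kp
  J₀_Km : ⁅J₀, Km⁆ = -Km
  Jp_K₀ : ⁅Jp, K₀⁆ = -Kp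
  Jp_Kp : ⁅Jp, Kp⁆ = 0
  Jp_Km : ⁅Jp, Km⁆ = (2 : ℂ) • K₀
  Jm_K₀ : ⁅Jm, K₀⁆ = Km
  Jm_Kp : ⁅Jm, Kp⁆ = -(2 : ℂ) • K₀
  Jm_Km : ⁅Jm, Km⁆ = 0
  K₀_Kp : ⁅K₀, Kp⁆ = -Jp
  K₀_Km : ⁅K₀, Km⁆ = Jm
  Kp_Km : ⁅Kp, Km⁆ = -(2 : ℂ) • J₀

namespace LadderRep

variable {V : Type*} [AddCommGroup V] [Module ℂ V] (r : LadderRep V)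

/-- The action of `x` determined by the ladder operators: since `J₁ = (J₊ + J₋)/2` and
`J₂ = (J₊ - J₋)/(2i)`, one has `∑ a, x_a J_a = x₀ J₀ + (x₁ - i x₂)/2 J₊ + (x₁ + i x₂)/2 J₋`,
and similarly for `K`. -/
noncomputable def toFun (x : Spin31) : Module.End ℂ V :=
    x.1 0 • r.J₀ + ((x.1 1 - Complex.I * x.1 2) / 2) • r.Jp
      + ((x.1 1 + Complex.I * x.1 2) / 2) • r.Jm
    + x.2 0 • r.K₀ + ((x.2 1 - Complex.I * x.2 2) / 2) • r.Kp
      + ((x.2 1 + Complex.I * x.2 2) / 2) • r.Km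

/-- The Lie algebra representation given by the ladder operators. -/
noncomputable def toLieHom : Spin31 →ₗ⁅ℂ⁆ Module.End ℂ V where
  toFun := r.toFun
  map_add' x y := by
    simp only [toFun, add_fst, add_snd]; module
  map_smul' c x := by
    simp only [toFun, smul_fst, smul_snd, RingHom.id_apply]; module
  map_lie' := by
    intro x y
    have h1 : ⁅r.Jp, r.J₀⁆ = -r.Jp := by rw [← lie_skew, r.J₀_Jp]
    have h2 : ⁅r.Jm, r.J₀⁆ = r.Jm := by rw [← lie_skew, r.J₀_Jm, neg_neg]
    have h3 : ⁅r.Jm, r.Jp⁆ = -((2 : ℂ) • r.J₀) := by rw [← lie_skew, r.Jp_Jm]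
    have h4 : ⁅r.K₀, r.J₀⁆ = 0 := by rw [← lie_skew, r.J₀_K₀, neg_zero]
    have h5 : ⁅r.Kp, r.J₀⁆ = -r.Kp := by rw [← lie_skew, r.J₀_Kp]
    have h6 : ⁅r.Km, r.J₀⁆ = r.Km := by rw [← lie_skew, r.J₀_Km, neg_neg]
    have h7 : ⁅r.K₀, r.Jp⁆ = r.Kp := by rw [← lie_skew, r.Jp_K₀, neg_neg]
    have h8 : ⁅r.Kp, r.Jp⁆ = 0 := by rw [← lie_skew, r.Jp_Kp, neg_zero]
    have h9 : ⁅r.Km, r.Jp⁆ = -((2 : ℂ) • r.K₀) := by rw [← lie_skew, r.Jp_Km]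
    have h10 : ⁅r.K₀, r.Jm⁆ = -r.Km := by rw [← lie_skew, r.Jm_K₀]
    have h11 : ⁅r.Kp, r.Jm⁆ = (2 : ℂ) • r.K₀ := by rw [← lie_skew, r.Jm_Kp, neg_smul, neg_neg]
    have h12 : ⁅r.Km, r.Jm⁆ = 0 := by rw [← lie_skew, r.Jm_Km, neg_zero]
    have h13 : ⁅r.Kp, r.K₀⁆ = r.Jp := by rw [← lie_skew, r.K₀_Kp, neg_neg]
    have h14 : ⁅r.Km, r.K₀⁆ = -r.Jm := by rw [← lie_skew, r.K₀_Km]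
    have h15 : ⁅r.Km, r.Kp⁆ = (2 : ℂ) • r.J₀ := by rw [← lie_skew, r.Kp_Km, neg_smul, neg_neg]
    simp only [toFun, lie_add, add_lie, lie_smul, smul_lie, lie_self, r.J₀_Jp, r.J₀_Jm, r.Jp_Jm,
      r.J₀_K₀, r.J₀_Kp, r.J₀_Km, r.Jp_K₀, r.Jp_Kp, r.Jp_Km, r.Jm_K₀, r.Jm_Kp, r.Jm_Km, r.K₀_Kp,
      r.K₀_Km, r.Kp_Km, h1, h2, h3, h4, h5, h6, h7, h8, h9, h10, h11, h12, h13, h14, h15]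
    simp only [Spin31.lie_coord]
    match_scalars <;> ring_nf <;> simp only [Complex.I_sq] <;> ring

end LadderRep

/-- The complex vector space with basis the kets `|j, m⟩`, `(2j, 2m) ∈ S`. All half-integers are
encoded by their doubles. -/
def Kets (S : Set (ℤ × ℤ)) : Type := S →₀ ℂ

noncomputable instance (S : Set (ℤ × ℤ)) : AddCommGroup (Kets S) :=
  inferInstanceAs (AddCommGroup (S →₀ ℂ))

noncomputable instance (S : Set (ℤ × ℤ)) : Module ℂ (Kets S) :=
  inferInstanceAs (Module ℂ (S →₀ ℂ))

/-- The basis of kets, indexed by the pairs `(2j, 2m)`. -/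
noncomputable def ketBasis (S : Set (ℤ × ℤ)) : Module.Basis S ℂ (Kets S) :=
  Module.Basis.ofRepr (LinearEquiv.refl ℂ (S →₀ ℂ))

/-- The ket `|j, m⟩` with `j = n/2`, `m = q/2`; it is the zero vector if `(n, q) ∉ S`. -/
noncomputable def ket (S : Set (ℤ × ℤ)) (n q : ℤ) : Kets S :=
  open Classical in if h : (n, q) ∈ S then ketBasis S ⟨(n, q), h⟩ else 0

/-- The vector `up(j,m) |j+1, m+s⟩ + mid(j,m) |j, m+s⟩ + down(j,m) |j-1, m+s⟩`,
where `j = n/2` and `m = q/2`. -/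
noncomputable def ladderKet (S : Set (ℤ × ℤ)) (s : ℤ) (up mid down : ℂ → ℂ → ℂ) (n q : ℤ) :
    Kets S :=
  up (n / 2) (q / 2) • ket S (n + 2) (q + 2 * s) + mid (n / 2) (q / 2) • ket S n (q + 2 * s)
    + down (n / 2) (q / 2) • ket S (n - 2) (q + 2 * s)

/-- The linear operator with
`|j, m⟩ ↦ up(j,m) |j+1, m+s⟩ + mid(j,m) |j, m+s⟩ + down(j,m) |j-1, m+s⟩`. -/
noncomputable def ladder (S : Set (ℤ × ℤ)) (s : ℤ) (up mid down : ℂ → ℂ → ℂ) :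
    Module.End ℂ (Kets S) :=
  (ketBasis S).constr ℂ fun p => ladderKet S s up mid down p.1.1 p.1.2

/-- The operator `ladder S s up mid down` is not truncated: a non-zero coefficient leads to a ket in
the index set. -/
def IsStable (S : Set (ℤ × ℤ)) (s : ℤ) (up mid down : ℂ → ℂ → ℂ) : Prop :=
  ∀ n q : ℤ, (n, q) ∈ S →
    (up (n / 2) (q / 2) ≠ 0 → (n + 2, q + 2 * s) ∈ S) ∧
    (mid (n / 2) (q / 2) ≠ 0 → (n, q + 2 * s) ∈ S) ∧
    (down (n / 2) (q / 2) ≠ 0 → (n - 2, q + 2 * s) ∈ S)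

theorem ladder_smul_ket {S : Set (ℤ × ℤ)} {s : ℤ} {up mid down : ℂ → ℂ → ℂ} {n q : ℤ} {c : ℂ}
    (h : c ≠ 0 → (n, q) ∈ S) :
    ladder S s up mid down (c • ket S n q) = c • ladderKet S s up mid down n q := by
  rcases eq_or_ne c 0 with rfl | hc
  · simp
  · rw [map_smul, ket, dif_pos (h hc), ladder, Module.Basis.constr_basis]

theorem ladder_ladder {S : Set (ℤ × ℤ)} {s s' : ℤ} {u z d u' z' d' : ℂ → ℂ → ℂ}
    (h : IsStable S s u z d) {n q : ℤ} (hnq : (n, q) ∈ S) :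
    ladder S s' u' z' d' (ladder S s u z d (ket S n q)) =
      u (n / 2) (q / 2) • ladderKet S s' u' z' d' (n + 2) (q + 2 * s)
      + z (n / 2) (q / 2) • ladderKet S s' u' z' d' n (q + 2 * s)
      + d (n / 2) (q / 2) • ladderKet S s' u' z' d' (n - 2) (q + 2 * s) := by
  have h0 : ladder S s u z d (ket S n q) = ladderKet S s u z d n q := by
    simpa using ladder_smul_ket (s := s) (up := u) (mid := z) (down := d) (c := 1) fun _ => hnq
  obtain ⟨h1, h2, h3⟩ := h n q hnq
  rw [h0, ladderKet, map_add, map_add, ladder_smul_ket h1, ladder_smul_ket h2, ladder_smul_ket h3]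

theorem ladder_lie {S : Set (ℤ × ℤ)} {s₁ s₂ s₃ : ℤ} {u₁ z₁ d₁ u₂ z₂ d₂ u₃ z₃ d₃ : ℂ → ℂ → ℂ}
    {α : ℂ} (h₁ : IsStable S s₁ u₁ z₁ d₁) (h₂ : IsStable S s₂ u₂ z₂ d₂) (hs : s₁ + s₂ = s₃)
    (H : ∀ n q : ℤ, (n, q) ∈ S → ∀ j m : ℂ, j = n / 2 → m = q / 2 →
      u₂ j m * u₁ (j + 1) (m + s₂) - u₁ j m * u₂ (j + 1) (m + s₁) = 0 ∧
      u₂ j m * z₁ (j + 1) (m + s₂) + z₂ j m * u₁ j (m + s₂)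
        - (u₁ j m * z₂ (j + 1) (m + s₁) + z₁ j m * u₂ j (m + s₁)) = α * u₃ j m ∧
      u₂ j m * d₁ (j + 1) (m + s₂) + z₂ j m * z₁ j (m + s₂) + d₂ j m * u₁ (j - 1) (m + s₂)
        - (u₁ j m * d₂ (j + 1) (m + s₁) + z₁ j m * z₂ j (m + s₁)
            + d₁ j m * u₂ (j - 1) (m + s₁)) = α * z₃ j m ∧
      z₂ j m * d₁ j (m + s₂) + d₂ j m * z₁ (j - 1) (m + s₂)
        - (z₁ j m * d₂ j (m + s₁) + d₁ j m * z₂ (j - 1) (m + s₁)) = α * d₃ j m ∧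
      d₂ j m * d₁ (j - 1) (m + s₂) - d₁ j m * d₂ (j - 1) (m + s₁) = 0) :
    ⁅ladder S s₁ u₁ z₁ d₁, ladder S s₂ u₂ z₂ d₂⁆ = α • ladder S s₃ u₃ z₃ d₃ := by
  refine (ketBasis S).ext fun p => ?_
  obtain ⟨⟨n, q⟩, hp⟩ := p
  have hk : ketBasis S ⟨(n, q), hp⟩ = ket S n q := by rw [ket, dif_pos hp]
  have e3 : ladder S s₃ u₃ z₃ d₃ (ket S n q) = ladderKet S s₃ u₃ z₃ d₃ n q := by
    simpa using ladder_smul_ket (s := s₃) (up := u₃) (mid := z₃) (down := d₃) (c := 1) fun _ => hp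
  obtain ⟨H1, H2, H3, H4, H5⟩ := H n q hp _ _ rfl rfl
  simp only [hk, LieRing.of_associative_ring_bracket, LinearMap.sub_apply,
    Module.End.mul_apply, LinearMap.smul_apply, e3, ladder_ladder h₁ hp, ladder_ladder h₂ hp]
  have i1 : ((n + 2 : ℤ) : ℂ) / 2 = n / 2 + 1 := by push_cast; ring
  have i2 : ((n - 2 : ℤ) : ℂ) / 2 = n / 2 - 1 := by push_cast; ring
  have i3 : ((q + 2 * s₁ : ℤ) : ℂ) / 2 = q / 2 + s₁ := by push_cast; ring
  have i4 : ((q + 2 * s₂ : ℤ) : ℂ) / 2 = q / 2 + s₂ := by push_cast; ring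
  have i5 : q + 2 * s₁ + 2 * s₂ = q + 2 * s₃ := by rw [← hs]; ring
  have i6 : q + 2 * s₂ + 2 * s₁ = q + 2 * s₃ := by rw [← hs]; ring
  have i7 : n + 2 - 2 = n := by ring
  have i8 : n - 2 + 2 = n := by ring
  simp only [ladderKet, i1, i2, i3, i4, i5, i6, i7, i8]
  match_scalars
  all_goals first
    | linear_combination H1
    | linear_combination H2
    | linear_combination H3
    | linear_combination H4
    | linear_combination H5

/-- `C₊(j,m) = √(j-m) √(j+m+1)`. -/
noncomputable def Cp (j m : ℂ) : ℂ := Complex.sqrt (j - m) * Complex.sqrt (j + m + 1)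

/-- `C₋(j,m) = √(j+m) √(j-m+1)`. -/
noncomputable def Cm (j m : ℂ) : ℂ := Complex.sqrt (j + m) * Complex.sqrt (j - m + 1)

/-- The set `{-j, -j+1, …, j-1, j}` for `j = n/2`, each element `m` being encoded as `q = 2m`. -/
def weights (n : ℤ) : Set ℤ := {q | -n ≤ q ∧ q ≤ n ∧ 2 ∣ n - q}

theorem sqrt_sq (x : ℂ) : Complex.sqrt x ^ 2 = x := by
  rw [Complex.sqrt, ← Complex.cpow_nat_mul]; simp

theorem sqrt_ne {x : ℂ} (h : Complex.sqrt x ≠ 0) : x ≠ 0 := by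
  rintro rfl; exact h (by simp [Complex.sqrt])

/-- The index set of the single multiplet of spin `n/2`. -/
def spinSet (n : ℤ) : Set (ℤ × ℤ) := {p | p.1 = n ∧ p.2 ∈ weights n}

/-- `P⁻_{λ,ρ}(j)`. At the lowest value `j = |λ|` it is zero (also for `|λ| = 0, 1/2`, where the
formula reads `0/0`). -/
noncomputable def Pminus (lam rho j : ℂ) : ℂ :=
  Complex.sqrt (j + lam) * Complex.sqrt (j - lam) * Complex.sqrt (j + rho) * Complex.sqrt (j - rho)
    / (j * Complex.sqrt (2 * j + 1) * Complex.sqrt (2 * j - 1))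

/-- `P⁺_{λ,ρ}(j) = P⁻_{λ,ρ}(j+1)`. -/
noncomputable def Pplus (lam rho j : ℂ) : ℂ := Pminus lam rho (j + 1)

/-- `P_{λ,ρ}(j)`. -/
noncomputable def Pzero (lam rho j : ℂ) : ℂ :=
  open Classical in if j = 0 then 0 else Complex.I * lam * rho / (j * (j + 1))

/-- The doubles `n = 2j` of the spins `j` that occur in `V_{λ,ρ}`, `λ = l/2`: those `j ∈ |λ| + ℕ₀` such
that `P⁺_{λ,ρ}` does not vanish at any smaller element of `|λ| + ℕ₀`. So `j` runs from `|λ|` to the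
first zero `j_max` of `P⁺_{λ,ρ}`, and to infinity if there is none. -/
def spins (l : ℤ) (rho : ℂ) : Set ℤ :=
  {n | (∃ k : ℕ, n = |l| + 2 * k) ∧
    ∀ i : ℕ, |l| + 2 * (i : ℤ) < n → Pplus (l / 2) rho (((|l| + 2 * i : ℤ) : ℂ) / 2) ≠ 0}

/-- The index set of the basis `|(λ,ρ) j, m⟩` of `V_{λ,ρ}`, `λ = l/2`. -/
def basisSet (l : ℤ) (rho : ℂ) : Set (ℤ × ℤ) := {p | p.1 ∈ spins l rho ∧ p.2 ∈ weights p.1}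

theorem cast_half_ne {n q a b : ℤ} (h : (n : ℂ) / 2 + a * (q / 2) + b ≠ 0) : n + a * q + 2 * b ≠ 0 := by
  intro e
  apply h
  have : ((n + a * q + 2 * b : ℤ) : ℂ) = 0 := by rw [e]; simp
  push_cast at this
  linear_combination this / 2

theorem stable_mid {S : Set (ℤ × ℤ)} {s : ℤ} {mid : ℂ → ℂ → ℂ}
    (h : ∀ n q : ℤ, (n, q) ∈ S → mid (n / 2) (q / 2) ≠ 0 → (n, q + 2 * s) ∈ S) :
    IsStable S s (fun _ _ => 0) mid (fun _ _ => 0) :=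
  fun n q hnq => ⟨fun h0 => absurd rfl h0, h n q hnq, fun h0 => absurd rfl h0⟩

/-- With `|j, m⟩`, the index set contains the full multiplet of spin `j`. -/
def WeightClosed (S : Set (ℤ × ℤ)) : Prop :=
  ∀ n q : ℤ, (n, q) ∈ S → q ∈ weights n ∧ ∀ q' ∈ weights n, (n, q') ∈ S

theorem Cp_stable {n q : ℤ} (hq : q ∈ weights n) (h : Complex.sqrt ((n : ℂ) / 2 - q / 2) ≠ 0) :
    q + 2 * 1 ∈ weights n := by
  obtain ⟨h1, h2, h3⟩ := hq
  have := cast_half_ne (n := n) (q := q) (a := -1) (b := 0)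
    (by have := sqrt_ne h; push_cast; intro e; apply this; linear_combination e)
  refine ⟨by omega, by omega, by omega⟩

theorem Cm_stable {n q : ℤ} (hq : q ∈ weights n) (h : Complex.sqrt ((n : ℂ) / 2 + q / 2) ≠ 0) :
    q + 2 * (-1) ∈ weights n := by
  obtain ⟨h1, h2, h3⟩ := hq
  have := cast_half_ne (n := n) (q := q) (a := 1) (b := 0)
    (by have := sqrt_ne h; push_cast; intro e; apply this; linear_combination e)
  refine ⟨by omega, by omega, by omega⟩

theorem J₀_stable {S : Set (ℤ × ℤ)} (f : ℂ → ℂ → ℂ): IsStable S 0 (fun _ _ => 0) f (fun _ _ => 0) :=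
  stable_mid fun n q h _ => by simpa using h

theorem Jp_stable {S : Set (ℤ × ℤ)} (hS : WeightClosed S) : IsStable S 1 (fun _ _ => 0) Cp (fun _ _ => 0) :=
  stable_mid fun n q h h0 =>
    (hS n q h).2 _ (Cp_stable (hS n q h).1 (left_ne_zero_of_mul h0))

theorem Jm_stable {S : Set (ℤ × ℤ)} (hS : WeightClosed S) : IsStable S (-1) (fun _ _ => 0) Cm (fun _ _ => 0) :=
  stable_mid fun n q h h0 =>
    (hS n q h).2 _ (Cm_stable (hS n q h).1 (left_ne_zero_of_mul h0))

/-- `J₀ |j,m⟩ = m |j,m⟩`. -/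
noncomputable abbrev opJ₀ (S : Set (ℤ × ℤ)) : Module.End ℂ (Kets S) :=
  ladder S 0 (fun _ _ => 0) (fun _ m => m) (fun _ _ => 0)
/-- `J₊ |j,m⟩ = C₊(j,m) |j,m+1⟩`. -/
noncomputable abbrev opJp (S : Set (ℤ × ℤ)) : Module.End ℂ (Kets S) :=
  ladder S 1 (fun _ _ => 0) Cp (fun _ _ => 0)
/-- `J₋ |j,m⟩ = C₋(j,m) |j,m-1⟩`. -/
noncomputable abbrev opJm (S : Set (ℤ × ℤ)) : Module.End ℂ (Kets S) :=
  ladder S (-1) (fun _ _ => 0) Cm (fun _ _ => 0)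

theorem su2_rel {S : Set (ℤ × ℤ)} (hS : WeightClosed S) :
    ⁅opJ₀ S, opJp S⁆ = opJp S ∧ ⁅opJ₀ S, opJm S⁆ = -opJm S ∧
      ⁅opJp S, opJm S⁆ = (2 : ℂ) • opJ₀ S := by
  refine ⟨?_, ?_, ?_⟩
  · refine (ladder_lie (α := 1) (J₀_stable _) (Jp_stable hS) rfl ?_).trans (one_smul _ _)
    intro n q _ j m _ _
    simp only [Cp]; push_cast
    refine ⟨?_, ?_, ?_, ?_, ?_⟩ <;> ring_nf
  · refine (ladder_lie (α := -1) (J₀_stable _) (Jm_stable hS) rfl ?_).trans (neg_one_smul _ _)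
    intro n q _ j m _ _
    simp only [Cm]; push_cast
    refine ⟨?_, ?_, ?_, ?_, ?_⟩ <;> ring_nf
  · refine ladder_lie (Jp_stable hS) (Jm_stable hS) rfl ?_
    intro n q _ j m _ _
    simp only [Cp, Cm]; push_cast
    refine ⟨by ring_nf, by ring_nf, ?_, by ring_nf, by ring_nf⟩
    ring_nf
    simp only [sqrt_sq]
    ring

theorem weightClosed_spinSet (n : ℤ) : WeightClosed (spinSet n) := by
  rintro a q ⟨h1, h2⟩
  obtain rfl : a = n := h1
  exact ⟨h2, fun q' h => ⟨rfl, h⟩⟩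

theorem weightClosed_basisSet (l : ℤ) (rho : ℂ) : WeightClosed (basisSet l rho) :=
  fun _ _ h => ⟨h.2, fun _ h' => ⟨h.1, h'⟩⟩

/-- Operators `J` that represent `su(2)_ℂ`, extended to `spin(3,1)_ℂ` by `K = i A J`. -/
noncomputable def LadderRep.ofSU2 {V : Type*} [AddCommGroup V] [Module ℂ V]
    {J₀ Jp Jm : Module.End ℂ V} (h1 : ⁅J₀, Jp⁆ = Jp) (h2 : ⁅J₀, Jm⁆ = -Jm)
    (h3 : ⁅Jp, Jm⁆ = (2 : ℂ) • J₀) (A : ℤˣ) : LadderRep V :=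
  have h2' : ⁅Jm, J₀⁆ = Jm := by rw [← lie_skew, h2, neg_neg]
  have h1' : ⁅Jp, J₀⁆ = -Jp := by rw [← lie_skew, h1]
  have h3' : ⁅Jm, Jp⁆ = -(2 : ℂ) • J₀ := by rw [← lie_skew, h3, neg_smul]
  have hA : (Complex.I * ((A : ℤ) : ℂ)) * (Complex.I * ((A : ℤ) : ℂ)) = -1 := by
    rcases Int.units_eq_one_or A with rfl | rfl <;> simp
  { J₀ := J₀
    Jp := Jp
    Jm := Jm
    K₀ := (Complex.I * ((A : ℤ) : ℂ)) • J₀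
    Kp := (Complex.I * ((A : ℤ) : ℂ)) • Jp
    Km := (Complex.I * ((A : ℤ) : ℂ)) • Jm
    J₀_Jp := h1
    J₀_Jm := h2
    Jp_Jm := h3
    J₀_K₀ := by rw [lie_smul, lie_self, smul_zero]
    J₀_Kp := by rw [lie_smul, h1]
    J₀_Km := by rw [lie_smul, h2, smul_neg]
    Jp_K₀ := by rw [lie_smul, h1', smul_neg]
    Jp_Kp := by rw [lie_smul, lie_self, smul_zero]
    Jp_Km := by rw [lie_smul, h3, smul_comm]
    Jm_K₀ := by rw [lie_smul, h2']
    Jm_Kp := by rw [lie_smul, h3', smul_comm]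
    Jm_Km := by rw [lie_smul, lie_self, smul_zero]
    K₀_Kp := by rw [lie_smul, smul_lie, h1, smul_smul, hA, neg_one_smul]
    K₀_Km := by rw [lie_smul, smul_lie, h2, smul_smul, hA, neg_one_smul, neg_neg]
    Kp_Km := by rw [lie_smul, smul_lie, h3, smul_smul, hA, neg_one_smul, neg_smul] }

theorem Pminus_bot {l : ℤ} {rho j : ℂ} (hj : j = ((|l| : ℤ) : ℂ) / 2) :
    Pminus (l / 2) rho j = 0 := by
  have : j - l / 2 = 0 ∨ j + l / 2 = 0 := by
    subst hj
    rcases abs_choice l with h | h <;> rw [h]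
    · left; ring
    · right; push_cast; ring
  rcases this with h | h <;> simp [Pminus, h, Complex.sqrt]

theorem stable_V {l : ℤ} {rho : ℂ} {n : ℤ} (hn : n ∈ spins l rho) :
    (Pplus (l / 2) rho (n / 2) ≠ 0 → n + 2 ∈ spins l rho) ∧
      (Pminus (l / 2) rho (n / 2) ≠ 0 → n - 2 ∈ spins l rho) := by
  obtain ⟨⟨k, rfl⟩, h⟩ := hn
  constructor
  · intro h0
    refine ⟨⟨k + 1, by push_cast; ring⟩, fun i hi => ?_⟩
    rcases (show i = k ∨ |l| + 2 * (i : ℤ) < |l| + 2 * k by omega) with rfl | h1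
    · exact h0
    · exact h i h1
  · intro h0
    rcases k with _ | k
    · exact absurd (Pminus_bot (by push_cast; simp)) h0
    · refine ⟨⟨k, by push_cast; ring⟩, fun i hi => h i (by omega)⟩

theorem P_facts {l : ℤ} {rho : ℂ} {n : ℤ} (hn : n ∈ spins l rho) {j : ℂ} (hj : j = n / 2) :
    (j = 0 ∨ (2 * j + 3) * Pminus (l / 2) rho (j + 1) ^ 2 - Pzero (l / 2) rho j ^ 2
      - (2 * j - 1) * Pminus (l / 2) rho j ^ 2 = 1) ∧
    j * Pzero (l / 2) rho j = (j + 2) * Pzero (l / 2) rho (j + 1) ∧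
    Pminus (l / 2) rho j * ((j - 1) * Pzero (l / 2) rho (j - 1) - (j + 1) * Pzero (l / 2) rho j) = 0
    := by
  obtain ⟨⟨k, rfl⟩, -⟩ := hn
  have key : ∀ (k : ℕ) (j : ℂ), j = ((|l| + 2 * k : ℤ) : ℂ) / 2 →
      j * Pzero (l / 2) rho j = (j + 2) * Pzero (l / 2) rho (j + 1) := by
    intro k j hj
    have e1 : j + 1 ≠ 0 := by
      have : ((|l| + 2 * k + 2 : ℤ) : ℂ) ≠ 0 := by
        have := abs_nonneg l
        exact_mod_cast (by omega : |l| + 2 * (k : ℤ) + 2 ≠ 0)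
      intro e; apply this; push_cast at hj ⊢; linear_combination 2 * e - 2 * hj
    have e2 : j + 2 ≠ 0 := by
      have : ((|l| + 2 * k + 4 : ℤ) : ℂ) ≠ 0 := by
        have := abs_nonneg l
        exact_mod_cast (by omega : |l| + 2 * (k : ℤ) + 4 ≠ 0)
      intro e; apply this; push_cast at hj ⊢; linear_combination 2 * e - 2 * hj
    have e3 : j + 1 + 1 ≠ 0 := by convert e2 using 1; ring
    by_cases h0 : j = 0
    · have : l = 0 := by
        have : ((|l| + 2 * k : ℤ) : ℂ) = 0 := by linear_combination 2 * h0 - 2 * hj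
        have : |l| + 2 * (k : ℤ) = 0 := by exact_mod_cast this
        have := abs_nonneg l
        exact abs_eq_zero.1 (by omega)
      subst this; simp [Pzero]
    · simp only [Pzero, h0, e1, if_false]
      field_simp
      ring
  have hl : |l| ≥ 0 := abs_nonneg l
  have hj0 : ∀ c : ℤ, |l| + 2 * (k : ℤ) + c ≠ 0 → 2 * j + c ≠ 0 := by
    intro c hc
    have : ((|l| + 2 * k + c : ℤ) : ℂ) ≠ 0 := by exact_mod_cast hc
    intro e; apply this; push_cast at hj ⊢; linear_combination e - 2 * hj
  refine ⟨?_, key k j hj, ?_⟩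
  · by_cases h0 : j = 0
    · exact Or.inl h0
    right
    have e1 : j + 1 ≠ 0 := by
      have := hj0 2 (by omega)
      intro e; apply this; push_cast; linear_combination 2 * e
    have e2 : 2 * j + 1 ≠ 0 := by simpa using hj0 1 (by omega)
    have e3 : 2 * j + 3 ≠ 0 := by simpa using hj0 3 (by omega)
    have hP : ∀ x : ℂ, Pminus (l / 2) rho x ^ 2 = ((x + l / 2) * (x - l / 2) * (x + rho) * (x - rho))
        / (x ^ 2 * (2 * x + 1) * (2 * x - 1)) := by
      intro x; simp only [Pminus, div_pow, mul_pow, sqrt_sq]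
    have f1 : (2 * j + 3) * Pminus (l / 2) rho (j + 1) ^ 2 =
        ((j + 1) ^ 2 - (l / 2) ^ 2) * ((j + 1) ^ 2 - rho ^ 2) / ((j + 1) ^ 2 * (2 * j + 1)) := by
      rw [hP, show 2 * (j + 1) + 1 = 2 * j + 3 by ring, show 2 * (j + 1) - 1 = 2 * j + 1 by ring]
      field_simp
      ring
    have f2 : (2 * j - 1) * Pminus (l / 2) rho j ^ 2 =
        (j ^ 2 - (l / 2) ^ 2) * (j ^ 2 - rho ^ 2) / (j ^ 2 * (2 * j + 1)) := by
      by_cases e4 : 2 * j - 1 = 0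
      · have h1 : ((|l| + 2 * k - 1 : ℤ) : ℂ) = 0 := by
          push_cast at hj ⊢; linear_combination e4 - 2 * hj
        have h1 : |l| + 2 * (k : ℤ) - 1 = 0 := by exact_mod_cast h1
        have h2 : |l| = 1 := by omega
        have h3 : (l : ℂ) ^ 2 = 1 := by
          have : l ^ 2 = 1 := by rw [← sq_abs, h2]; rfl
          exact_mod_cast this
        have : j ^ 2 - ((l : ℂ) / 2) ^ 2 = 0 := by linear_combination (2 * j + 1) / 4 * e4 - h3 / 4
        rw [e4, this]; simp
      · rw [hP]
        field_simp
        ring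
    have f3 : Pzero (l / 2) rho j ^ 2 = -(l / 2 * rho) ^ 2 / (j ^ 2 * (j + 1) ^ 2) := by
      simp only [Pzero, h0, if_false, div_pow, mul_pow, Complex.I_sq]
      ring
    rw [f1, f2, f3, div_sub_div _ _ (by positivity) (by positivity),
      div_sub_div _ _ (by positivity) (by positivity), div_eq_one_iff_eq (by positivity)]
    ring
  · rcases k with _ | k
    · rw [Pminus_bot (by rw [hj]; simp), zero_mul]
    · have := key k (j - 1) (by rw [hj]; push_cast; ring)
      rw [sub_add_cancel] at this
      rw [this]; ring

/-- The operator `K₀` on `V_{λ,ρ}`, `λ = l/2`. -/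
noncomputable abbrev opK₀ (l : ℤ) (rho : ℂ) : Module.End ℂ (Kets (basisSet l rho)) :=
  ladder _ 0
    (fun j m => Pplus (l / 2) rho j * Complex.sqrt (j + m + 1) * Complex.sqrt (j - m + 1))
    (fun j m => Pzero (l / 2) rho j * m)
    (fun j m => Pminus (l / 2) rho j * Complex.sqrt (j + m) * Complex.sqrt (j - m))

/-- The operator `K₊` on `V_{λ,ρ}`, `λ = l/2`. -/
noncomputable abbrev opKp (l : ℤ) (rho : ℂ) : Module.End ℂ (Kets (basisSet l rho)) :=
  ladder _ 1
    (fun j m => -Pplus (l / 2) rho j * Complex.sqrt (j + m + 1) * Complex.sqrt (j + m + 2))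
    (fun j m => Pzero (l / 2) rho j * Cp j m)
    (fun j m => Pminus (l / 2) rho j * Complex.sqrt (j - m) * Complex.sqrt (j - m - 1))

/-- The operator `K₋` on `V_{λ,ρ}`, `λ = l/2`. -/
noncomputable abbrev opKm (l : ℤ) (rho : ℂ) : Module.End ℂ (Kets (basisSet l rho)) :=
  ladder _ (-1)
    (fun j m => Pplus (l / 2) rho j * Complex.sqrt (j - m + 1) * Complex.sqrt (j - m + 2))
    (fun j m => Pzero (l / 2) rho j * Cm j m)
    (fun j m => -Pminus (l / 2) rho j * Complex.sqrt (j + m) * Complex.sqrt (j + m - 1))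

theorem down_ne {n q a b : ℤ} (h : Complex.sqrt ((n : ℂ) / 2 + a * (q / 2) + b) ≠ 0) :
    n + a * q + 2 * b ≠ 0 := cast_half_ne (sqrt_ne h)

theorem K₀_stable (l : ℤ) (rho : ℂ) : IsStable (basisSet l rho) 0
    (fun j m => Pplus (l / 2) rho j * Complex.sqrt (j + m + 1) * Complex.sqrt (j - m + 1))
    (fun j m => Pzero (l / 2) rho j * m)
    (fun j m => Pminus (l / 2) rho j * Complex.sqrt (j + m) * Complex.sqrt (j - m)) := by
  rintro n q ⟨hn, h1, h2, h3⟩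
  dsimp only at hn h1 h2 h3
  refine ⟨fun h => ?_, fun h => ?_, fun h => ?_⟩
  · obtain ⟨⟨h4, -⟩, -⟩ := And.imp_left mul_ne_zero_iff.1 (mul_ne_zero_iff.1 h)
    exact ⟨(stable_V hn).1 h4, by refine ⟨?_, ?_, ?_⟩ <;> dsimp only <;> omega⟩
  · exact ⟨hn, by refine ⟨?_, ?_, ?_⟩ <;> dsimp only <;> omega⟩
  · obtain ⟨⟨h4, h5⟩, h6⟩ := And.imp_left mul_ne_zero_iff.1 (mul_ne_zero_iff.1 h)
    have h5 := down_ne (n := n) (q := q) (a := 1) (b := 0) (by simpa using h5)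
    have h6 := down_ne (n := n) (q := q) (a := -1) (b := 0) (by simpa [sub_eq_add_neg] using h6)
    exact ⟨(stable_V hn).2 h4, by refine ⟨?_, ?_, ?_⟩ <;> dsimp only <;> omega⟩

theorem Kp_stable (l : ℤ) (rho : ℂ) : IsStable (basisSet l rho) 1
    (fun j m => -Pplus (l / 2) rho j * Complex.sqrt (j + m + 1) * Complex.sqrt (j + m + 2))
    (fun j m => Pzero (l / 2) rho j * Cp j m)
    (fun j m => Pminus (l / 2) rho j * Complex.sqrt (j - m) * Complex.sqrt (j - m - 1)) := by
  rintro n q ⟨hn, h1, h2, h3⟩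
  dsimp only at hn h1 h2 h3
  refine ⟨fun h => ?_, fun h => ?_, fun h => ?_⟩
  · obtain ⟨⟨h4, -⟩, -⟩ := And.imp_left mul_ne_zero_iff.1 (mul_ne_zero_iff.1 h)
    exact ⟨(stable_V hn).1 (neg_ne_zero.1 h4), by refine ⟨?_, ?_, ?_⟩ <;> dsimp only <;> omega⟩
  · exact ⟨hn, Cp_stable ⟨h1, h2, h3⟩ (left_ne_zero_of_mul (right_ne_zero_of_mul h))⟩
  · obtain ⟨⟨h4, h5⟩, h6⟩ := And.imp_left mul_ne_zero_iff.1 (mul_ne_zero_iff.1 h)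
    have h5 := down_ne (n := n) (q := q) (a := -1) (b := 0) (by simpa [sub_eq_add_neg] using h5)
    have h6 := down_ne (n := n) (q := q) (a := -1) (b := -1) (by simpa [sub_eq_add_neg] using h6)
    exact ⟨(stable_V hn).2 h4, by refine ⟨?_, ?_, ?_⟩ <;> dsimp only <;> omega⟩

theorem Km_stable (l : ℤ) (rho : ℂ) : IsStable (basisSet l rho) (-1)
    (fun j m => Pplus (l / 2) rho j * Complex.sqrt (j - m + 1) * Complex.sqrt (j - m + 2))
    (fun j m => Pzero (l / 2) rho j * Cm j m)
    (fun j m => -Pminus (l / 2) rho j * Complex.sqrt (j + m) * Complex.sqrt (j + m - 1)) := by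
  rintro n q ⟨hn, h1, h2, h3⟩
  dsimp only at hn h1 h2 h3
  refine ⟨fun h => ?_, fun h => ?_, fun h => ?_⟩
  · obtain ⟨⟨h4, -⟩, -⟩ := And.imp_left mul_ne_zero_iff.1 (mul_ne_zero_iff.1 h)
    exact ⟨(stable_V hn).1 h4, by refine ⟨?_, ?_, ?_⟩ <;> dsimp only <;> omega⟩
  · exact ⟨hn, Cm_stable ⟨h1, h2, h3⟩ (left_ne_zero_of_mul (right_ne_zero_of_mul h))⟩
  · obtain ⟨⟨h4, h5⟩, h6⟩ := And.imp_left mul_ne_zero_iff.1 (mul_ne_zero_iff.1 h)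
    have h5 := down_ne (n := n) (q := q) (a := 1) (b := 0) (by simpa using h5)
    have h6 := down_ne (n := n) (q := q) (a := 1) (b := -1) (by simpa [sub_eq_add_neg] using h6)
    exact ⟨(stable_V hn).2 (neg_ne_zero.1 h4),
      by refine ⟨?_, ?_, ?_⟩ <;> dsimp only <;> omega⟩

theorem V_J₀_K₀ (l : ℤ) (rho : ℂ) :
    ⁅opJ₀ (basisSet l rho), opK₀ l rho⁆ = 0 := by
  refine (ladder_lie (α := 0) (J₀_stable _) (K₀_stable l rho) rfl ?_).trans
    (zero_smul _ (opK₀ l rho))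
  intro n q _ j m _ _
  push_cast
  refine ⟨?_, ?_, ?_, ?_, ?_⟩ <;> ring_nf

theorem V_J₀_Kp (l : ℤ) (rho : ℂ) :
    ⁅opJ₀ (basisSet l rho), opKp l rho⁆ = opKp l rho := by
  refine (ladder_lie (α := 1) (J₀_stable _) (Kp_stable l rho) rfl ?_).trans (one_smul _ _)
  intro n q _ j m _ _
  push_cast
  refine ⟨?_, ?_, ?_, ?_, ?_⟩ <;> ring_nf

theorem V_J₀_Km (l : ℤ) (rho : ℂ) :
    ⁅opJ₀ (basisSet l rho), opKm l rho⁆ = -opKm l rho := by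
  refine (ladder_lie (α := -1) (J₀_stable _) (Km_stable l rho) rfl ?_).trans (neg_one_smul _ _)
  intro n q _ j m _ _
  push_cast
  refine ⟨?_, ?_, ?_, ?_, ?_⟩ <;> ring_nf

theorem V_Jp_K₀ (l : ℤ) (rho : ℂ) :
    ⁅opJp (basisSet l rho), opK₀ l rho⁆ = -opKp l rho := by
  refine (ladder_lie (α := -1) (Jp_stable (weightClosed_basisSet l rho)) (K₀_stable l rho) rfl ?_).trans (neg_one_smul _ _)
  intro n q _ j m _ _
  push_cast
  simp only [Cp]
  refine ⟨?_, ?_, ?_, ?_, ?_⟩ <;> ring_nf <;> simp only [sqrt_sq] <;> ring_nf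

theorem V_Jp_Kp (l : ℤ) (rho : ℂ) :
    ⁅opJp (basisSet l rho), opKp l rho⁆ = 0 := by
  refine (ladder_lie (α := 0) (Jp_stable (weightClosed_basisSet l rho)) (Kp_stable l rho) rfl ?_).trans
    (zero_smul _ (ladder _ 2 (fun _ _ => 0) (fun _ _ => 0) (fun _ _ => 0)))
  intro n q _ j m _ _
  push_cast
  simp only [Cp]
  refine ⟨?_, ?_, ?_, ?_, ?_⟩ <;> ring_nf

theorem V_Jp_Km (l : ℤ) (rho : ℂ) :
    ⁅opJp (basisSet l rho), opKm l rho⁆ = (2 : ℂ) • opK₀ l rho := by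
  refine (ladder_lie (α := 2) (Jp_stable (weightClosed_basisSet l rho)) (Km_stable l rho) rfl ?_)
  intro n q _ j m _ _
  push_cast
  simp only [Cp, Cm]
  refine ⟨?_, ?_, ?_, ?_, ?_⟩ <;> ring_nf <;> simp only [sqrt_sq] <;> ring_nf

theorem V_Jm_K₀ (l : ℤ) (rho : ℂ) :
    ⁅opJm (basisSet l rho), opK₀ l rho⁆ = opKm l rho := by
  refine (ladder_lie (α := 1) (Jm_stable (weightClosed_basisSet l rho)) (K₀_stable l rho) rfl ?_).trans (one_smul _ _)
  intro n q _ j m _ _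
  push_cast
  simp only [Cm]
  refine ⟨?_, ?_, ?_, ?_, ?_⟩ <;> ring_nf <;> simp only [sqrt_sq] <;> ring_nf

theorem V_Jm_Kp (l : ℤ) (rho : ℂ) :
    ⁅opJm (basisSet l rho), opKp l rho⁆ = -(2 : ℂ) • opK₀ l rho := by
  refine (ladder_lie (α := -2) (Jm_stable (weightClosed_basisSet l rho)) (Kp_stable l rho) rfl ?_)
  intro n q _ j m _ _
  push_cast
  simp only [Cp, Cm]
  refine ⟨?_, ?_, ?_, ?_, ?_⟩ <;> ring_nf <;> simp only [sqrt_sq] <;> ring_nf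

theorem V_Jm_Km (l : ℤ) (rho : ℂ) :
    ⁅opJm (basisSet l rho), opKm l rho⁆ = 0 := by
  refine (ladder_lie (α := 0) (s₃ := -2) (Jm_stable (weightClosed_basisSet l rho)) (Km_stable l rho) rfl ?_).trans
    (zero_smul _ (ladder _ (-2) (fun _ _ => 0) (fun _ _ => 0) (fun _ _ => 0)))
  intro n q _ j m _ _
  push_cast
  simp only [Cm]
  refine ⟨?_, ?_, ?_, ?_, ?_⟩ <;> ring_nf

theorem K_facts {l : ℤ} {rho : ℂ} {n q : ℤ} (h : (n, q) ∈ basisSet l rho) {j m : ℂ}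
    (hj : j = n / 2) (hm : m = q / 2) :
    (Complex.sqrt (j - m) * ((2 * j + 3) * Pminus (l / 2) rho (j + 1) ^ 2 - Pzero (l / 2) rho j ^ 2
      - (2 * j - 1) * Pminus (l / 2) rho j ^ 2 - 1) = 0 ∧
     Complex.sqrt (j + m) * ((2 * j + 3) * Pminus (l / 2) rho (j + 1) ^ 2 - Pzero (l / 2) rho j ^ 2
      - (2 * j - 1) * Pminus (l / 2) rho j ^ 2 - 1) = 0 ∧
     m * ((2 * j + 3) * Pminus (l / 2) rho (j + 1) ^ 2 - Pzero (l / 2) rho j ^ 2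
      - (2 * j - 1) * Pminus (l / 2) rho j ^ 2 - 1) = 0) ∧
    j * Pzero (l / 2) rho j = (j + 2) * Pzero (l / 2) rho (j + 1) ∧
    Pminus (l / 2) rho j * ((j - 1) * Pzero (l / 2) rho (j - 1) - (j + 1) * Pzero (l / 2) rho j)
      = 0 := by
  obtain ⟨hn, h1, h2, h3⟩ := h
  dsimp only at hn h1 h2 h3
  obtain ⟨f1, f2, f3⟩ := P_facts hn hj
  refine ⟨?_, f2, f3⟩
  rcases f1 with h0 | f1
  · have hn0 : (n : ℂ) = 0 := by linear_combination 2 * h0 - 2 * hj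
    have hn0 : n = 0 := by exact_mod_cast hn0
    have hq0 : q = 0 := by omega
    have hm0 : m = 0 := by rw [hm, hq0]; simp
    simp [h0, hm0, Complex.sqrt]
  · simp [f1]

theorem V_K₀_Kp (l : ℤ) (rho : ℂ) :
    ⁅opK₀ l rho, opKp l rho⁆ = -opJp (basisSet l rho) := by
  refine (ladder_lie (α := -1) (K₀_stable l rho) (Kp_stable l rho) rfl ?_).trans (neg_one_smul _ _)
  intro n q h j m hj hm
  obtain ⟨e1, e2, e3⟩ := K_facts h hj hm
  simp only [Pplus, sub_add_cancel, Cp, Cm]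
  push_cast
  refine ⟨?_, ?_, ?_, ?_, ?_⟩
  · ring_nf
  · linear_combination (norm := (ring_nf; simp only [sqrt_sq]; ring_nf)) Pminus (l / 2) rho (j + 1) * Complex.sqrt (j + m + 1) * Complex.sqrt (j + m + 2) * e2
  · linear_combination (norm := (ring_nf; simp only [sqrt_sq]; ring_nf)) -Complex.sqrt (j + m + 1) * e1.1
  · linear_combination (norm := (ring_nf; simp only [sqrt_sq]; ring_nf)) -Complex.sqrt (j - m) * Complex.sqrt (j - m - 1) * e3
  · ring_nf

theorem V_K₀_Km (l : ℤ) (rho : ℂ) :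
    ⁅opK₀ l rho, opKm l rho⁆ = opJm (basisSet l rho) := by
  refine (ladder_lie (α := 1) (K₀_stable l rho) (Km_stable l rho) rfl ?_).trans (one_smul _ _)
  intro n q h j m hj hm
  obtain ⟨e1, e2, e3⟩ := K_facts h hj hm
  simp only [Pplus, sub_add_cancel, Cp, Cm]
  push_cast
  refine ⟨?_, ?_, ?_, ?_, ?_⟩
  · ring_nf
  · linear_combination (norm := (ring_nf; simp only [sqrt_sq]; ring_nf)) Pminus (l / 2) rho (j + 1) * Complex.sqrt (j - m + 1) * Complex.sqrt (j - m + 2) * e2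
  · linear_combination (norm := (ring_nf; simp only [sqrt_sq]; ring_nf)) Complex.sqrt (j - m + 1) * e1.2.1
  · linear_combination (norm := (ring_nf; simp only [sqrt_sq]; ring_nf)) -Complex.sqrt (j + m) * Complex.sqrt (j + m - 1) * e3
  · ring_nf

theorem V_Kp_Km (l : ℤ) (rho : ℂ) :
    ⁅opKp l rho, opKm l rho⁆ = -(2 : ℂ) • opJ₀ (basisSet l rho) := by
  refine (ladder_lie (α := -2) (Kp_stable l rho) (Km_stable l rho) rfl ?_)
  intro n q h j m hj hm
  obtain ⟨e1, e2, e3⟩ := K_facts h hj hm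
  simp only [Pplus, sub_add_cancel, Cp, Cm]
  push_cast
  refine ⟨?_, ?_, ?_, ?_, ?_⟩
  · ring_nf
  · linear_combination (norm := (ring_nf; simp only [sqrt_sq]; ring_nf)) -2 * Pminus (l / 2) rho (j + 1) * Complex.sqrt (j + m + 1) * Complex.sqrt (j - m + 1) * e2
  · linear_combination (norm := (ring_nf; simp only [sqrt_sq]; ring_nf)) -2 * e1.2.2
  · linear_combination (norm := (ring_nf; simp only [sqrt_sq]; ring_nf)) -2 * Complex.sqrt (j + m) * Complex.sqrt (j - m) * e3
  · ring_nf

/-- The ladder operators on `V_{λ,ρ}`, `λ = l/2`. -/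
noncomputable def repV (l : ℤ) (rho : ℂ) : LadderRep (Kets (basisSet l rho)) where
  J₀ := opJ₀ _
  Jp := opJp _
  Jm := opJm _
  K₀ := opK₀ l rho
  Kp := opKp l rho
  Km := opKm l rho
  J₀_Jp := (su2_rel (weightClosed_basisSet l rho)).1
  J₀_Jm := (su2_rel (weightClosed_basisSet l rho)).2.1
  Jp_Jm := (su2_rel (weightClosed_basisSet l rho)).2.2
  J₀_K₀ := V_J₀_K₀ l rho
  J₀_Kp := V_J₀_Kp l rho
  J₀_Km := V_J₀_Km l rho
  Jp_K₀ := V_Jp_K₀ l rho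
  Jp_Kp := V_Jp_Kp l rho
  Jp_Km := V_Jp_Km l rho
  Jm_K₀ := V_Jm_K₀ l rho
  Jm_Kp := V_Jm_Kp l rho
  Jm_Km := V_Jm_Km l rho
  K₀_Kp := V_K₀_Kp l rho
  K₀_Km := V_K₀_Km l rho
  Kp_Km := V_Kp_Km l rho

/-- The module `F^A_γ`, `γ = n/2`, `A = ±1`: its basis is `|γ, μ⟩`, `μ ∈ {-γ, …, γ}`, the operators `J`
act by the spin-`γ` representation of `su(2)`, and `K = i A J`. It is `(γ,0)` for `A = -1` and
`(0,γ)` for `A = 1`. -/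
def F (_A : ℤˣ) (n : ℕ) : Type := Kets (spinSet n)

noncomputable instance (A : ℤˣ) (n : ℕ) : AddCommGroup (F A n) :=
  inferInstanceAs (AddCommGroup (Kets (spinSet n)))

noncomputable instance (A : ℤˣ) (n : ℕ) : Module ℂ (F A n) :=
  inferInstanceAs (Module ℂ (Kets (spinSet n)))

/-- The ladder operators on `F^A_γ`, `γ = n/2`. -/
noncomputable def repF (A : ℤˣ) (n : ℕ) : LadderRep (F A n) :=
  (LadderRep.ofSU2 (su2_rel (weightClosed_spinSet n)).1 (su2_rel (weightClosed_spinSet n)).2.1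
    (su2_rel (weightClosed_spinSet n)).2.2 A : LadderRep (Kets (spinSet n)))

noncomputable instance (A : ℤˣ) (n : ℕ) : LieRingModule Spin31 (F A n) :=
  LieRingModule.compLieHom (F A n) (repF A n).toLieHom

instance (A : ℤˣ) (n : ℕ) : LieModule ℂ Spin31 (F A n) :=
  LieModule.compLieHom (F A n) (repF A n).toLieHom

/-- The module `V_{λ,ρ}`, `λ = l/2`: the algebraic direct sum of the `SU(2)`-multiplets
`|(λ,ρ) j, m⟩`, with the standard action of `J` and `K` on this basis. -/
def V (l : ℤ) (rho : ℂ) : Type := Kets (basisSet l rho)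

noncomputable instance (l : ℤ) (rho : ℂ) : AddCommGroup (V l rho) :=
  inferInstanceAs (AddCommGroup (Kets (basisSet l rho)))

noncomputable instance (l : ℤ) (rho : ℂ) : Module ℂ (V l rho) :=
  inferInstanceAs (Module ℂ (Kets (basisSet l rho)))

noncomputable instance (l : ℤ) (rho : ℂ) : LieRingModule Spin31 (V l rho) :=
  LieRingModule.compLieHom (V l rho) (show LadderRep (V l rho) from repV l rho).toLieHom

instance (l : ℤ) (rho : ℂ) : LieModule ℂ Spin31 (V l rho) :=
  LieModule.compLieHom (V l rho) (show LadderRep (V l rho) from repV l rho).toLieHom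

/-- A Lorentz `(𝔤,K)`-module, `𝔤 = spin(3,1)`, `K = SU(2)`: a `𝔤_ℂ`-module in which every vector lies in
a finite-dimensional subspace that is stable under `𝔨_ℂ`, the span of `J 0, J 1, J 2`. As `SU(2)` is
compact, connected and simply connected, the action of `𝔨` integrates in exactly one way to a
locally finite action of `K` with the right differential; this action is compatible with that of
`𝔤`, and it is preserved by `𝔤`-submodules and `𝔤`-linear maps, so it is not carried as
separate data. -/
class GKModule (W : Type*) [AddCommGroup W] [Module ℂ W] [LieRingModule Spin31 W]
    [LieModule ℂ Spin31 W] : Prop where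
  locally_finite : ∀ w : W, ∃ U : Submodule ℂ W, FiniteDimensional ℂ U ∧ w ∈ U ∧
    ∀ a : Fin 3, ∀ u ∈ U, ⁅Spin31.J a, u⁆ ∈ U

theorem ladder_mem {S : Set (ℤ × ℤ)} {s : ℤ} {f : ℂ → ℂ → ℂ} {n : ℤ} {U : Submodule ℂ (Kets S)}
    (hU : U = Submodule.span ℂ (ket S n '' Set.Icc (-n) n)) (hket : ∀ q, ket S n q ∈ U) :
    ∀ u ∈ U, ladder S s (fun _ _ => 0) f (fun _ _ => 0) u ∈ U := by
  intro u hu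
  have : U ≤ U.comap (ladder S s (fun _ _ => 0) f (fun _ _ => 0)) := by
    conv_lhs => rw [hU]
    rw [Submodule.span_le]
    rintro _ ⟨q, -, rfl⟩
    change ladder S s (fun _ _ => 0) f (fun _ _ => 0) (ket S n q) ∈ U
    by_cases h : (n, q) ∈ S
    · have := ladder_smul_ket (s := s) (up := fun _ _ => 0) (mid := f) (down := fun _ _ => 0)
        (c := 1) fun _ => h
      rw [one_smul, one_smul] at this
      rw [this, ladderKet, zero_smul, zero_smul, zero_add, add_zero]
      exact U.smul_mem _ (hket _)
    · rw [ket, dif_neg h, map_zero]; exact U.zero_mem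
  exact this hu

theorem kets_locally_finite {S : Set (ℤ × ℤ)} (hS : WeightClosed S) (w : Kets S) :
    ∃ U : Submodule ℂ (Kets S), FiniteDimensional ℂ U ∧ w ∈ U ∧
      ∀ u ∈ U, opJ₀ S u ∈ U ∧ opJp S u ∈ U ∧ opJm S u ∈ U := by
  have hw : w ∈ Submodule.span ℂ (Set.range (ketBasis S)) := by
    rw [(ketBasis S).span_eq]; trivial
  induction hw using Submodule.span_induction with
  | zero => exact ⟨⊥, inferInstance, Submodule.zero_mem _, fun u hu => by
      rw [Submodule.mem_bot] at hu; simp [hu]⟩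
  | add v w _ _ hv hw =>
    obtain ⟨U, h1, h2, h3⟩ := hv
    obtain ⟨U', h1', h2', h3'⟩ := hw
    refine ⟨U ⊔ U', inferInstance, Submodule.add_mem_sup h2 h2', fun u hu => ?_⟩
    obtain ⟨x, hx, y, hy, rfl⟩ := Submodule.mem_sup.1 hu
    simp only [map_add]
    exact ⟨Submodule.add_mem_sup (h3 x hx).1 (h3' y hy).1,
      Submodule.add_mem_sup (h3 x hx).2.1 (h3' y hy).2.1,
      Submodule.add_mem_sup (h3 x hx).2.2 (h3' y hy).2.2⟩
  | smul c w _ hw =>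
    obtain ⟨U, h1, h2, h3⟩ := hw
    exact ⟨U, h1, U.smul_mem c h2, h3⟩
  | mem w hw =>
    obtain ⟨⟨⟨n, q⟩, hp⟩, rfl⟩ := hw
    have hket : ∀ q, ket S n q ∈ Submodule.span ℂ (ket S n '' Set.Icc (-n) n) := by
      intro q
      by_cases h : (n, q) ∈ S
      · exact Submodule.subset_span ⟨q, ⟨(hS n q h).1.1, (hS n q h).1.2.1⟩, rfl⟩
      · rw [ket, dif_neg h]; exact Submodule.zero_mem _
    refine ⟨_, FiniteDimensional.span_of_finite ℂ ((Set.finite_Icc (-n) n).image (ket S n)), ?_,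
      fun u hu => ⟨ladder_mem rfl hket u hu, ladder_mem rfl hket u hu, ladder_mem rfl hket u hu⟩⟩
    have := hket q
    rwa [ket, dif_pos hp] at this

theorem LadderRep.toLieHom_J_mem {W : Type*} [AddCommGroup W] [Module ℂ W] (r : LadderRep W)
    {U : Submodule ℂ W} {u : W} (h₀ : r.J₀ u ∈ U) (hp : r.Jp u ∈ U) (hm : r.Jm u ∈ U)
    (a : Fin 3) : r.toLieHom (Spin31.J a) u ∈ U := by
  change r.toFun (Spin31.J a) u ∈ U
  simp only [LadderRep.toFun, LinearMap.add_apply, LinearMap.smul_apply]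
  have hK : ∀ b, (Spin31.J a).2 b = 0 := fun _ => rfl
  simp only [hK, mul_zero, sub_zero, add_zero, zero_div, zero_smul]
  exact U.add_mem (U.add_mem (U.smul_mem _ h₀) (U.smul_mem _ hp)) (U.smul_mem _ hm)

instance (A : ℤˣ) (n : ℕ) : GKModule (F A n) where
  locally_finite w := by
    obtain ⟨U, h1, h2, h3⟩ := kets_locally_finite (weightClosed_spinSet n) w
    exact ⟨U, h1, h2, fun a u hu =>
      (repF A n).toLieHom_J_mem (h3 u hu).1 (h3 u hu).2.1 (h3 u hu).2.2 a⟩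

instance (l : ℤ) (rho : ℂ) : GKModule (V l rho) where
  locally_finite w := by
    obtain ⟨U, h1, h2, h3⟩ := kets_locally_finite (weightClosed_basisSet l rho) w
    exact ⟨U, h1, h2, fun a u hu =>
      (repV l rho).toLieHom_J_mem (h3 u hu).1 (h3 u hu).2.1 (h3 u hu).2.2 a⟩

section

variable {W W' : Type*} [AddCommGroup W] [Module ℂ W] [LieRingModule Spin31 W]
  [LieModule ℂ Spin31 W] [AddCommGroup W'] [Module ℂ W'] [LieRingModule Spin31 W']
  [LieModule ℂ Spin31 W']

instance [GKModule W] [GKModule W'] : GKModule (W ⊗[ℂ] W') where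
  locally_finite w := by
    induction w using TensorProduct.induction_on with
    | zero => exact ⟨⊥, inferInstance, Submodule.zero_mem _, fun a u hu => by
        rw [Submodule.mem_bot] at hu; simp [hu]⟩
    | tmul x y =>
      obtain ⟨U, h1, h2, h3⟩ := GKModule.locally_finite x
      obtain ⟨U', h1', h2', h3'⟩ := GKModule.locally_finite y
      refine ⟨LinearMap.range (TensorProduct.map U.subtype U'.subtype), inferInstance,
        ⟨(⟨x, h2⟩ : U) ⊗ₜ (⟨y, h2'⟩ : U'), rfl⟩, ?_⟩
      rintro a _ ⟨t, rfl⟩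
      induction t using TensorProduct.induction_on with
      | zero => simp
      | tmul u u' =>
        simp only [TensorProduct.map_tmul, Submodule.subtype_apply,
          TensorProduct.LieModule.lie_tmul_right]
        exact Submodule.add_mem _ ⟨(⟨_, h3 a u u.2⟩ : U) ⊗ₜ u', rfl⟩
          ⟨u ⊗ₜ (⟨_, h3' a u' u'.2⟩ : U'), rfl⟩
      | add s t hs ht => rw [map_add, lie_add]; exact Submodule.add_mem _ hs ht
    | add v w hv hw =>
      obtain ⟨U, h1, h2, h3⟩ := hv
      obtain ⟨U', h1', h2', h3'⟩ := hw
      refine ⟨U ⊔ U', inferInstance, Submodule.add_mem_sup h2 h2', fun a u hu => ?_⟩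
      obtain ⟨x, hx, y, hy, rfl⟩ := Submodule.mem_sup.1 hu
      rw [lie_add]
      exact Submodule.add_mem_sup (h3 a x hx) (h3' a y hy)

instance [GKModule W] (E : LieSubmodule ℂ Spin31 W) : GKModule E where
  locally_finite w := by
    obtain ⟨U, h1, h2, h3⟩ := GKModule.locally_finite (w : W)
    refine ⟨U.comap (E : Submodule ℂ W).subtype, ?_, h2, fun a u hu => h3 a u hu⟩
    exact Module.Finite.of_injective
      (((E : Submodule ℂ W).subtype).restrict (p := U.comap (E : Submodule ℂ W).subtype) (q := U)
        fun _ h => h) fun x y h => by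
          apply Subtype.ext; apply Subtype.ext; exact congrArg (fun z : U => (z : W)) h

/-- Isomorphism of Lorentz `(𝔤,K)`-modules. -/
def GKModule.Iso (W W' : Type*) [AddCommGroup W] [Module ℂ W] [LieRingModule Spin31 W]
    [LieModule ℂ Spin31 W] [AddCommGroup W'] [Module ℂ W'] [LieRingModule Spin31 W']
    [LieModule ℂ Spin31 W'] [GKModule W] [GKModule W'] : Prop :=
  Nonempty (W ≃ₗ⁅ℂ, Spin31⁆ W')

end

/-- The Casimir operator `C₁ = ∑ a, J_a K_a`. -/
noncomputable def casimir₁ (W : Type*) [AddCommGroup W] [Module ℂ W] [LieRingModule Spin31 W]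
    [LieModule ℂ Spin31 W] : Module.End ℂ W :=
  ∑ a : Fin 3, LieModule.toEnd ℂ Spin31 W (J a) * LieModule.toEnd ℂ Spin31 W (K a)

/-- The Casimir operator `C₂ = ∑ a, (J_a² - K_a²)`. -/
noncomputable def casimir₂ (W : Type*) [AddCommGroup W] [Module ℂ W] [LieRingModule Spin31 W]
    [LieModule ℂ Spin31 W] : Module.End ℂ W :=
  ∑ a : Fin 3, (LieModule.toEnd ℂ Spin31 W (J a) ^ 2 - LieModule.toEnd ℂ Spin31 W (K a) ^ 2)

/-- There is a basis of common eigenvectors. -/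
def SimultaneouslyDiagonalisable {W : Type} [AddCommGroup W] [Module ℂ W]
    (S T : Module.End ℂ W) : Prop :=
  ∃ (ι : Type) (b : Module.Basis ι ℂ W), ∀ i, ∃ x y : ℂ, S (b i) = x • b i ∧ T (b i) = y • b i

/-- The common eigenspace of the Casimirs with label `(Λ,Ρ)`: `C₁ = i Λ Ρ` and `C₂ = Λ² + Ρ² - 1`. -/
noncomputable def casimirEigenspace (W : Type*) [AddCommGroup W] [Module ℂ W]
    [LieRingModule Spin31 W] [LieModule ℂ Spin31 W] (Lam Rho : ℂ) : Submodule ℂ W :=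
  (casimir₁ W).eigenspace (Complex.I * Lam * Rho) ⊓
    (casimir₂ W).eigenspace (Lam ^ 2 + Rho ^ 2 - 1)

end Lorentz

open Lorentz

open Lorentz.Spin31

namespace Lorentz

attribute [local instance] LieRing.ofAssociativeRing

namespace LadderRep

/-! ### Commutation rules applied to vectors, and centrality of the two Casimirs. -/

section Commutators

variable {W : Type*} [AddCommGroup W] [Module ℂ W] (r : LadderRep W) (w : W)

/-! Over ℂ the Lie algebra splits into two copies of sl(2). For `c * c = -1` the operators B = J -
cK span one copy (in twice the usual normalisation), and `chiral c` = C₂ - 2c C₁ = B·B is four times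
its Casimir. Its eigenvalues are written t² - 1, where t = 2j + 1 for spin j. On F^A_γ one has B =
2J for c = iA and B = 0 for c = -iA, so F^A_γ has spin γ for one factor and is trivial for the
other. On V_{λ,ρ} the two chiral Casimirs are the scalars (λ ± Aρ)² - 1. Hence `chiral (-iA)` stays
scalar on F ⊗ V (`chiral_neg_tensor`). Since Λ - AΡ = λ - Aρ for every label ν, both C₁ and C₂ can
be recovered from `chiral (iA)` alone (`Generic.casimirEigenspace_eq`).

Diagonalisability. Let s = λ + Aρ, n = 2γ and v = 2ν. Tensoring with spin 1/2 turns an eigenvalue t²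
- 1 into (t ± 1)² - 1, as in the Clebsch-Gordan rule, and these values differ unless t = 0. Building
F^A_γ one half-unit of spin at a time, the excluded values of ρ + Aλ are exactly those for which t =
0 could occur, so F ⊗ V is the sum of the eigenspaces (s + v)² - 1 (`chiralSum_eq_top`). The same
condition makes these values distinct (`eigenvalue_injective`).

Identification of the eigenspaces. For every ν there is an eigenvector that is a highest weight
vector of spin γ + |λ| (`Generic.exists_hw_top`). The operator `lower` takes it step by step to spin
|λ + ν| (`Generic.exists_hw_bot`). It is not killed on the way, because V_{λ+ν,ρ+Aν} is again
infinite-dimensional (`Generic.shift`). Call the result b_ν. The vectors J₋ᵏK₊ⁱb_ν span a subspace,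
the tower of b_ν, inside the ν-eigenspace. For each spin p/2 the vectors K₊ⁱb_ν of that spin are
independent, and their number equals an upper bound for the multiplicity of that spin in F ⊗ V
(`Generic.finrank_hw_le`). So the towers together exhaust F ⊗ V (`Generic.iSup_tower_eq_top`), and
each fills its eigenspace.

Finally, a module that is the tower of its lowest SU(2)-multiplet is determined up to isomorphism by
the spin of that multiplet and the two Casimir values (`IsTower.intertwines`). Both the ν-eigenspace
and V_{λ+ν,ρ+Aν} are of this kind, with the same data. -/

theorem apply_apply_of_lie {S T U : Module.End ℂ W} (h : ⁅S, T⁆ = U) (w : W) :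
    S (T w) = T (S w) + U w := by
  rw [← h, LieRing.of_associative_ring_bracket]
  simp

theorem J₀_Jp_apply : r.J₀ (r.Jp w) = r.Jp (r.J₀ w) + r.Jp w := apply_apply_of_lie r.J₀_Jp w

theorem J₀_Jm_apply : r.J₀ (r.Jm w) = r.Jm (r.J₀ w) - r.Jm w := by
  simpa [sub_eq_add_neg] using apply_apply_of_lie r.J₀_Jm w

theorem Jp_Jm_apply : r.Jp (r.Jm w) = r.Jm (r.Jp w) + (2 : ℂ) • r.J₀ w :=
  apply_apply_of_lie r.Jp_Jm w

theorem J₀_K₀_apply : r.J₀ (r.K₀ w) = r.K₀ (r.J₀ w) := by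
  simpa using apply_apply_of_lie r.J₀_K₀ w

theorem J₀_Kp_apply : r.J₀ (r.Kp w) = r.Kp (r.J₀ w) + r.Kp w := apply_apply_of_lie r.J₀_Kp w

theorem J₀_Km_apply : r.J₀ (r.Km w) = r.Km (r.J₀ w) - r.Km w := by
  simpa [sub_eq_add_neg] using apply_apply_of_lie r.J₀_Km w

theorem Jp_K₀_apply : r.Jp (r.K₀ w) = r.K₀ (r.Jp w) - r.Kp w := by
  simpa [sub_eq_add_neg] using apply_apply_of_lie r.Jp_K₀ w

theorem Jp_Kp_apply : r.Jp (r.Kp w) = r.Kp (r.Jp w) := by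
  simpa using apply_apply_of_lie r.Jp_Kp w

theorem Jp_Km_apply : r.Jp (r.Km w) = r.Km (r.Jp w) + (2 : ℂ) • r.K₀ w :=
  apply_apply_of_lie r.Jp_Km w

theorem K₀_Jm_apply : r.K₀ (r.Jm w) = r.Jm (r.K₀ w) - r.Km w := by
  rw [apply_apply_of_lie r.Jm_K₀ w]; abel

theorem Kp_Jm_apply : r.Kp (r.Jm w) = r.Jm (r.Kp w) + (2 : ℂ) • r.K₀ w := by
  rw [apply_apply_of_lie r.Jm_Kp w]; simp

theorem Km_Jm_apply : r.Km (r.Jm w) = r.Jm (r.Km w) := by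
  rw [apply_apply_of_lie r.Jm_Km w]; simp

theorem K₀_Kp_apply : r.K₀ (r.Kp w) = r.Kp (r.K₀ w) - r.Jp w := by
  simpa [sub_eq_add_neg] using apply_apply_of_lie r.K₀_Kp w

theorem K₀_Km_apply : r.K₀ (r.Km w) = r.Km (r.K₀ w) + r.Jm w := apply_apply_of_lie r.K₀_Km w

theorem Kp_Km_apply : r.Kp (r.Km w) = r.Km (r.Kp w) - (2 : ℂ) • r.J₀ w := by
  simpa [sub_eq_add_neg] using apply_apply_of_lie r.Kp_Km w

/-- K₀ and K₋ are obtained from J₋ and K₊ by brackets. An operator that commutes with J₋ and K₊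
therefore commutes with K₀ and K₋ as well, which shortens the proof that the Casimirs are central.
-/
theorem K₀_eq : r.K₀ w = (-(1 / 2) : ℂ) • (r.Jm (r.Kp w) - r.Kp (r.Jm w)) := by
  rw [Kp_Jm_apply]; module

theorem Km_eq : r.Km w = r.Jm (r.K₀ w) - r.K₀ (r.Jm w) := by
  rw [K₀_Jm_apply]; abel

/-- `C₁ = J₀ K₀ + (J₊ K₋ + J₋ K₊) / 2`. -/
noncomputable def cas₁ : Module.End ℂ W :=
  r.J₀ * r.K₀ + (1 / 2 : ℂ) • (r.Jp * r.Km + r.Jm * r.Kp)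

/-- `C₂ = J₀² + (J₊ J₋ + J₋ J₊) / 2 - K₀² - (K₊ K₋ + K₋ K₊) / 2`. -/
noncomputable def cas₂ : Module.End ℂ W :=
  r.J₀ * r.J₀ + (1 / 2 : ℂ) • (r.Jp * r.Jm + r.Jm * r.Jp)
    - (r.K₀ * r.K₀ + (1 / 2 : ℂ) • (r.Kp * r.Km + r.Km * r.Kp))

/-- Normal ordering: raising operators act first, so that terms drop out on highest weight vectors.
-/
theorem cas₁_apply : r.cas₁ w = r.J₀ (r.K₀ w) + r.K₀ w + r.Km (r.Jp w)
    + (1 / 2 : ℂ) • (r.Jm (r.Kp w) - r.Km (r.Jp w)) := by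
  simp only [cas₁, LinearMap.add_apply, Module.End.mul_apply, LinearMap.smul_apply, Jp_Km_apply]
  module

theorem cas₂_apply : r.cas₂ w = r.J₀ (r.J₀ w) + r.J₀ w + r.Jm (r.Jp w)
    - (r.K₀ (r.K₀ w) + r.Km (r.Kp w) - r.J₀ w) := by
  simp only [cas₂, LinearMap.add_apply, LinearMap.sub_apply, Module.End.mul_apply,
    LinearMap.smul_apply, Jp_Jm_apply, Kp_Km_apply]
  module

/-- A linear map that commutes with the action of the six ladder operators. -/
structure Intertwines {W' : Type*} [AddCommGroup W'] [Module ℂ W'] (r : LadderRep W)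
    (r' : LadderRep W') (f : W →ₗ[ℂ] W') : Prop where
  J₀ : ∀ w, f (r.J₀ w) = r'.J₀ (f w)
  Jp : ∀ w, f (r.Jp w) = r'.Jp (f w)
  Jm : ∀ w, f (r.Jm w) = r'.Jm (f w)
  K₀ : ∀ w, f (r.K₀ w) = r'.K₀ (f w)
  Kp : ∀ w, f (r.Kp w) = r'.Kp (f w)
  Km : ∀ w, f (r.Km w) = r'.Km (f w)

theorem Intertwines.cas₁ {W' : Type*} [AddCommGroup W'] [Module ℂ W'] {r : LadderRep W}
    {r' : LadderRep W'} {f : W →ₗ[ℂ] W'} (h : Intertwines r r' f) (w : W) :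
    f (r.cas₁ w) = r'.cas₁ (f w) := by
  simp [LadderRep.cas₁, h.J₀, h.Jp, h.Jm, h.K₀, h.Kp, h.Km]

theorem Intertwines.cas₂ {W' : Type*} [AddCommGroup W'] [Module ℂ W'] {r : LadderRep W}
    {r' : LadderRep W'} {f : W →ₗ[ℂ] W'} (h : Intertwines r r' f) (w : W) :
    f (r.cas₂ w) = r'.cas₂ (f w) := by
  simp [LadderRep.cas₂, h.J₀, h.Jp, h.Jm, h.K₀, h.Kp, h.Km]

theorem cas₁_J₀ : r.cas₁ (r.J₀ w) = r.J₀ (r.cas₁ w) := by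
  simp only [cas₁_apply, map_add, map_sub, map_smul, J₀_Jp_apply, J₀_Jm_apply, J₀_K₀_apply,
    J₀_Kp_apply, J₀_Km_apply]
  module

theorem cas₁_Jp : r.cas₁ (r.Jp w) = r.Jp (r.cas₁ w) := by
  simp only [cas₁_apply, map_add, map_sub, map_smul, J₀_Jp_apply, J₀_K₀_apply, Jp_Jm_apply,
    J₀_Kp_apply, Jp_K₀_apply, Jp_Kp_apply, Jp_Km_apply]
  module

theorem cas₁_Jm : r.cas₁ (r.Jm w) = r.Jm (r.cas₁ w) := by
  simp only [cas₁_apply, map_add, map_sub, map_smul, J₀_Jm_apply, J₀_K₀_apply,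
    J₀_Km_apply, Jp_Jm_apply, K₀_Jm_apply, Kp_Jm_apply, Km_Jm_apply]
  module

theorem cas₁_Kp : r.cas₁ (r.Kp w) = r.Kp (r.cas₁ w) := by
  simp only [cas₁_apply, map_add, map_sub, map_smul, J₀_Jp_apply, J₀_K₀_apply,
    J₀_Kp_apply, Jp_Kp_apply, Kp_Jm_apply, K₀_Kp_apply, Kp_Km_apply]
  module

theorem cas₂_J₀ : r.cas₂ (r.J₀ w) = r.J₀ (r.cas₂ w) := by
  simp only [cas₂_apply, map_add, map_sub, J₀_Jp_apply, J₀_Jm_apply, J₀_K₀_apply,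
    J₀_Kp_apply, J₀_Km_apply]
  module

theorem cas₂_Jp : r.cas₂ (r.Jp w) = r.Jp (r.cas₂ w) := by
  simp only [cas₂_apply, map_add, map_sub, J₀_Jp_apply, Jp_Jm_apply,
    Jp_K₀_apply, Jp_Kp_apply, Jp_Km_apply, K₀_Kp_apply]
  module

theorem cas₂_Jm : r.cas₂ (r.Jm w) = r.Jm (r.cas₂ w) := by
  simp only [cas₂_apply, map_add, map_sub, map_smul, J₀_Jm_apply,
    Jp_Jm_apply, K₀_Jm_apply, Kp_Jm_apply, Km_Jm_apply, K₀_Km_apply]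
  module

theorem cas₂_Kp : r.cas₂ (r.Kp w) = r.Kp (r.cas₂ w) := by
  simp only [cas₂_apply, map_add, map_sub, J₀_Kp_apply,
    Jp_K₀_apply, Jp_Kp_apply, Kp_Jm_apply, K₀_Kp_apply, Kp_Km_apply]
  module

theorem commute_K₀ {C : Module.End ℂ W} (h1 : ∀ w, C (r.Jm w) = r.Jm (C w))
    (h2 : ∀ w, C (r.Kp w) = r.Kp (C w)) : C (r.K₀ w) = r.K₀ (C w) := by
  simp only [K₀_eq, map_smul, map_sub, h1, h2]

theorem commute_Km {C : Module.End ℂ W} (h1 : ∀ w, C (r.Jm w) = r.Jm (C w))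
    (h2 : ∀ w, C (r.Kp w) = r.Kp (C w)) : C (r.Km w) = r.Km (C w) := by
  simp only [Km_eq, map_sub, h1, r.commute_K₀ _ h1 h2]

theorem intertwines_cas₁ : Intertwines r r r.cas₁ :=
  ⟨r.cas₁_J₀, r.cas₁_Jp, r.cas₁_Jm, fun w => r.commute_K₀ w r.cas₁_Jm r.cas₁_Kp, r.cas₁_Kp,
    fun w => r.commute_Km w r.cas₁_Jm r.cas₁_Kp⟩

theorem intertwines_cas₂ : Intertwines r r r.cas₂ :=
  ⟨r.cas₂_J₀, r.cas₂_Jp, r.cas₂_Jm, fun w => r.commute_K₀ w r.cas₂_Jm r.cas₂_Kp, r.cas₂_Kp,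
    fun w => r.commute_Km w r.cas₂_Jm r.cas₂_Kp⟩

end Commutators

end LadderRep

/-! ### Passage from an arbitrary module to its ladder operators and back. -/

namespace Spin31

/-- `J₊ = J₁ + i J₂`. -/
noncomputable def Jplus : Spin31 := J 1 + Complex.I • J 2
/-- `J₋ = J₁ - i J₂`. -/
noncomputable def Jminus : Spin31 := J 1 - Complex.I • J 2
/-- `K₊ = K₁ + i K₂`. -/
noncomputable def Kplus : Spin31 := K 1 + Complex.I • K 2
/-- `K₋ = K₁ - i K₂`. -/
noncomputable def Kminus : Spin31 := K 1 - Complex.I • K 2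

theorem sub_fst (x y : Spin31) (a : Fin 3) : (x - y).1 a = x.1 a - y.1 a := rfl
theorem sub_snd (x y : Spin31) (a : Fin 3) : (x - y).2 a = x.2 a - y.2 a := rfl
theorem neg_fst (x : Spin31) (a : Fin 3) : (-x).1 a = -x.1 a := rfl
theorem neg_snd (x : Spin31) (a : Fin 3) : (-x).2 a = -x.2 a := rfl
theorem J_fst (a b : Fin 3) : (J a).1 b = Pi.single (M := fun _ => ℂ) a 1 b := rfl
theorem J_snd (a b : Fin 3) : (J a).2 b = 0 := rfl
theorem K_fst (a b : Fin 3) : (K a).1 b = 0 := rfl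
theorem K_snd (a b : Fin 3) : (K a).2 b = Pi.single (M := fun _ => ℂ) a 1 b := rfl

theorem eq_sum (x : Spin31) : x = x.1 0 • J 0 + ((x.1 1 - Complex.I * x.1 2) / 2) • Jplus
      + ((x.1 1 + Complex.I * x.1 2) / 2) • Jminus
    + x.2 0 • K 0 + ((x.2 1 - Complex.I * x.2 2) / 2) • Kplus
      + ((x.2 1 + Complex.I * x.2 2) / 2) • Kminus := by
  apply ext3 <;> simp [add_fst, add_snd, sub_fst, sub_snd, smul_fst, smul_snd, J_fst, J_snd, K_fst,
    K_snd, Jplus, Jminus, Kplus, Kminus] <;> ring_nf <;> simp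

end Spin31

section OfModule

variable (W : Type*) [AddCommGroup W] [Module ℂ W] [LieRingModule Spin31 W] [LieModule ℂ Spin31 W]

theorem toEnd_lie {x y z : Spin31} (h : ⁅x, y⁆ = z) :
    ⁅LieModule.toEnd ℂ Spin31 W x, LieModule.toEnd ℂ Spin31 W y⁆ = LieModule.toEnd ℂ Spin31 W z := by
  rw [← h, LieHom.map_lie]

/-- The ladder operators of a `spin(3,1)_ℂ`-module. -/
noncomputable def LadderRep.ofModule : LadderRep W where
  J₀ := LieModule.toEnd ℂ Spin31 W (J 0)
  Jp := LieModule.toEnd ℂ Spin31 W Jplus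
  Jm := LieModule.toEnd ℂ Spin31 W Jminus
  K₀ := LieModule.toEnd ℂ Spin31 W (K 0)
  Kp := LieModule.toEnd ℂ Spin31 W Kplus
  Km := LieModule.toEnd ℂ Spin31 W Kminus
  J₀_Jp := by
    refine toEnd_lie W ?_
    apply ext3 <;> simp [lie_coord, add_fst, add_snd, smul_fst, smul_snd, J_fst,
      J_snd, Jplus]
  J₀_Jm := by
    refine (toEnd_lie W (z := -Jminus) ?_).trans (map_neg _ _)
    apply ext3 <;> simp [lie_coord, sub_fst, sub_snd, smul_fst, smul_snd, J_fst,
      J_snd, Jminus]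
  Jp_Jm := by
    refine (toEnd_lie W (z := (2 : ℂ) • J 0) ?_).trans (map_smul _ _ _)
    apply ext3 <;> simp [lie_coord, sub_fst, sub_snd, smul_fst, smul_snd, J_fst,
      J_snd, Jminus, Jplus]
    ring_nf
  J₀_K₀ := by
    refine (toEnd_lie W (z := 0) ?_).trans (map_zero _)
    apply ext3 <;> simp [lie_coord, J_fst, J_snd, K_fst, K_snd, zero_fst, zero_snd]
  J₀_Kp := by
    refine toEnd_lie W ?_
    apply ext3 <;> simp [lie_coord, add_fst, add_snd, smul_fst, smul_snd, J_fst,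
      J_snd, K_fst, K_snd, Kplus]
  J₀_Km := by
    refine (toEnd_lie W (z := -Kminus) ?_).trans (map_neg _ _)
    apply ext3 <;> simp [lie_coord, sub_fst, sub_snd, smul_fst, smul_snd, J_fst,
      J_snd, K_fst, K_snd, Kminus]
  Jp_K₀ := by
    refine (toEnd_lie W (z := -Kplus) ?_).trans (map_neg _ _)
    apply ext3 <;> simp [lie_coord, add_fst, add_snd, smul_fst, smul_snd, J_fst,
      J_snd, K_fst, K_snd, Jplus, Kplus, neg_fst, neg_snd]
  Jp_Kp := by
    refine (toEnd_lie W (z := 0) ?_).trans (map_zero _)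
    apply ext3 <;> simp [lie_coord, add_fst, add_snd, smul_fst, smul_snd, J_fst,
      J_snd, K_fst, K_snd, Jplus, Kplus, zero_fst, zero_snd]
  Jp_Km := by
    refine (toEnd_lie W (z := (2 : ℂ) • K 0) ?_).trans (map_smul _ _ _)
    apply ext3 <;> simp [lie_coord, add_fst, add_snd, sub_fst, sub_snd, smul_fst, smul_snd, J_fst,
      J_snd, K_fst, K_snd, Jplus, Kminus]
    ring_nf
  Jm_K₀ := by
    refine toEnd_lie W ?_
    apply ext3 <;> simp [lie_coord, sub_fst, sub_snd, smul_fst, smul_snd, J_fst,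
      J_snd, K_fst, K_snd, Jminus, Kminus]
  Jm_Kp := by
    refine (toEnd_lie W (z := -(2 : ℂ) • K 0) ?_).trans (map_smul _ _ _)
    apply ext3 <;> simp [lie_coord, add_fst, add_snd, sub_fst, sub_snd, smul_fst, smul_snd, J_fst,
      J_snd, K_fst, K_snd, Jminus, Kplus, neg_fst, neg_snd]
    ring_nf
  Jm_Km := by
    refine (toEnd_lie W (z := 0) ?_).trans (map_zero _)
    apply ext3 <;> simp [lie_coord, sub_fst, sub_snd, smul_fst, smul_snd, J_fst,
      J_snd, K_fst, K_snd, Jminus, Kminus, zero_fst, zero_snd]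
  K₀_Kp := by
    refine (toEnd_lie W (z := -Jplus) ?_).trans (map_neg _ _)
    apply ext3 <;> simp [lie_coord, add_fst, add_snd, smul_fst, smul_snd, J_fst,
      J_snd, K_fst, K_snd, Jplus, Kplus, neg_fst, neg_snd]
  K₀_Km := by
    refine toEnd_lie W ?_
    apply ext3 <;> simp [lie_coord, sub_fst, sub_snd, smul_fst, smul_snd, J_fst,
      J_snd, K_fst, K_snd, Jminus, Kminus]
  Kp_Km := by
    refine (toEnd_lie W (z := -(2 : ℂ) • J 0) ?_).trans (map_smul _ _ _)
    apply ext3 <;> simp [lie_coord, sub_fst, sub_snd, smul_fst, smul_snd, J_fst,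
      J_snd, K_fst, K_snd, Kplus, Kminus, neg_fst, neg_snd]
    ring_nf

open LadderRep

theorem casimir₁_eq : casimir₁ W = (ofModule W).cas₁ := by
  ext w
  simp only [casimir₁, Fin.sum_univ_three, cas₁, ofModule, Jplus, Jminus, Kplus, Kminus, map_add,
    map_sub, map_smul, LinearMap.add_apply, Module.End.mul_apply, LinearMap.smul_apply,
    LinearMap.sub_apply, smul_add, smul_sub, smul_smul, Complex.I_mul_I]
  match_scalars <;> ring_nf

theorem casimir₂_eq : casimir₂ W = (ofModule W).cas₂ := by
  ext w
  simp only [casimir₂, Fin.sum_univ_three, cas₂, ofModule, Jplus, Jminus, Kplus, Kminus, map_add,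
    map_sub, map_smul, LinearMap.add_apply, Module.End.mul_apply, LinearMap.smul_apply,
    LinearMap.sub_apply, smul_add, smul_sub, smul_smul, Complex.I_mul_I, pow_two]
  match_scalars <;> ring_nf

variable {W}

theorem lie_eq_ladder (x : Spin31) (w : W) : ⁅x, w⁆ =
    x.1 0 • (ofModule W).J₀ w + ((x.1 1 - Complex.I * x.1 2) / 2) • (ofModule W).Jp w
      + ((x.1 1 + Complex.I * x.1 2) / 2) • (ofModule W).Jm w
    + x.2 0 • (ofModule W).K₀ w + ((x.2 1 - Complex.I * x.2 2) / 2) • (ofModule W).Kp w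
      + ((x.2 1 + Complex.I * x.2 2) / 2) • (ofModule W).Km w := by
  conv_lhs => rw [eq_sum x]
  simp only [add_lie, smul_lie]
  rfl

theorem LadderRep.Intertwines.map_lie {W' : Type*} [AddCommGroup W'] [Module ℂ W']
    [LieRingModule Spin31 W'] [LieModule ℂ Spin31 W'] {f : W →ₗ[ℂ] W'}
    (h : Intertwines (ofModule W) (ofModule W') f) (x : Spin31) (w : W) : f ⁅x, w⁆ = ⁅x, f w⁆ := by
  simp only [lie_eq_ladder, map_add, map_smul, h.J₀, h.Jp, h.Jm, h.K₀, h.Kp, h.Km]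

theorem LadderRep.intertwines_of_map_lie {W' : Type*} [AddCommGroup W'] [Module ℂ W']
    [LieRingModule Spin31 W'] [LieModule ℂ Spin31 W'] {f : W →ₗ[ℂ] W'}
    (h : ∀ (x : Spin31) (w : W), f ⁅x, w⁆ = ⁅x, f w⁆) :
    Intertwines (ofModule W) (ofModule W') f :=
  ⟨h _, h _, h _, h _, h _, h _⟩

end OfModule

end Lorentz

/-! ### Highest weight vectors of the rotation algebra and the strings below them. -/

namespace Lorentz

namespace LadderRep

variable {W : Type*} [AddCommGroup W] [Module ℂ W] (r : LadderRep W)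

/-- The highest weight vectors of weight `j` for the rotation algebra. -/
noncomputable def hw (j : ℂ) : Submodule ℂ W := r.J₀.eigenspace j ⊓ LinearMap.ker r.Jp

variable {r} {w u : W} {j m : ℂ}

theorem mem_hw : w ∈ r.hw j ↔ r.J₀ w = j • w ∧ r.Jp w = 0 := by
  simp [hw]

theorem J₀_Jm_pow (h : r.J₀ w = m • w) (k : ℕ) :
    r.J₀ ((r.Jm ^ k) w) = (m - k) • (r.Jm ^ k) w := by
  induction k with
  | zero => simp [h]
  | succ k ih =>
    rw [pow_succ', Module.End.mul_apply, J₀_Jm_apply, ih, map_smul]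
    push_cast
    module

theorem J₀_Jp_pow (h : r.J₀ w = m • w) (k : ℕ) :
    r.J₀ ((r.Jp ^ k) w) = (m + k) • (r.Jp ^ k) w := by
  induction k with
  | zero => simp [h]
  | succ k ih =>
    rw [pow_succ', Module.End.mul_apply, J₀_Jp_apply, ih, map_smul]
    push_cast
    module

theorem Jp_Jm_pow (h : r.J₀ w = m • w) (k : ℕ) :
    r.Jp ((r.Jm ^ (k + 1)) w) =
      (r.Jm ^ (k + 1)) (r.Jp w) + ((k + 1) * (2 * m - k)) • (r.Jm ^ k) w := by
  induction k with
  | zero => simp [Jp_Jm_apply, h, smul_smul]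
  | succ k ih =>
    rw [pow_succ' _ (k + 1), Module.End.mul_apply, Jp_Jm_apply, ih, J₀_Jm_pow h,
      Module.End.mul_apply, map_add, map_smul, ← Module.End.mul_apply r.Jm (r.Jm ^ k),
      ← pow_succ']
    push_cast
    module

theorem Jp_Jm_pow_of_hw (h : u ∈ r.hw j) (k : ℕ) :
    r.Jp ((r.Jm ^ (k + 1)) u) = ((k + 1) * (2 * j - k)) • (r.Jm ^ k) u := by
  rw [Jp_Jm_pow (mem_hw.1 h).1, (mem_hw.1 h).2, map_zero, zero_add]

/-- The constant is the product of (i + 1)(2j - i) over i < k, by `Jp_Jm_pow_of_hw`. -/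
theorem Jp_pow_Jm_pow (h : u ∈ r.hw j) (k : ℕ) (hj : ∀ i : ℕ, i < k → 2 * j ≠ i) :
    ∃ c : ℂ, c ≠ 0 ∧ (r.Jp ^ k) ((r.Jm ^ k) u) = c • u := by
  induction k with
  | zero => exact ⟨1, one_ne_zero, by simp⟩
  | succ k ih =>
    obtain ⟨c, hc, e⟩ := ih fun i hi => hj i (by omega)
    refine ⟨(k + 1) * (2 * j - k) * c, mul_ne_zero (mul_ne_zero (Nat.cast_add_one_ne_zero k)
      (sub_ne_zero.2 (hj k (by omega)))) hc, ?_⟩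
    rw [pow_succ, Module.End.mul_apply, Jp_Jm_pow_of_hw h, map_smul, e, smul_smul]

theorem Jm_pow_ne_zero (h : u ∈ r.hw j) (hu : u ≠ 0) (k : ℕ) (hj : ∀ i : ℕ, i < k → 2 * j ≠ i) :
    (r.Jm ^ k) u ≠ 0 := by
  obtain ⟨c, hc, e⟩ := Jp_pow_Jm_pow h k hj
  intro h0
  rw [h0, map_zero] at e
  exact smul_ne_zero hc hu e.symm

/-- Applying J₊ to J₋^(K+1) w = 0 leaves only (K + 1)(2m - K) J₋^K w. The coefficient never
vanishes, so the exponent can be lowered down to 0. -/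
theorem eq_zero_of_Jm_Jp {K : ℕ} (h : r.J₀ w = m • w) (h0 : r.Jm (r.Jp w) = 0)
    (hK : (r.Jm ^ K) w = 0) (hm : ∀ k : ℕ, 2 * m ≠ k) : w = 0 := by
  induction K with
  | zero => simpa using hK
  | succ K ih =>
    have e := Jp_Jm_pow h K
    rw [hK, map_zero, pow_succ, Module.End.mul_apply, h0, map_zero, zero_add] at e
    exact ih ((smul_eq_zero.1 e.symm).resolve_left
      (mul_ne_zero (Nat.cast_add_one_ne_zero K) (sub_ne_zero.2 (hm K))))

variable (r) in
/-- The operators `J₊` and `J₋` are locally nilpotent. -/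
structure LocNilpotent : Prop where
  Jp : ∀ w, ∃ k, (r.Jp ^ k) w = 0
  Jm : ∀ w, ∃ k, (r.Jm ^ k) w = 0

theorem hw_eq_zero (hr : r.LocNilpotent) (h : u ∈ r.hw j) (hj : ∀ k : ℕ, 2 * j ≠ k) : u = 0 := by
  obtain ⟨K, hK⟩ := hr.Jm u
  exact eq_zero_of_Jm_Jp (mem_hw.1 h).1 (by rw [(mem_hw.1 h).2, map_zero]) hK hj

/-- The vector J₋^(p+1) u is again a highest weight vector, of the negative weight -p/2 - 1, which
local nilpotency of J₋ forbids. -/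
theorem Jm_pow_eq_zero (hr : r.LocNilpotent) {p k : ℕ} (h : u ∈ r.hw (p / 2)) (hk : p < k) :
    (r.Jm ^ k) u = 0 := by
  have h1 : (r.Jm ^ (p + 1)) u = 0 := by
    refine hw_eq_zero (j := (p : ℂ) / 2 - ((p + 1 : ℕ) : ℂ)) hr
      (mem_hw.2 ⟨J₀_Jm_pow (mem_hw.1 h).1 _, ?_⟩) fun k hk => ?_
    · rw [Jp_Jm_pow_of_hw h]
      have : (p + 1 : ℂ) * (2 * (p / 2) - p) = 0 := by ring
      rw [this, zero_smul]
    · have : ((k + p + 2 : ℕ) : ℂ) = 0 := by push_cast at hk ⊢; linear_combination -hk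
      exact absurd (Nat.cast_eq_zero.1 this) (by omega)
  obtain ⟨i, rfl⟩ := Nat.exists_eq_add_of_le (Nat.succ_le_of_lt hk)
  rw [add_comm, pow_add, Module.End.mul_apply, h1, map_zero]

variable (r) in
/-- The span of the vectors of weight `q/2` that are of the form `J₋ᵏ h` with a highest weight vector
`h`. -/
noncomputable def strings (q : ℤ) : Submodule ℂ W :=
  Submodule.span ℂ {x | ∃ k p : ℕ, ∃ h ∈ r.hw (p / 2), (p : ℤ) - 2 * k = q ∧ x = (r.Jm ^ k) h}

theorem J₀_of_mem_strings {q : ℤ} {x : W} (hx : x ∈ r.strings q) : r.J₀ x = ((q : ℂ) / 2) • x := by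
  rw [← Module.End.mem_eigenspace_iff]
  refine Submodule.span_le.2 ?_ hx
  rintro _ ⟨k, p, h, hh, rfl, rfl⟩
  rw [SetLike.mem_coe, Module.End.mem_eigenspace_iff, J₀_Jm_pow (mem_hw.1 hh).1]
  push_cast
  congr 1
  ring

/-- A vector J₋ᵏh of a string is J₊ of a multiple of its successor, unless it is the bottom of the
string, where J₋ already kills it. -/
theorem exists_Jm_Jp_eq (hr : r.LocNilpotent) {q : ℤ} {y : W} (hy : y ∈ r.strings (q + 2)) :
    ∃ x ∈ r.strings q, r.Jm (y - r.Jp x) = 0 := by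
  induction hy using Submodule.span_induction with
  | zero => exact ⟨0, Submodule.zero_mem _, by simp⟩
  | add y y' _ _ h h' =>
    obtain ⟨x, hx, e⟩ := h
    obtain ⟨x', hx', e'⟩ := h'
    refine ⟨x + x', Submodule.add_mem _ hx hx', ?_⟩
    rw [map_add, add_sub_add_comm, map_add, e, e', add_zero]
  | smul c y _ h =>
    obtain ⟨x, hx, e⟩ := h
    refine ⟨c • x, Submodule.smul_mem _ c hx, ?_⟩
    rw [map_smul, ← smul_sub, map_smul, e, smul_zero]
  | mem y hy =>
    obtain ⟨k, p, h, hh, hq, rfl⟩ := hy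
    by_cases hk : k = p
    · subst hk
      refine ⟨0, Submodule.zero_mem _, ?_⟩
      rw [map_zero, sub_zero, ← Module.End.mul_apply, ← pow_succ']
      exact Jm_pow_eq_zero hr hh (Nat.lt_succ_self k)
    · have hc : ((k + 1) * (2 * ((p : ℂ) / 2) - k)) ≠ 0 := by
        refine mul_ne_zero (Nat.cast_add_one_ne_zero k) fun e => hk ?_
        have : (p : ℂ) = k := by linear_combination e
        exact_mod_cast this.symm
      refine ⟨((k + 1) * (2 * ((p : ℂ) / 2) - k))⁻¹ • (r.Jm ^ (k + 1)) h,
        Submodule.smul_mem _ _ (Submodule.subset_span ⟨k + 1, p, h, hh, by push_cast; omega, rfl⟩),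
        ?_⟩
      rw [map_smul, Jp_Jm_pow_of_hw hh, smul_smul, inv_mul_cancel₀ hc, one_smul, sub_self, map_zero]

/-- The last non-zero power of J₊ on w gives a highest weight vector. Subtracting a multiple of the
string vector below it makes a smaller power of J₊ vanish. The multiple exists because the weight is
non-negative, which keeps the constant of `Jp_pow_Jm_pow` away from 0. -/
theorem mem_strings_of_nonneg {q : ℤ} (hq : 0 ≤ q) {R : ℕ}
    (h : r.J₀ w = ((q : ℂ) / 2) • w) (hR : (r.Jp ^ R) w = 0) : w ∈ r.strings q := by
  induction R generalizing w with
  | zero =>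
    have : w = 0 := by simpa using hR
    rw [this]; exact Submodule.zero_mem _
  | succ R ih =>
    obtain ⟨p, hp⟩ := Int.eq_ofNat_of_zero_le (show 0 ≤ q + 2 * R by omega)
    have hpc : (p : ℂ) = q + 2 * R := by exact_mod_cast hp.symm
    have hu : (r.Jp ^ R) w ∈ r.hw ((p : ℂ) / 2) := by
      refine mem_hw.2 ⟨?_, ?_⟩
      · rw [J₀_Jp_pow h, hpc]; congr 1; ring
      · rw [← Module.End.mul_apply, ← pow_succ', hR]
    obtain ⟨c, hc, e⟩ := Jp_pow_Jm_pow hu R fun i hi e => by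
      have : (p : ℂ) = i := by linear_combination e
      have : p = i := by exact_mod_cast this
      omega
    have hx : (r.Jm ^ R) ((r.Jp ^ R) w) ∈ r.strings q :=
      Submodule.subset_span ⟨R, p, _, hu, by omega, rfl⟩
    have hw' : w - c⁻¹ • (r.Jm ^ R) ((r.Jp ^ R) w) ∈ r.strings q := by
      refine ih ?_ ?_
      · rw [map_sub, map_smul, h, J₀_of_mem_strings hx]; module
      · rw [map_sub, map_smul, e, smul_smul, inv_mul_cancel₀ hc, one_smul, sub_self]
    simpa using Submodule.add_mem _ hw' (Submodule.smul_mem _ c⁻¹ hx)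

/-- This plays the role of complete reducibility under su(2): half-integral weight vectors are sums
of vectors J₋ᵏh. For negative weight, J₊w is treated first. A string vector x is then subtracted so
that J₋J₊(w - x) = 0, and a vector of negative weight with this property is zero. -/
theorem mem_strings (hr : r.LocNilpotent) {q : ℤ} (h : r.J₀ w = ((q : ℂ) / 2) • w) :
    w ∈ r.strings q := by
  obtain ⟨t, ht⟩ : ∃ t : ℕ, -(t : ℤ) ≤ q := ⟨q.natAbs, by omega⟩
  induction t generalizing q w with
  | zero =>
    obtain ⟨R, hR⟩ := hr.Jp w
    exact mem_strings_of_nonneg (by simpa using ht) h hR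
  | succ t ih =>
    by_cases hq : 0 ≤ q
    · obtain ⟨R, hR⟩ := hr.Jp w
      exact mem_strings_of_nonneg hq h hR
    have h1 : r.Jp w ∈ r.strings (q + 2) := by
      refine ih ?_ (by push_cast at ht; omega)
      rw [J₀_Jp_apply, h, map_smul]; push_cast; module
    obtain ⟨x, hx, e⟩ := exists_Jm_Jp_eq hr h1
    obtain ⟨K, hK⟩ := hr.Jm (w - x)
    have : w - x = 0 := by
      refine eq_zero_of_Jm_Jp (m := (q : ℂ) / 2) ?_ (by rw [map_sub, e]) hK fun k hk => ?_
      · rw [map_sub, h, J₀_of_mem_strings hx, smul_sub]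
      · have : (q : ℂ) = (k : ℤ) := by push_cast; linear_combination hk
        have : q = k := by exact_mod_cast this
        omega
    rwa [sub_eq_zero.1 this]

/-! ### Boosts on highest weight vectors, controlled by the Casimirs. -/

section Boost

variable {c₁ c₂ : ℂ}

theorem Kp_mem_hw (h : w ∈ r.hw j) : r.Kp w ∈ r.hw (j + 1) := by
  obtain ⟨h1, h2⟩ := mem_hw.1 h
  refine mem_hw.2 ⟨?_, by rw [Jp_Kp_apply, h2, map_zero]⟩
  rw [J₀_Kp_apply, h1, map_smul]; module

/-- With J₊w = 0 the equation for C₁ is linear in K₀w, so K₀w can be expressed by w and J₋K₊w. -/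
theorem K₀_of_hw (h : w ∈ r.hw j) (h₁ : r.cas₁ w = c₁ • w) :
    (j + 1) • r.K₀ w = c₁ • w - (1 / 2 : ℂ) • r.Jm (r.Kp w) := by
  obtain ⟨e1, e2⟩ := mem_hw.1 h
  rw [cas₁_apply, J₀_K₀_apply, e1, e2] at h₁
  simp only [map_smul, map_zero] at h₁
  linear_combination (norm := module) h₁

theorem K₀_K₀_of_hw (h : w ∈ r.hw j) (h₁ : r.cas₁ w = c₁ • w) :
    (j + 1) • r.K₀ (r.K₀ w) =
      c₁ • r.K₀ w - (1 / 2 : ℂ) • (r.Jm (r.K₀ (r.Kp w)) - r.Km (r.Kp w)) := by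
  have := congrArg r.K₀ (K₀_of_hw h h₁)
  simpa only [map_sub, map_smul, K₀_Jm_apply] using this

theorem Km_Kp_add_of_hw (h : w ∈ r.hw j) (h₂ : r.cas₂ w = c₂ • w) :
    r.Km (r.Kp w) + r.K₀ (r.K₀ w) = (j * (j + 2) - c₂) • w := by
  obtain ⟨e1, e2⟩ := mem_hw.1 h
  rw [cas₂_apply, e1, e2] at h₂
  simp only [map_smul, map_zero, e1] at h₂
  linear_combination (norm := module) -h₂

/-- Elimination of K₀K₀w between the two Casimir equations. It expresses K₋ on the highest weight
vector K₊w by vectors that are already under control. -/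
theorem Km_Kp_of_hw (h : w ∈ r.hw j) (h₁ : r.cas₁ w = c₁ • w) (h₂ : r.cas₂ w = c₂ • w) :
    (2 * j + 3) • r.Km (r.Kp w) = (2 * (j + 1) * (j * (j + 2) - c₂)) • w - (2 * c₁) • r.K₀ w
      + r.Jm (r.K₀ (r.Kp w)) := by
  have e1 := Km_Kp_add_of_hw h h₂
  have e2 := K₀_K₀_of_hw h h₁
  linear_combination (norm := module) (2 * (j + 1)) • e1 - (2 : ℂ) • e2

variable (r) in
/-- The operator that maps highest weight vectors of weight `j` to those of weight `j - 1`. -/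
noncomputable def lower (j : ℂ) : Module.End ℂ W :=
  (2 * j * (2 * j + 1)) • r.Km - (2 * (2 * j + 1)) • (r.Jm * r.K₀) - r.Jm * r.Jm * r.Kp

theorem lower_apply : r.lower j w = (2 * j * (2 * j + 1)) • r.Km w
    - (2 * (2 * j + 1)) • r.Jm (r.K₀ w) - r.Jm (r.Jm (r.Kp w)) := rfl

/-- Since K is a vector operator, K₋w mixes the spins j + 1, j and j - 1. The coefficients of
`lower` remove the first two. -/
theorem lower_mem_hw (h : w ∈ r.hw j) : r.lower j w ∈ r.hw (j - 1) := by
  obtain ⟨e1, e2⟩ := mem_hw.1 h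
  refine mem_hw.2 ⟨?_, ?_⟩
  · simp only [lower_apply, map_sub, map_smul, J₀_Km_apply, J₀_Jm_apply, J₀_K₀_apply, J₀_Kp_apply,
      map_add, e1]
    module
  · simp only [lower_apply, map_sub, map_smul, Jp_Km_apply, Jp_Jm_apply, J₀_K₀_apply, J₀_Kp_apply,
      Jp_K₀_apply, Jp_Kp_apply, J₀_Jm_apply, map_add, e1, e2, map_zero]
    module

/-- The Casimir equations reduce K₊(lower w) to 4(j² - L²)(j² - P²)w. This is the algebraic
counterpart of the zeros of P⁻(j). -/
theorem lower_ne_zero {L P : ℂ} (h : w ∈ r.hw j) (hw0 : w ≠ 0)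
    (h₁ : r.cas₁ w = (Complex.I * L * P) • w)
    (h₂ : r.cas₂ w = (L ^ 2 + P ^ 2 - 1) • w)
    (hL : j ^ 2 ≠ L ^ 2) (hP : j ^ 2 ≠ P ^ 2) :
    r.lower j w ≠ 0 := by
  intro h0
  obtain ⟨w1, w2⟩ := mem_hw.1 h
  have hu := Kp_mem_hw h
  have h₁' : r.cas₁ (r.Kp w) = (Complex.I * L * P) • r.Kp w := by rw [cas₁_Kp, h₁, map_smul]
  have e0 := K₀_of_hw h h₁
  have e1 := Km_Kp_add_of_hw h h₂
  have e2 := K₀_K₀_of_hw h h₁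
  have e3 := congrArg r.Jm (K₀_of_hw hu h₁')
  have e4 := congrArg r.Kp h0
  simp only [lower_apply, map_sub, map_smul, Kp_Km_apply, Kp_Jm_apply, map_add, K₀_Jm_apply, w1,
    map_zero] at e3 e4
  have e5 : r.Kp (r.K₀ w) = r.K₀ (r.Kp w) := by
    rw [K₀_Kp_apply, w2, sub_zero]
  rw [e5] at e4
  have : ((j ^ 2 - L ^ 2) * (j ^ 2 - P ^ 2)) • w = 0 := by
    linear_combination (norm := skip) (-j ^ 2) • e1 + (1 / 4 : ℂ) • e4 + (1 / 2 : ℂ) • e3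
      + (Complex.I * L * P) • e0 + (j + 1) • e2
    match_scalars <;> ring_nf <;> simp only [Complex.I_sq] <;> ring
  rcases smul_eq_zero.1 this with h | h
  · rcases mul_eq_zero.1 h with h | h
    · exact hL (sub_eq_zero.1 h)
    · exact hP (sub_eq_zero.1 h)
  · exact hw0 h

end Boost

end LadderRep

end Lorentz

/-! ### Modules generated from their lowest spin by K₊ and J₋. -/

namespace Lorentz

attribute [local instance] LieRing.ofAssociativeRing

namespace LadderRep

variable {W W' : Type*} [AddCommGroup W] [Module ℂ W] [AddCommGroup W'] [Module ℂ W']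

theorem prodMap_lie (f f' : Module.End ℂ W) (g g' : Module.End ℂ W') :
    (⁅f.prodMap g, f'.prodMap g'⁆ : Module.End ℂ (W × W')) = ⁅f, f'⁆.prodMap ⁅g, g'⁆ := rfl

/-- The direct sum of two representations. -/
noncomputable def prod (r : LadderRep W) (r' : LadderRep W') : LadderRep (W × W') where
  J₀ := r.J₀.prodMap r'.J₀
  Jp := r.Jp.prodMap r'.Jp
  Jm := r.Jm.prodMap r'.Jm
  K₀ := r.K₀.prodMap r'.K₀
  Kp := r.Kp.prodMap r'.Kp
  Km := r.Km.prodMap r'.Km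
  J₀_Jp := by rw [prodMap_lie, r.J₀_Jp, r'.J₀_Jp]
  J₀_Jm := by rw [prodMap_lie, r.J₀_Jm, r'.J₀_Jm]; rfl
  Jp_Jm := by rw [prodMap_lie, r.Jp_Jm, r'.Jp_Jm]; rfl
  J₀_K₀ := by rw [prodMap_lie, r.J₀_K₀, r'.J₀_K₀]; rfl
  J₀_Kp := by rw [prodMap_lie, r.J₀_Kp, r'.J₀_Kp]
  J₀_Km := by rw [prodMap_lie, r.J₀_Km, r'.J₀_Km]; rfl
  Jp_K₀ := by rw [prodMap_lie, r.Jp_K₀, r'.Jp_K₀]; rfl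
  Jp_Kp := by rw [prodMap_lie, r.Jp_Kp, r'.Jp_Kp]; rfl
  Jp_Km := by rw [prodMap_lie, r.Jp_Km, r'.Jp_Km]; rfl
  Jm_K₀ := by rw [prodMap_lie, r.Jm_K₀, r'.Jm_K₀]
  Jm_Kp := by rw [prodMap_lie, r.Jm_Kp, r'.Jm_Kp]; rfl
  Jm_Km := by rw [prodMap_lie, r.Jm_Km, r'.Jm_Km]; rfl
  K₀_Kp := by rw [prodMap_lie, r.K₀_Kp, r'.K₀_Kp]; rfl
  K₀_Km := by rw [prodMap_lie, r.K₀_Km, r'.K₀_Km]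
  Kp_Km := by rw [prodMap_lie, r.Kp_Km, r'.Kp_Km]; rfl

variable (r : LadderRep W)

theorem add_two_mul_ne_zero (p i : ℕ) {c : ℕ} (hc : c ≠ 0) : (p : ℂ) + 2 * i + c ≠ 0 := by
  have : p + 2 * i + c ≠ 0 := by omega
  exact_mod_cast this

/-- The vectors `J₋ᵏ K₊ⁱ w`. -/
noncomputable def towerVec (w : W) (x : ℕ × ℕ) : W := (r.Jm ^ x.2) ((r.Kp ^ x.1) w)

/-- The span of the vectors `J₋ᵏ K₊ⁱ w`. -/
noncomputable def tower (w : W) : Submodule ℂ W := Submodule.span ℂ (Set.range (r.towerVec w))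

variable {r} {p : ℕ} {w : W} {c₁ c₂ : ℂ}

theorem towerVec_mem (i k : ℕ) : (r.Jm ^ k) ((r.Kp ^ i) w) ∈ r.tower w :=
  Submodule.subset_span ⟨(i, k), rfl⟩

theorem tower_le_comap {T : Module.End ℂ W}
    (h : ∀ i k : ℕ, T ((r.Jm ^ k) ((r.Kp ^ i) w)) ∈ r.tower w) {x : W} (hx : x ∈ r.tower w) :
    T x ∈ r.tower w := by
  have : r.tower w ≤ (r.tower w).comap T := by
    refine Submodule.span_le.2 ?_
    rintro _ ⟨x, rfl⟩
    exact h x.1 x.2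
  exact this hx

theorem Jm_tower {x : W} (hx : x ∈ r.tower w) : r.Jm x ∈ r.tower w :=
  tower_le_comap (fun i k => by
    rw [← Module.End.mul_apply, ← pow_succ']; exact towerVec_mem i (k + 1)) hx

theorem Kp_pow_mem_hw (h : w ∈ r.hw (p / 2)) (i : ℕ) :
    (r.Kp ^ i) w ∈ r.hw (((p + 2 * i : ℕ) : ℂ) / 2) := by
  induction i with
  | zero => simpa using h
  | succ i ih =>
    rw [pow_succ', Module.End.mul_apply]
    have := Kp_mem_hw ih
    convert this using 1
    push_cast
    congr 1
    ring

theorem J₀_tower (h : w ∈ r.hw (p / 2)) {x : W} (hx : x ∈ r.tower w) : r.J₀ x ∈ r.tower w :=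
  tower_le_comap (fun i k => by
    rw [J₀_Jm_pow (mem_hw.1 (Kp_pow_mem_hw h i)).1]
    exact Submodule.smul_mem _ _ (towerVec_mem i k)) hx

theorem Jp_tower (h : w ∈ r.hw (p / 2)) {x : W} (hx : x ∈ r.tower w) : r.Jp x ∈ r.tower w :=
  tower_le_comap (fun i k => by
    cases k with
    | zero => simp [(mem_hw.1 (Kp_pow_mem_hw h i)).2]
    | succ k =>
      rw [Jp_Jm_pow_of_hw (Kp_pow_mem_hw h i)]
      exact Submodule.smul_mem _ _ (towerVec_mem i k)) hx

theorem K₀_Kp_pow_mem (h : w ∈ r.hw (p / 2)) (h₁ : ∀ x, r.cas₁ x = c₁ • x) (i : ℕ) :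
    r.K₀ ((r.Kp ^ i) w) ∈ r.tower w := by
  have e := K₀_of_hw (Kp_pow_mem_hw h i) (h₁ _)
  rw [← Module.End.mul_apply r.Kp, ← pow_succ'] at e
  have h0 : ((p + 2 * i : ℕ) : ℂ) / 2 + 1 ≠ 0 := by
    have := add_two_mul_ne_zero p i (c := 2) (by norm_num)
    intro e; apply this; push_cast at e ⊢; linear_combination 2 * e
  rw [← Submodule.smul_mem_iff _ h0, e]
  exact Submodule.sub_mem _ (Submodule.smul_mem _ _ (towerVec_mem i 0))
    (Submodule.smul_mem _ _ (Jm_tower (towerVec_mem (i + 1) 0)))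

/-- There is no spin below p/2, so `lower` kills w, and this relation can be solved for K₋w. -/
theorem Km_mem_tower (h : w ∈ r.hw (p / 2)) (h₁ : ∀ x, r.cas₁ x = c₁ • x) (hp : p = 0 → c₁ = 0)
    (hbot : ∀ u ∈ r.hw ((p : ℂ) / 2 - 1), u = 0) :
    r.Km w ∈ r.tower w := by
  have hK := K₀_Kp_pow_mem h h₁ 0
  have hJ : r.Jm (r.Jm (r.Kp w)) ∈ r.tower w := Jm_tower (Jm_tower (towerVec_mem 1 0))
  rw [pow_zero, Module.End.one_apply] at hK
  rcases eq_or_ne p 0 with rfl | h0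
  · have e0 := K₀_of_hw h (h₁ w)
    obtain ⟨e1, e2⟩ := mem_hw.1 h
    -- For spin 0 the coefficient of K₋ in `lower` vanishes. This shorter combination is used
    -- instead; J₊ kills it because c₁ = 0 gives K₀w = -½ J₋K₊w.
    have e3 : (2 : ℂ) • r.Km w + r.Jm (r.Jm (r.Kp w)) = 0 := by
      refine hbot _ (mem_hw.2 ⟨?_, ?_⟩)
      · simp only [map_add, map_sub, map_smul, J₀_Km_apply, J₀_Jm_apply, J₀_Kp_apply, e1]
        module
      · rw [hp rfl] at e0
        simp only [map_add, map_smul, Jp_Km_apply, Jp_Jm_apply, J₀_Jm_apply,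
          J₀_Kp_apply, Jp_Kp_apply, e1, e2, map_zero]
        push_cast at e0 ⊢
        linear_combination (norm := module) (4 : ℂ) • e0
    rw [← Submodule.smul_mem_iff _ (two_ne_zero (α := ℂ)), eq_neg_of_add_eq_zero_left e3]
    exact Submodule.neg_mem _ hJ
  · have e := hbot _ (lower_mem_hw h)
    rw [lower_apply] at e
    have hc : 2 * ((p : ℂ) / 2) * (2 * ((p : ℂ) / 2) + 1) ≠ 0 := by
      rw [mul_div_cancel₀ _ (two_ne_zero)]
      exact mul_ne_zero (Nat.cast_ne_zero.2 h0) (Nat.cast_add_one_ne_zero p)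
    rw [← Submodule.smul_mem_iff _ hc, sub_eq_iff_eq_add.1 (sub_eq_zero.1 e)]
    exact Submodule.add_mem _ hJ (Submodule.smul_mem _ _ (Jm_tower hK))

theorem Km_Kp_pow_mem (h : w ∈ r.hw (p / 2)) (h₁ : ∀ x, r.cas₁ x = c₁ • x)
    (h₂ : ∀ x, r.cas₂ x = c₂ • x) (hp : p = 0 → c₁ = 0)
    (hbot : ∀ u ∈ r.hw ((p : ℂ) / 2 - 1), u = 0) (i : ℕ) :
    r.Km ((r.Kp ^ i) w) ∈ r.tower w := by
  cases i with
  | zero => exact Km_mem_tower h h₁ hp hbot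
  | succ i =>
    have e := Km_Kp_of_hw (Kp_pow_mem_hw h i) (h₁ _) (h₂ _)
    rw [← Module.End.mul_apply r.Kp, ← pow_succ'] at e
    have h0 : 2 * (((p + 2 * i : ℕ) : ℂ) / 2) + 3 ≠ 0 := by
      have := add_two_mul_ne_zero p i (c := 3) (by norm_num)
      intro e; apply this; push_cast at e ⊢; linear_combination e
    rw [← Submodule.smul_mem_iff _ h0, e]
    exact Submodule.add_mem _ (Submodule.sub_mem _ (Submodule.smul_mem _ _ (towerVec_mem i 0))
      (Submodule.smul_mem _ _ (K₀_Kp_pow_mem h h₁ i))) (Jm_tower (K₀_Kp_pow_mem h h₁ (i + 1)))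

/-- Commuting a boost past J₋ yields a boost of one step lower (K₊ gives K₀, K₀ gives K₋), so the
three claims are proved in one induction on k. With the J-stability of the tower this makes it a
submodule. -/
theorem boost_mem (h : w ∈ r.hw (p / 2)) (h₁ : ∀ x, r.cas₁ x = c₁ • x)
    (h₂ : ∀ x, r.cas₂ x = c₂ • x) (hp : p = 0 → c₁ = 0)
    (hbot : ∀ u ∈ r.hw ((p : ℂ) / 2 - 1), u = 0) (i k : ℕ) :
    r.Km ((r.Jm ^ k) ((r.Kp ^ i) w)) ∈ r.tower w ∧ r.K₀ ((r.Jm ^ k) ((r.Kp ^ i) w)) ∈ r.tower w ∧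
      r.Kp ((r.Jm ^ k) ((r.Kp ^ i) w)) ∈ r.tower w := by
  induction k with
  | zero =>
    refine ⟨Km_Kp_pow_mem h h₁ h₂ hp hbot i, K₀_Kp_pow_mem h h₁ i, ?_⟩
    rw [pow_zero, Module.End.one_apply, ← Module.End.mul_apply, ← pow_succ']
    exact towerVec_mem (i + 1) 0
  | succ k ih =>
    obtain ⟨h1, h2, h3⟩ := ih
    rw [pow_succ', Module.End.mul_apply, Km_Jm_apply, K₀_Jm_apply, Kp_Jm_apply]
    exact ⟨Jm_tower h1, Submodule.sub_mem _ (Jm_tower h2) h1,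
      Submodule.add_mem _ (Jm_tower h3) (Submodule.smul_mem _ _ h2)⟩

/-- The index set of the vectors `J₋ᵏ K₊ⁱ w` with `k ≤ 2j`, `j = p/2 + i`. -/
def TowerIndex (p : ℕ) : Type := {x : ℕ × ℕ // x.2 ≤ p + 2 * x.1}

/-- The operator `J² + i J₀`. -/
noncomputable def separator (r : LadderRep W) : Module.End ℂ W :=
  r.Jm * r.Jp + r.J₀ * r.J₀ + r.J₀ + Complex.I • r.J₀

theorem separator_Jm_pow {j : ℂ} {u : W} (h : u ∈ r.hw j) (k : ℕ) :
    r.separator ((r.Jm ^ k) u) = (j * (j + 1) + Complex.I * (j - k)) • (r.Jm ^ k) u := by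
  have e := J₀_Jm_pow (mem_hw.1 h).1 k
  simp only [separator, LinearMap.add_apply, Module.End.mul_apply, LinearMap.smul_apply, e, map_smul]
  cases k with
  | zero => simp only [pow_zero, Module.End.one_apply, (mem_hw.1 h).2, map_zero]; push_cast; module
  | succ k =>
    rw [Jp_Jm_pow_of_hw h, map_smul, ← Module.End.mul_apply, ← pow_succ']
    push_cast
    module

/-- Spins and weights are real, so the real part j(j + 1) shows the spin and the imaginary part
shows the weight. One operator thus separates all the vectors J₋ᵏK₊ⁱw. -/
theorem separator_injective (p : ℕ) : Function.Injective fun x : TowerIndex p =>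
    (((p + 2 * x.1.1 : ℕ) : ℂ) / 2 * (((p + 2 * x.1.1 : ℕ) : ℂ) / 2 + 1) +
      Complex.I * (((p + 2 * x.1.1 : ℕ) : ℂ) / 2 - x.1.2)) := by
  rintro ⟨⟨i, k⟩, hx⟩ ⟨⟨i', k'⟩, hx'⟩ e
  have key : ∀ a k : ℕ, ((a : ℂ) / 2 * ((a : ℂ) / 2 + 1) + Complex.I * ((a : ℂ) / 2 - k)) =
      (((a : ℝ) / 2 * ((a : ℝ) / 2 + 1) : ℝ) : ℂ) + (((a : ℝ) / 2 - k : ℝ) : ℂ) * Complex.I := by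
    intro a k; push_cast; ring
  dsimp only at e
  rw [key, key, Complex.ext_iff] at e
  simp only [Complex.add_re, Complex.ofReal_re, Complex.re_ofReal_mul, Complex.I_re, mul_zero,
    add_zero, Complex.add_im, Complex.ofReal_im, Complex.im_ofReal_mul, Complex.I_im, mul_one,
    zero_add] at e
  obtain ⟨e1, e2⟩ := e
  have h1 : ((p + 2 * i : ℕ) : ℝ) = ((p + 2 * i' : ℕ) : ℝ) := by
    have h2 : (((p + 2 * i : ℕ) : ℝ) - ((p + 2 * i' : ℕ) : ℝ)) *
        (((p + 2 * i : ℕ) : ℝ) + ((p + 2 * i' : ℕ) : ℝ) + 2) = 0 := by linear_combination 4 * e1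
    rcases mul_eq_zero.1 h2 with h | h
    · exact sub_eq_zero.1 h
    · have : (0 : ℝ) < ((p + 2 * i : ℕ) : ℝ) + ((p + 2 * i' : ℕ) : ℝ) + 2 := by positivity
      exact absurd h this.ne'
  rw [h1] at e2
  have h3 : (k : ℝ) = k' := by linarith
  have h1 : p + 2 * i = p + 2 * i' := by exact_mod_cast h1
  have h3 : k = k' := by exact_mod_cast h3
  obtain rfl : i = i' := by omega
  subst h3
  rfl

/-- `W` is generated by a vector `w` of lowest `K`-type `p/2`, and every `K`-type `p/2 + i` is
generated by `K₊ⁱ w`. -/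
structure IsTower (r : LadderRep W) (p : ℕ) (c₁ c₂ : ℂ) (w : W) : Prop where
  locNilpotent : r.LocNilpotent
  mem_hw : w ∈ r.hw (p / 2)
  ne_zero : ∀ i, (r.Kp ^ i) w ≠ 0
  tower_eq_top : r.tower w = ⊤
  bot : ∀ u ∈ r.hw ((p : ℂ) / 2 - 1), u = 0
  cas₁ : ∀ x, r.cas₁ x = c₁ • x
  cas₂ : ∀ x, r.cas₂ x = c₂ • x
  c₁_eq_zero : p = 0 → c₁ = 0

theorem towerVec_linearIndependent (h : w ∈ r.hw (p / 2)) (hne : ∀ i, (r.Kp ^ i) w ≠ 0) :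
    LinearIndependent ℂ fun x : TowerIndex p => r.towerVec w x.1 := by
  refine Module.End.eigenvectors_linearIndependent' r.separator _ (separator_injective p) _ ?_
  rintro ⟨⟨i, k⟩, hx⟩
  refine ⟨Module.End.mem_eigenspace_iff.2 (separator_Jm_pow (Kp_pow_mem_hw h i) k),
    Jm_pow_ne_zero (Kp_pow_mem_hw h i) (hne i) k fun t ht e => ?_⟩
  have : ((p + 2 * i : ℕ) : ℂ) = t := by linear_combination e
  have : p + 2 * i = t := by exact_mod_cast this
  dsimp only at hx
  omega

theorem IsTower.top_le_span (h : r.IsTower p c₁ c₂ w) :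
    ⊤ ≤ Submodule.span ℂ (Set.range fun x : TowerIndex p => r.towerVec w x.1) := by
  rw [← h.tower_eq_top, tower, Submodule.span_le]
  rintro _ ⟨⟨i, k⟩, rfl⟩
  by_cases hk : k ≤ p + 2 * i
  · exact Submodule.subset_span ⟨⟨(i, k), hk⟩, rfl⟩
  · rw [towerVec, Jm_pow_eq_zero h.locNilpotent (Kp_pow_mem_hw h.mem_hw i) (not_le.1 hk)]
    exact Submodule.zero_mem _

/-- The basis `J₋ᵏ K₊ⁱ w`. -/
noncomputable def IsTower.basis (h : r.IsTower p c₁ c₂ w) : Module.Basis (TowerIndex p) ℂ W :=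
  Module.Basis.mk (towerVec_linearIndependent h.mem_hw h.ne_zero) h.top_le_span

theorem IsTower.basis_apply (h : r.IsTower p c₁ c₂ w) (x : TowerIndex p) :
    h.basis x = r.towerVec w x.1 := by
  simp [IsTower.basis]

/-! ### Uniqueness of towers, through the graph of the isomorphism. -/

section Graph

variable {r' : LadderRep W'} {w' : W'}

theorem prodMap_pow (f : Module.End ℂ W) (g : Module.End ℂ W') (k : ℕ) (x : W × W') :
    ((f.prodMap g : Module.End ℂ (W × W')) ^ k) x = ((f ^ k) x.1, (g ^ k) x.2) := by
  induction k with
  | zero => rfl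
  | succ k ih => rw [pow_succ', Module.End.mul_apply, ih, pow_succ', pow_succ']; rfl

theorem prod_towerVec (x : ℕ × ℕ) :
    (r.prod r').towerVec (w, w') x = (r.towerVec w x, r'.towerVec w' x) := by
  simp only [towerVec, prod, prodMap_pow]

theorem prod_mem_hw {j : ℂ} {x : W × W'} :
    x ∈ (r.prod r').hw j ↔ x.1 ∈ r.hw j ∧ x.2 ∈ r'.hw j := by
  simp only [LadderRep.mem_hw, prod, LinearMap.prodMap_apply, Prod.ext_iff, Prod.smul_fst,
    Prod.smul_snd, Prod.fst_zero, Prod.snd_zero]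
  tauto

theorem IsTower.equiv_towerVec (h : r.IsTower p c₁ c₂ w) (h' : r'.IsTower p c₁ c₂ w')
    (x : TowerIndex p) :
    h.basis.equiv h'.basis (Equiv.refl _) (r.towerVec w x.1) = r'.towerVec w' x.1 := by
  rw [← h.basis_apply, Module.Basis.equiv_apply, Equiv.refl_apply, h'.basis_apply]

/-- With `IsTower.graph_mem`: in the direct sum, the tower of (w, w') is exactly the graph of the
linear map that matches the two bases. Outside the index range both components vanish. -/
theorem IsTower.snd_eq (h : r.IsTower p c₁ c₂ w) (h' : r'.IsTower p c₁ c₂ w') {x : W × W'}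
    (hx : x ∈ (r.prod r').tower (w, w')) :
    x.2 = h.basis.equiv h'.basis (Equiv.refl _) x.1 := by
  have : (r.prod r').tower (w, w') ≤ LinearMap.ker (LinearMap.snd ℂ W W' -
      (h.basis.equiv h'.basis (Equiv.refl _)).toLinearMap ∘ₗ LinearMap.fst ℂ W W') := by
    refine Submodule.span_le.2 ?_
    rintro _ ⟨⟨i, k⟩, rfl⟩
    rw [SetLike.mem_coe, LinearMap.mem_ker, LinearMap.sub_apply, sub_eq_zero, prod_towerVec]
    by_cases hk : k ≤ p + 2 * i
    · exact (h.equiv_towerVec h' ⟨(i, k), hk⟩).symm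
    · simp [towerVec, Jm_pow_eq_zero h.locNilpotent (Kp_pow_mem_hw h.mem_hw i) (not_le.1 hk),
        Jm_pow_eq_zero h'.locNilpotent (Kp_pow_mem_hw h'.mem_hw i) (not_le.1 hk)]
  have := this hx
  rwa [LinearMap.mem_ker, LinearMap.sub_apply, sub_eq_zero] at this

theorem IsTower.graph_mem (h : r.IsTower p c₁ c₂ w) (h' : r'.IsTower p c₁ c₂ w') (x : W) :
    (x, h.basis.equiv h'.basis (Equiv.refl _) x) ∈ (r.prod r').tower (w, w') := by
  have : (⊤ : Submodule ℂ W) ≤ ((r.prod r').tower (w, w')).comap (LinearMap.prod LinearMap.id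
      (h.basis.equiv h'.basis (Equiv.refl _)).toLinearMap) := by
    rw [← h.basis.span_eq, Submodule.span_le]
    rintro _ ⟨x, rfl⟩
    refine Submodule.subset_span ⟨x.1, ?_⟩
    rw [prod_towerVec, ← h.equiv_towerVec h' x, ← h.basis_apply]
    rfl
  exact this trivial

/-- A linear map intertwines T and T' as soon as its graph is stable under T × T'. -/
theorem IsTower.commutes (h : r.IsTower p c₁ c₂ w) (h' : r'.IsTower p c₁ c₂ w')
    {T : Module.End ℂ W} {T' : Module.End ℂ W'}
    (hT : ∀ x ∈ (r.prod r').tower (w, w'), T.prodMap T' x ∈ (r.prod r').tower (w, w')) (x : W) :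
    h.basis.equiv h'.basis (Equiv.refl _) (T x) = T' (h.basis.equiv h'.basis (Equiv.refl _) x) :=
  (h.snd_eq h' (hT _ (h.graph_mem h' x))).symm

/-- The direct sum satisfies the hypotheses of `boost_mem` for (w, w') with the same Casimir values,
so the graph is a submodule. No structure constants have to be compared. -/
theorem IsTower.intertwines (h : r.IsTower p c₁ c₂ w) (h' : r'.IsTower p c₁ c₂ w') :
    Intertwines r r' (h.basis.equiv h'.basis (Equiv.refl _)).toLinearMap := by
  have hw : (w, w') ∈ (r.prod r').hw (p / 2) := prod_mem_hw.2 ⟨h.mem_hw, h'.mem_hw⟩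
  have hb : ∀ u ∈ (r.prod r').hw ((p : ℂ) / 2 - 1), u = 0 := fun u hu =>
    Prod.ext (h.bot _ (prod_mem_hw.1 hu).1) (h'.bot _ (prod_mem_hw.1 hu).2)
  have h₁ : ∀ x, (r.prod r').cas₁ x = c₁ • x := fun x => Prod.ext (h.cas₁ x.1) (h'.cas₁ x.2)
  have h₂ : ∀ x, (r.prod r').cas₂ x = c₂ • x := fun x => Prod.ext (h.cas₂ x.1) (h'.cas₂ x.2)
  have hK := boost_mem hw h₁ h₂ h.c₁_eq_zero hb
  exact ⟨h.commutes h' fun x hx => J₀_tower hw hx, h.commutes h' fun x hx => Jp_tower hw hx,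
    h.commutes h' fun x hx => Jm_tower hx,
    h.commutes h' fun x hx => tower_le_comap (T := (r.prod r').K₀) (fun i k => (hK i k).2.1) hx,
    h.commutes h' fun x hx => tower_le_comap (T := (r.prod r').Kp) (fun i k => (hK i k).2.2) hx,
    h.commutes h' fun x hx => tower_le_comap (T := (r.prod r').Km) (fun i k => (hK i k).1) hx⟩

end Graph

end LadderRep

theorem nonempty_lieModuleEquiv {W W' : Type*} [AddCommGroup W] [Module ℂ W]
    [LieRingModule Spin31 W] [LieModule ℂ Spin31 W] [AddCommGroup W'] [Module ℂ W']
    [LieRingModule Spin31 W'] [LieModule ℂ Spin31 W'] {p : ℕ} {c₁ c₂ : ℂ} {w : W} {w' : W'}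
    (h : (LadderRep.ofModule W).IsTower p c₁ c₂ w) (h' : (LadderRep.ofModule W').IsTower p c₁ c₂ w') :
    Nonempty (W ≃ₗ⁅ℂ, Spin31⁆ W') :=
  ⟨{ h.basis.equiv h'.basis (Equiv.refl _) with
      map_lie' := fun {x m} => (h.intertwines h').map_lie x m }⟩

end Lorentz

/-! ### Kets, and infinite-dimensionality of V_{λ,ρ} as a condition on ρ. -/

namespace Lorentz

theorem csqrt_ne_zero {x : ℂ} (h : x ≠ 0) : Complex.sqrt x ≠ 0 := fun e => h (by
  rw [← sqrt_sq x, e]; norm_num)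

theorem csqrt_zero : Complex.sqrt 0 = 0 := by simp [Complex.sqrt]

theorem csqrt_mul_self (x : ℂ) : Complex.sqrt x * Complex.sqrt x = x := by
  rw [← pow_two, sqrt_sq]

section Kets

variable {S : Set (ℤ × ℤ)} {n q : ℤ}

theorem ketBasis_apply (x : S) : ketBasis S x = ket S x.1.1 x.1.2 := by
  rw [ket, dif_pos x.2]

theorem ket_of_notMem (h : (n, q) ∉ S) : ket S n q = 0 := by rw [ket, dif_neg h]

theorem ket_ne_zero (h : (n, q) ∈ S) : ket S n q ≠ 0 := by
  rw [ket, dif_pos h]; exact (ketBasis S).ne_zero _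

theorem ladder_ket {s : ℤ} {up mid down : ℂ → ℂ → ℂ} (h : (n, q) ∈ S) :
    ladder S s up mid down (ket S n q) = ladderKet S s up mid down n q := by
  simpa using ladder_smul_ket (s := s) (up := up) (mid := mid) (down := down) (c := 1) fun _ => h

theorem span_ket : Submodule.span ℂ {x | ∃ n q, (n, q) ∈ S ∧ x = ket S n q} = ⊤ := by
  rw [eq_top_iff, ← (ketBasis S).span_eq, Submodule.span_le]
  rintro _ ⟨x, rfl⟩
  exact Submodule.subset_span ⟨_, _, x.2, ketBasis_apply x⟩

theorem ladder_pow_ket {s : ℤ} {f : ℂ → ℂ → ℂ} (k : ℕ) :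
    ∃ c : ℂ, (ladder S s (fun _ _ => 0) f (fun _ _ => 0) ^ k) (ket S n q) =
      c • ket S n (q + 2 * s * k) := by
  induction k with
  | zero => exact ⟨1, by simp⟩
  | succ k ih =>
    obtain ⟨c, hc⟩ := ih
    rw [pow_succ', Module.End.mul_apply, hc, map_smul]
    by_cases h : (n, q + 2 * s * k) ∈ S
    · refine ⟨c * f (n / 2) ((q + 2 * s * k : ℤ) / 2), ?_⟩
      rw [ladder_ket h, ladderKet, zero_smul, zero_smul, zero_add, add_zero, smul_smul]
      push_cast
      congr 2
      ring
    · exact ⟨0, by rw [ket_of_notMem h, map_zero, smul_zero, zero_smul]⟩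

theorem exists_pow_eq_zero_of_span {W : Type*} [AddCommGroup W] [Module ℂ W] {T : Module.End ℂ W}
    {s : Set W} (hs : Submodule.span ℂ s = ⊤) (h : ∀ x ∈ s, ∃ k, (T ^ k) x = 0) (w : W) :
    ∃ k, (T ^ k) w = 0 := by
  have hw : w ∈ Submodule.span ℂ s := hs ▸ trivial
  induction hw using Submodule.span_induction with
  | mem x hx => exact h x hx
  | zero => exact ⟨0, map_zero _⟩
  | add x y _ _ hx hy =>
    obtain ⟨k, hk⟩ := hx
    obtain ⟨k', hk'⟩ := hy
    refine ⟨k + k', ?_⟩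
    rw [map_add]
    have e1 : (T ^ (k + k')) x = 0 := by
      rw [add_comm, pow_add, Module.End.mul_apply, hk, map_zero]
    have e2 : (T ^ (k + k')) y = 0 := by
      rw [pow_add, Module.End.mul_apply, hk', map_zero]
    rw [e1, e2, add_zero]
  | smul c x _ hx =>
    obtain ⟨k, hk⟩ := hx
    exact ⟨k, by rw [map_smul, hk, smul_zero]⟩

theorem opJp_nilpotent (hS : WeightClosed S) (w : Kets S) : ∃ k, (opJp S ^ k) w = 0 := by
  refine exists_pow_eq_zero_of_span span_ket ?_ w
  rintro _ ⟨n, q, h, rfl⟩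
  obtain ⟨h1, h2, h3⟩ := (hS n q h).1
  obtain ⟨c, hc⟩ := ladder_pow_ket (S := S) (s := 1) (f := Cp) (n := n) (q := q) (2 * n + 1).toNat
  refine ⟨_, hc.trans ?_⟩
  rw [ket_of_notMem, smul_zero]
  intro h'
  obtain ⟨h4, h5, h6⟩ := (hS _ _ h').1
  omega

theorem opJm_nilpotent (hS : WeightClosed S) (w : Kets S) : ∃ k, (opJm S ^ k) w = 0 := by
  refine exists_pow_eq_zero_of_span span_ket ?_ w
  rintro _ ⟨n, q, h, rfl⟩
  obtain ⟨h1, h2, h3⟩ := (hS n q h).1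
  obtain ⟨c, hc⟩ := ladder_pow_ket (S := S) (s := -1) (f := Cm) (n := n) (q := q)
    (2 * n + 1).toNat
  refine ⟨_, hc.trans ?_⟩
  rw [ket_of_notMem, smul_zero]
  intro h'
  obtain ⟨h4, h5, h6⟩ := (hS _ _ h').1
  omega

theorem opJ₀_ket : opJ₀ S (ket S n q) = ((q : ℂ) / 2) • ket S n q := by
  by_cases h : (n, q) ∈ S
  · rw [ladder_ket h, ladderKet]; simp
  · rw [ket_of_notMem h, map_zero, smul_zero]

theorem opJp_ket_top : opJp S (ket S n n) = 0 := by
  by_cases h : (n, n) ∈ S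
  · rw [ladder_ket h, ladderKet]; simp [Cp]
  · rw [ket_of_notMem h, map_zero]

theorem opJm_pow_ket_top (hS : WeightClosed S) (h : (n, n) ∈ S) {k : ℕ} (hk : (k : ℤ) ≤ n) :
    ∃ c : ℂ, c ≠ 0 ∧ (opJm S ^ k) (ket S n n) = c • ket S n (n - 2 * k) := by
  induction k with
  | zero => exact ⟨1, one_ne_zero, by simp⟩
  | succ k ih =>
    obtain ⟨c, hc, e⟩ := ih (by push_cast at hk; omega)
    have hm : (n, n - 2 * (k : ℤ)) ∈ S := (hS n n h).2 _ ⟨by push_cast at hk; omega, by omega,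
      by omega⟩
    refine ⟨c * Cm (n / 2) ((n - 2 * (k : ℤ) : ℤ) / 2), mul_ne_zero hc (mul_ne_zero
      (csqrt_ne_zero ?_) (csqrt_ne_zero ?_)), ?_⟩
    · have : ((n - k : ℤ) : ℂ) ≠ 0 := by
        have : n - k ≠ 0 := by push_cast at hk; omega
        exact_mod_cast this
      intro e; apply this; push_cast at e ⊢; linear_combination e
    · have : ((k + 1 : ℕ) : ℂ) ≠ 0 := Nat.cast_ne_zero.2 (by omega)
      intro e; apply this; push_cast at e ⊢; linear_combination e
    · rw [pow_succ', Module.End.mul_apply, e, map_smul, ladder_ket hm, ladderKet, zero_smul,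
        zero_smul, zero_add, add_zero, smul_smul]
      push_cast
      congr 2
      ring

end Kets

section Generic

variable {l : ℤ} {rho : ℂ}

/-- `ρ` is not of the form `±(|λ| + k)` with an integer `k ≥ 1`, `λ = l/2`. -/
def Generic (l : ℤ) (rho : ℂ) : Prop :=
  ∀ i : ℕ, (((|l| + 2 * i : ℤ) : ℂ) / 2 + 1) ^ 2 ≠ rho ^ 2

theorem succ_sq_ne (l : ℤ) (i : ℕ) :
    (((|l| + 2 * i : ℤ) : ℂ) / 2 + 1) ^ 2 ≠ ((l : ℂ) / 2) ^ 2 := by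
  intro e
  have h : ((|l| + 2 * i + 2) ^ 2 : ℤ) = l ^ 2 := by
    have : (((|l| + 2 * i + 2) ^ 2 : ℤ) : ℂ) = ((l ^ 2 : ℤ) : ℂ) := by
      push_cast at e ⊢; linear_combination 4 * e
    exact_mod_cast this
  rw [← sq_abs l] at h
  have := abs_nonneg l
  have := (pow_left_inj₀ (by omega) (by omega) two_ne_zero).1 h
  omega

theorem cast_abs_add_ne_zero (l : ℤ) (i : ℕ) {c : ℤ} (hc : 0 < c) :
    ((|l| + 2 * i : ℤ) : ℂ) + c ≠ 0 := by
  have := abs_nonneg l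
  have : |l| + 2 * (i : ℤ) + c ≠ 0 := by omega
  exact_mod_cast this

/-- Here j + 1 > |λ| (`succ_sq_ne`), so the factors with λ and the denominator are non-zero and only
j + 1 = ±ρ can produce a zero. -/
theorem Pplus_ne_zero_iff (i : ℕ) : Pplus (l / 2) rho (((|l| + 2 * i : ℤ) : ℂ) / 2) ≠ 0 ↔
    (((|l| + 2 * i : ℤ) : ℂ) / 2 + 1) ^ 2 ≠ rho ^ 2 := by
  have e2 := cast_abs_add_ne_zero l i (c := 2) (by norm_num)
  have e3 := cast_abs_add_ne_zero l i (c := 3) (by norm_num)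
  have e1 := cast_abs_add_ne_zero l i (c := 1) (by norm_num)
  have hl := succ_sq_ne l i
  generalize ((|l| + 2 * i : ℤ) : ℂ) = x at *
  push_cast at e1 e2 e3
  have f1 : Complex.sqrt (x / 2 + 1 + l / 2) ≠ 0 :=
    csqrt_ne_zero fun e => hl (by linear_combination (x / 2 + 1 - l / 2) * e)
  have f2 : Complex.sqrt (x / 2 + 1 - l / 2) ≠ 0 :=
    csqrt_ne_zero fun e => hl (by linear_combination (x / 2 + 1 + l / 2) * e)
  have f3 : Complex.sqrt (2 * (x / 2 + 1) + 1) ≠ 0 :=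
    csqrt_ne_zero fun e => e3 (by linear_combination e)
  have f4 : Complex.sqrt (2 * (x / 2 + 1) - 1) ≠ 0 :=
    csqrt_ne_zero fun e => e1 (by linear_combination e)
  have f5 : x / 2 + 1 ≠ 0 := fun e => e2 (by linear_combination 2 * e)
  simp only [Pplus, Pminus, ne_eq, div_eq_zero_iff, mul_eq_zero, f1, f2, f3, f4, f5, false_or,
    or_false]
  constructor
  · intro h e
    have : (x / 2 + 1 + rho) * (x / 2 + 1 - rho) = 0 := by linear_combination e
    refine h ((mul_eq_zero.1 this).imp ?_ ?_) <;>
    · intro e; rw [e, csqrt_zero]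
  · rintro h (e | e)
    · exact csqrt_ne_zero (fun e => h (by linear_combination (x / 2 + 1 - rho) * e)) e
    · exact csqrt_ne_zero (fun e => h (by linear_combination (x / 2 + 1 + rho) * e)) e

theorem Generic.mem_spins (h : Generic l rho) {n : ℤ} :
    n ∈ spins l rho ↔ ∃ k : ℕ, n = |l| + 2 * k :=
  ⟨fun hn => hn.1, fun hn => ⟨hn, fun i _ => (Pplus_ne_zero_iff i).2 (h i)⟩⟩

/-- A zero of P⁺ bounds the spins, which leaves only finitely many basis kets. -/
theorem generic_of_not_finiteDimensional (h : ¬ FiniteDimensional ℂ (V l rho)) :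
    Generic l rho := by
  intro i e
  apply h
  have hfin : (basisSet l rho).Finite := by
    refine ((Set.finite_Icc (-(|l| + 2 * i), -(|l| + 2 * (i : ℤ))) (|l| + 2 * (i : ℤ), |l| + 2 * (i : ℤ)))).subset ?_
    rintro ⟨n, q⟩ ⟨⟨⟨k, hk⟩, hn⟩, h1, h2, h3⟩
    dsimp only at hk hn h1 h2 h3
    have : ¬ |l| + 2 * (i : ℤ) < n := fun hlt => (Pplus_ne_zero_iff i).1 (hn i hlt) e
    have := abs_nonneg l
    refine ⟨⟨?_, ?_⟩, ?_, ?_⟩ <;> dsimp only <;> omega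
  have := hfin.to_subtype
  exact Module.Finite.of_basis (ketBasis (basisSet l rho))

end Generic

end Lorentz

/-! ### V_{λ,ρ} is a tower over its lowest spin |λ|. -/

namespace Lorentz

open LadderRep

section VTower

variable {l : ℤ} {rho : ℂ}

theorem Generic.mem_basisSet (h : Generic l rho) {n q : ℤ} :
    (n, q) ∈ basisSet l rho ↔ (∃ k : ℕ, n = |l| + 2 * k) ∧ q ∈ weights n :=
  and_congr_left' h.mem_spins

theorem mem_weights_self {n : ℤ} (hn : 0 ≤ n) : n ∈ weights n := ⟨by omega, le_rfl, by simp⟩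

theorem Generic.top_mem (h : Generic l rho) (i : ℕ) :
    (|l| + 2 * (i : ℤ), |l| + 2 * (i : ℤ)) ∈ basisSet l rho :=
  h.mem_basisSet.2 ⟨⟨i, rfl⟩, mem_weights_self (by have := abs_nonneg l; omega)⟩

theorem locNilpotent_repV (l : ℤ) (rho : ℂ) : (repV l rho).LocNilpotent :=
  ⟨opJp_nilpotent (weightClosed_basisSet l rho), opJm_nilpotent (weightClosed_basisSet l rho)⟩

theorem ket_top_mem_hw (S : Set (ℤ × ℤ)) (n : ℤ) :
    opJ₀ S (ket S n n) = ((n : ℂ) / 2) • ket S n n ∧ opJp S (ket S n n) = 0 :=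
  ⟨opJ₀_ket, opJp_ket_top⟩

theorem opKp_ket_top {n : ℤ} (h : (n, n) ∈ basisSet l rho) :
    opKp l rho (ket _ n n) = (-Pplus (l / 2) rho (n / 2) * Complex.sqrt (n + 1)
      * Complex.sqrt (n + 2)) • ket _ (n + 2) (n + 2) := by
  rw [ladder_ket h, ladderKet, Cp, sub_self, csqrt_zero]
  simp only [zero_mul, mul_zero, zero_smul, add_zero, mul_one]
  congr 5 <;> ring

theorem Generic.Kp_pow_ket (h : Generic l rho) (i : ℕ) :
    ∃ c : ℂ, c ≠ 0 ∧ (opKp l rho ^ i) (ket (basisSet l rho) |l| |l|) =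
      c • ket (basisSet l rho) (|l| + 2 * i) (|l| + 2 * i) := by
  induction i with
  | zero => exact ⟨1, one_ne_zero, by simp⟩
  | succ i ih =>
    obtain ⟨c, hc, e⟩ := ih
    have e1 := cast_abs_add_ne_zero l i (c := 1) (by norm_num)
    have e2 := cast_abs_add_ne_zero l i (c := 2) (by norm_num)
    push_cast at e1 e2
    rw [pow_succ', Module.End.mul_apply, e, map_smul, opKp_ket_top (h.top_mem i), smul_smul]
    refine ⟨_, mul_ne_zero hc (mul_ne_zero (mul_ne_zero (neg_ne_zero.2
      ((Pplus_ne_zero_iff i).2 (h i))) (csqrt_ne_zero (x := ((|l| + 2 * i : ℤ) : ℂ) + 1) ?_))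
      (csqrt_ne_zero (x := ((|l| + 2 * i : ℤ) : ℂ) + 2) ?_)), ?_⟩
    · push_cast; exact e1
    · push_cast; exact e2
    · push_cast
      ring_nf

/-- K₊ⁱ leads to the top ket of spin |λ| + i because P⁺ has no zero, and J₋ then sweeps out the
multiplet. -/
theorem Generic.tower_eq_top (h : Generic l rho) :
    (repV l rho).tower (ket (basisSet l rho) |l| |l|) = ⊤ := by
  rw [eq_top_iff, ← span_ket, Submodule.span_le]
  rintro _ ⟨n, q, hnq, rfl⟩
  obtain ⟨⟨i, rfl⟩, h1, h2, k, hk⟩ := h.mem_basisSet.1 hnq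
  obtain ⟨c, hc, e⟩ := h.Kp_pow_ket i
  lift k to ℕ using by omega
  obtain ⟨c', hc', e'⟩ := opJm_pow_ket_top (weightClosed_basisSet l rho) (h.top_mem i) (k := k)
    (by omega)
  have hm := towerVec_mem (r := repV l rho) (w := ket (basisSet l rho) |l| |l|) i k
  change (opJm _ ^ k) ((opKp l rho ^ i) _) ∈ _ at hm
  rw [e, map_smul, e', smul_smul, Submodule.smul_mem_iff _ (mul_ne_zero hc hc')] at hm
  have : q = |l| + 2 * i - 2 * k := by omega
  rw [this]
  exact hm

theorem Pplus_sq (i : ℕ) {j : ℂ} (hj : j = ((|l| + 2 * i : ℤ) : ℂ) / 2) :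
    (j + 1) ^ 2 * ((2 * j + 1) * (2 * j + 3)) * Pplus (l / 2) rho j ^ 2 =
      ((j + 1) ^ 2 - (l / 2) ^ 2) * ((j + 1) ^ 2 - rho ^ 2) := by
  have e1 : 2 * j + 1 ≠ 0 := by
    have := cast_abs_add_ne_zero l i (c := 1) (by norm_num)
    intro e; apply this; rw [hj] at e; push_cast at e ⊢; linear_combination e
  have e2 : j + 1 ≠ 0 := by
    have := cast_abs_add_ne_zero l i (c := 2) (by norm_num)
    intro e; apply this; rw [hj] at e; push_cast at e ⊢; linear_combination 2 * e
  have e3 : 2 * j + 3 ≠ 0 := by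
    have := cast_abs_add_ne_zero l i (c := 3) (by norm_num)
    intro e; apply this; rw [hj] at e; push_cast at e ⊢; linear_combination e
  simp only [Pplus, Pminus, div_pow, mul_pow, sqrt_sq]
  rw [show 2 * (j + 1) + 1 = 2 * j + 3 by ring, show 2 * (j + 1) - 1 = 2 * j + 1 by ring]
  rw [← mul_div_assoc, div_eq_iff (mul_ne_zero (mul_ne_zero (pow_ne_zero 2 e2) e3) e1)]
  ring

theorem Pzero_mul (i : ℕ) {j : ℂ} (hj : j = ((|l| + 2 * i : ℤ) : ℂ) / 2) :
    (j + 1) * (j * Pzero (l / 2) rho j) = Complex.I * (l / 2) * rho := by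
  have e2 : j + 1 ≠ 0 := by
    have := cast_abs_add_ne_zero l i (c := 2) (by norm_num)
    intro e; apply this; rw [hj] at e; push_cast at e ⊢; linear_combination 2 * e
  by_cases h0 : j = 0
  · have : l = 0 := by
      have h1 : ((|l| + 2 * i : ℤ) : ℂ) = 0 := by linear_combination 2 * h0 - 2 * hj
      have h1 : |l| + 2 * (i : ℤ) = 0 := by exact_mod_cast h1
      have := abs_nonneg l
      exact abs_eq_zero.1 (by omega)
    subst this
    simp [h0]
  · simp only [Pzero, h0, if_false]
    field_simp

theorem Generic.mem_basisSet_of (h : Generic l rho) {n q : ℤ} {i : ℕ} (hn : n = |l| + 2 * i)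
    (h1 : -n ≤ q) (h2 : q ≤ n) (h3 : 2 ∣ n - q) : (n, q) ∈ basisSet l rho :=
  h.mem_basisSet.2 ⟨⟨i, hn⟩, h1, h2, h3⟩

theorem csqrt_one : Complex.sqrt 1 = 1 := by simp [Complex.sqrt]

theorem opK₀_ket_top {n : ℤ} (h : (n, n) ∈ basisSet l rho) :
    opK₀ l rho (ket _ n n) = (Pplus (l / 2) rho (n / 2) * Complex.sqrt (n + 1)) • ket _ (n + 2) n
      + (Pzero (l / 2) rho (n / 2) * (n / 2)) • ket _ n n := by
  rw [ladder_ket h, ladderKet, sub_self, csqrt_zero, zero_add, csqrt_one]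
  simp only [mul_zero, zero_smul, add_zero, mul_one, add_halves]

theorem opK₀_ket_pred {n : ℤ} (h : (n + 2, n) ∈ basisSet l rho) :
    opK₀ l rho (ket _ (n + 2) n) =
      (Pplus (l / 2) rho (n / 2 + 1) * Complex.sqrt (n + 2) * Complex.sqrt 2) • ket _ (n + 4) n
      + (Pzero (l / 2) rho (n / 2 + 1) * (n / 2)) • ket _ (n + 2) n
      + (Pplus (l / 2) rho (n / 2) * Complex.sqrt (n + 1)) • ket _ n n := by
  have e : ((n + 2 : ℤ) : ℂ) / 2 = n / 2 + 1 := by push_cast; ring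
  rw [ladder_ket h, ladderKet, e, Pplus, Pplus]
  have e1 : (n : ℂ) / 2 + 1 + n / 2 + 1 = n + 2 := by ring
  have e2 : (n : ℂ) / 2 + 1 - n / 2 + 1 = 2 := by ring
  have e3 : (n : ℂ) / 2 + 1 + n / 2 = n + 1 := by ring
  have e4 : (n : ℂ) / 2 + 1 - n / 2 = 1 := by ring
  have e5 : n + 2 + 2 = n + 4 := by ring
  rw [e1, e2, e3, e4, e5, csqrt_one, add_sub_cancel_right, mul_zero, add_zero, mul_one]

theorem opKm_ket_top {n : ℤ} (h : (n + 2, n + 2) ∈ basisSet l rho) :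
    opKm l rho (ket _ (n + 2) (n + 2)) =
      (Pplus (l / 2) rho (n / 2 + 1) * Complex.sqrt 2) • ket _ (n + 4) n
      + (Pzero (l / 2) rho (n / 2 + 1) * Complex.sqrt (n + 2)) • ket _ (n + 2) n
      + (-Pplus (l / 2) rho (n / 2) * Complex.sqrt (n + 2) * Complex.sqrt (n + 1)) • ket _ n n := by
  have e : ((n + 2 : ℤ) : ℂ) / 2 = n / 2 + 1 := by push_cast; ring
  rw [ladder_ket h, ladderKet, e, Pplus, Pplus, Cm]
  have e1 : (n : ℂ) / 2 + 1 + (n / 2 + 1) = n + 2 := by ring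
  have e2 : (n : ℂ) + 2 - 1 = n + 1 := by ring
  have e3 : (0 : ℂ) + 2 = 2 := by ring
  have e5 : n + 2 + 2 = n + 4 := by ring
  have e6 : n + 2 + 2 * -1 = n := by ring
  rw [sub_self, zero_add, e1, e2, e3, e5, e6, csqrt_one, add_sub_cancel_right, mul_one, mul_one]

theorem opJm_ket_top {S : Set (ℤ × ℤ)} {n : ℤ} (h : (n + 2, n + 2) ∈ S) :
    opJm S (ket _ (n + 2) (n + 2)) = Complex.sqrt (n + 2) • ket _ (n + 2) n := by
  have e : ((n + 2 : ℤ) : ℂ) / 2 + ((n + 2 : ℤ) : ℂ) / 2 = n + 2 := by push_cast; ring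
  have e6 : n + 2 + 2 * -1 = n := by ring
  rw [ladder_ket h, ladderKet, Cm, sub_self, zero_add, e, e6, csqrt_one]
  simp

theorem Generic.cas₁_ket (h : Generic l rho) :
    (repV l rho).cas₁ (ket (basisSet l rho) |l| |l|) =
      (Complex.I * (l / 2) * rho) • ket (basisSet l rho) |l| |l| := by
  have hl := abs_nonneg l
  have m0 := h.mem_basisSet_of (n := |l|) (q := |l|) (i := 0) (by simp) (by omega) le_rfl (by simp)
  have m2 := h.mem_basisSet_of (n := |l| + 2) (q := |l| + 2) (i := 1) (by simp) (by omega)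
    (by omega) (by simp)
  have hz := Pzero_mul (l := l) (rho := rho) (j := ((|l| : ℤ) : ℂ) / 2) 0 (by simp)
  have hs := csqrt_mul_self (((|l| : ℤ) : ℂ) + 2)
  rw [cas₁_apply]
  change opJ₀ _ (opK₀ l rho _) + opK₀ l rho _ + opKm l rho (opJp _ _) +
    (1 / 2 : ℂ) • (opJm _ (opKp l rho _) - opKm l rho (opJp _ _)) = _
  rw [opJp_ket_top, opKp_ket_top m0, map_smul, opJm_ket_top m2, opK₀_ket_top m0]
  simp only [map_add, map_smul, opJ₀_ket, map_zero]
  generalize Complex.sqrt (((|l| : ℤ) : ℂ) + 2) = s at *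
  generalize Complex.sqrt (((|l| : ℤ) : ℂ) + 1) = t at *
  generalize ((|l| : ℤ) : ℂ) = x at *
  match_scalars
  · linear_combination (-(1 / 2) * Pplus (l / 2) rho (x / 2) * t) * hs
  · linear_combination hz

theorem Generic.cas₂_ket (h : Generic l rho) :
    (repV l rho).cas₂ (ket (basisSet l rho) |l| |l|) =
      (((l : ℂ) / 2) ^ 2 + rho ^ 2 - 1) • ket (basisSet l rho) |l| |l| := by
  have hl := abs_nonneg l
  have m0 := h.mem_basisSet_of (n := |l|) (q := |l|) (i := 0) (by simp) (by omega) le_rfl (by simp)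
  have m1 := h.mem_basisSet_of (n := |l| + 2) (q := |l|) (i := 1) (by simp) (by omega) (by omega)
    (by simp)
  have m2 := h.mem_basisSet_of (n := |l| + 2) (q := |l| + 2) (i := 1) (by simp) (by omega)
    (by omega) (by simp)
  have hz := Pzero_mul (l := l) (rho := rho) (j := ((|l| : ℤ) : ℂ) / 2) 0 (by simp)
  have hp := Pplus_sq (l := l) (rho := rho) (j := ((|l| : ℤ) : ℂ) / 2) 0 (by simp)
  have hf := (P_facts m0.1 (j := ((|l| : ℤ) : ℂ) / 2) rfl).2.1
  have hs := csqrt_mul_self (((|l| : ℤ) : ℂ) + 2)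
  have ht := csqrt_mul_self (((|l| : ℤ) : ℂ) + 1)
  have hne := cast_abs_add_ne_zero l 0 (c := 2) (by norm_num)
  rw [cas₂_apply]
  change opJ₀ _ (opJ₀ _ _) + opJ₀ _ _ + opJm _ (opJp _ _) -
    (opK₀ l rho (opK₀ l rho _) + opKm l rho (opKp l rho _) - opJ₀ _ _) = _
  rw [opJp_ket_top, opKp_ket_top m0, opK₀_ket_top m0]
  simp only [map_add, map_smul, opJ₀_ket, map_zero]
  rw [opK₀_ket_top m0, opK₀_ket_pred m1, opKm_ket_top m2]
  push_cast at hne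
  simp only [add_zero] at hne
  generalize Complex.sqrt (((|l| : ℤ) : ℂ) + 2) = s at *
  generalize Complex.sqrt (((|l| : ℤ) : ℂ) + 1) = t at *
  generalize ((|l| : ℤ) : ℂ) = x at *
  have hne' : (x / 2 + 1) ^ 2 ≠ 0 := pow_ne_zero 2 fun e => hne (by linear_combination 2 * e)
  match_scalars
  · refine mul_left_cancel₀ hne' ?_
    linear_combination (-(x / 2 + 1) ^ 2 * Pplus (l / 2) rho (x / 2) ^ 2 * (1 + s * s)) * ht
      - ((x / 2 + 1) ^ 2 * Pplus (l / 2) rho (x / 2) ^ 2 * (x + 1)) * hs - hp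
      - ((x / 2 + 1) * (x / 2 * Pzero (l / 2) rho (x / 2)) + Complex.I * (l / 2) * rho) * hz
      - (l / 2 * rho) ^ 2 * Complex.I_sq
  · ring
  · linear_combination (-Pplus (l / 2) rho (x / 2) * t) * hf
      + (Pplus (l / 2) rho (x / 2) * t * Pzero (l / 2) rho (x / 2 + 1)) * hs

/-- This is why the Casimirs of V_{λ,ρ} are computed on a single ket. -/
theorem cas_eq_of_tower {W : Type*} [AddCommGroup W] [Module ℂ W] {r : LadderRep W} {w : W}
    (ht : r.tower w = ⊤) {C : Module.End ℂ W} (hm : ∀ x, C (r.Jm x) = r.Jm (C x))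
    (hp : ∀ x, C (r.Kp x) = r.Kp (C x)) {c : ℂ} (hw : C w = c • w) (x : W) : C x = c • x := by
  have hx : x ∈ r.tower w := ht ▸ trivial
  have h1 : ∀ i : ℕ, ∀ x, C ((r.Kp ^ i) x) = (r.Kp ^ i) (C x) := by
    intro i
    induction i with
    | zero => simp
    | succ i ih => intro x; rw [pow_succ, Module.End.mul_apply, ih, hp]; rfl
  have h2 : ∀ i : ℕ, ∀ x, C ((r.Jm ^ i) x) = (r.Jm ^ i) (C x) := by
    intro i
    induction i with
    | zero => simp
    | succ i ih => intro x; rw [pow_succ, Module.End.mul_apply, ih, hm]; rfl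
  rw [← Module.End.mem_eigenspace_iff]
  refine Submodule.span_le.2 ?_ hx
  rintro _ ⟨⟨i, k⟩, rfl⟩
  rw [SetLike.mem_coe, Module.End.mem_eigenspace_iff, towerVec, h2, h1, hw, map_smul, map_smul]

/-- Such a vector is an eigenvector of `separator` for a value that occurs nowhere in the tower,
although the tower is everything. -/
theorem eq_zero_of_mem_hw_pred {W : Type*} [AddCommGroup W] [Module ℂ W] {r : LadderRep W} {w : W}
    {p : ℕ} (hl : r.LocNilpotent) (hw : w ∈ r.hw (p / 2)) (ht : r.tower w = ⊤) {u : W}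
    (hu : u ∈ r.hw ((p : ℂ) / 2 - 1)) : u = 0 := by
  have hs := separator_Jm_pow hu 0
  rw [pow_zero, Module.End.one_apply] at hs
  set μ : ℂ := ((p : ℂ) / 2 - 1) * ((p : ℂ) / 2 - 1 + 1) + Complex.I * ((p : ℂ) / 2 - 1 - (0 : ℕ))
  have hd := r.separator.eigenspaces_iSupIndep μ
  have htop : (⊤ : Submodule ℂ W) ≤ ⨆ ν, ⨆ (_ : ν ≠ μ), r.separator.eigenspace ν := by
    rw [← ht, tower, Submodule.span_le]
    rintro _ ⟨⟨i, k⟩, rfl⟩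
    by_cases hk : k ≤ p + 2 * i
    · refine Submodule.mem_iSup_of_mem _ (Submodule.mem_iSup_of_mem ?_
        (Module.End.mem_eigenspace_iff.2 (separator_Jm_pow (Kp_pow_mem_hw hw i) k)))
      intro e
      have e' : ((((p + 2 * i : ℕ) : ℝ) / 2 * (((p + 2 * i : ℕ) : ℝ) / 2 + 1) : ℝ) : ℂ) +
          ((((p + 2 * i : ℕ) : ℝ) / 2 - k : ℝ) : ℂ) * Complex.I =
          ((((p : ℝ) / 2 - 1) * ((p : ℝ) / 2) : ℝ) : ℂ) +
          (((p : ℝ) / 2 - 1 : ℝ) : ℂ) * Complex.I := by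
        simp only [μ] at e
        push_cast at e ⊢
        linear_combination e
      rw [Complex.ext_iff] at e'
      simp only [Complex.add_re, Complex.ofReal_re, Complex.re_ofReal_mul, Complex.I_re, mul_zero,
        add_zero, Complex.add_im, Complex.ofReal_im, Complex.im_ofReal_mul, Complex.I_im, mul_one,
        zero_add] at e'
      obtain ⟨e1, e2⟩ := e'
      have hp : (0 : ℝ) ≤ p := Nat.cast_nonneg p
      have hi : (0 : ℝ) ≤ i := Nat.cast_nonneg i
      push_cast at e1 e2
      -- The spins p/2 + i and p/2 - 1 can share j(j + 1) only as 0 and -1, that is for p = i = 0.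
      -- There the weights 0 and -1 still differ.
      have hpi : (p : ℝ) + i = 0 := by
        nlinarith [mul_nonneg hp hi, mul_nonneg hi hi]
      have hpi : p + i = 0 := by exact_mod_cast hpi
      obtain rfl : p = 0 := by omega
      obtain rfl : i = 0 := by omega
      obtain rfl : k = 0 := by omega
      norm_num at e2
    · rw [towerVec, Jm_pow_eq_zero hl (Kp_pow_mem_hw hw i) (not_le.1 hk)]
      exact Submodule.zero_mem _
  exact Submodule.disjoint_def.1 hd u (Module.End.mem_eigenspace_iff.2 hs) (htop trivial)

theorem Generic.isTower_repV (h : Generic l rho) :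
    (repV l rho).IsTower l.natAbs (Complex.I * (l / 2) * rho) (((l : ℂ) / 2) ^ 2 + rho ^ 2 - 1)
      (ket (basisSet l rho) |l| |l|) := by
  have hc : ((l.natAbs : ℕ) : ℂ) = ((|l| : ℤ) : ℂ) := by
    rw [← Int.natCast_natAbs]; rfl
  have hw : ket (basisSet l rho) |l| |l| ∈ (repV l rho).hw ((l.natAbs : ℂ) / 2) := by
    rw [hc]
    exact mem_hw.2 (ket_top_mem_hw _ _)
  refine ⟨locNilpotent_repV l rho, hw, fun i => ?_, h.tower_eq_top, fun u hu =>
    eq_zero_of_mem_hw_pred (locNilpotent_repV l rho) hw h.tower_eq_top hu, 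
    cas_eq_of_tower h.tower_eq_top (cas₁_Jm _) (cas₁_Kp _) h.cas₁_ket,
    cas_eq_of_tower h.tower_eq_top (cas₂_Jm _) (cas₂_Kp _) h.cas₂_ket, fun h0 => ?_⟩
  · obtain ⟨c, hc, e⟩ := h.Kp_pow_ket i
    intro e0
    exact smul_ne_zero hc (ket_ne_zero (h.top_mem i)) (e.symm.trans e0)
  · rw [Int.natAbs_eq_zero.1 h0]; simp

theorem LadderRep.ext_of_apply {W : Type*} [AddCommGroup W] [Module ℂ W] {r r' : LadderRep W}
    (h1 : r.J₀ = r'.J₀) (h2 : r.Jp = r'.Jp) (h3 : r.Jm = r'.Jm) (h4 : r.K₀ = r'.K₀)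
    (h5 : r.Kp = r'.Kp) (h6 : r.Km = r'.Km) : r = r' := by
  cases r; cases r'; simp_all

theorem LadderRep.toFun_J₀ {W : Type*} [AddCommGroup W] [Module ℂ W] (r : LadderRep W) :
    r.toFun (J 0) = r.J₀ := by simp [LadderRep.toFun, J_fst, J_snd]

theorem LadderRep.toFun_K₀ {W : Type*} [AddCommGroup W] [Module ℂ W] (r : LadderRep W) :
    r.toFun (K 0) = r.K₀ := by simp [LadderRep.toFun, K_fst, K_snd]

theorem LadderRep.toFun_Jplus {W : Type*} [AddCommGroup W] [Module ℂ W] (r : LadderRep W) :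
    r.toFun Jplus = r.Jp := by
  simp [LadderRep.toFun, Jplus, add_fst, add_snd, smul_fst, smul_snd, J_fst, J_snd]
  

theorem LadderRep.toFun_Jminus {W : Type*} [AddCommGroup W] [Module ℂ W] (r : LadderRep W) :
    r.toFun Jminus = r.Jm := by
  simp [LadderRep.toFun, Jminus, sub_fst, sub_snd, smul_fst, smul_snd, J_fst, J_snd]

theorem LadderRep.toFun_Kplus {W : Type*} [AddCommGroup W] [Module ℂ W] (r : LadderRep W) :
    r.toFun Kplus = r.Kp := by
  simp [LadderRep.toFun, Kplus, add_fst, add_snd, smul_fst, smul_snd, K_fst, K_snd]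

theorem LadderRep.toFun_Kminus {W : Type*} [AddCommGroup W] [Module ℂ W] (r : LadderRep W) :
    r.toFun Kminus = r.Km := by
  simp [LadderRep.toFun, Kminus, sub_fst, sub_snd, smul_fst, smul_snd, K_fst, K_snd]

theorem ofModule_V (l : ℤ) (rho : ℂ) :
    ofModule (V l rho) = (show LadderRep (V l rho) from repV l rho) :=
  ext_of_apply (toFun_J₀ (repV l rho)) (toFun_Jplus (repV l rho)) (toFun_Jminus (repV l rho))
    (toFun_K₀ (repV l rho)) (toFun_Kplus (repV l rho)) (toFun_Kminus (repV l rho))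

theorem ofModule_F (A : ℤˣ) (n : ℕ) : ofModule (F A n) = repF A n :=
  ext_of_apply (toFun_J₀ (repF A n)) (toFun_Jplus (repF A n)) (toFun_Jminus (repF A n))
    (toFun_K₀ (repF A n)) (toFun_Kplus (repF A n)) (toFun_Kminus (repF A n))

theorem Generic.isTower (h : Generic l rho) :
    (ofModule (V l rho)).IsTower l.natAbs (Complex.I * (l / 2) * rho)
      (((l : ℂ) / 2) ^ 2 + rho ^ 2 - 1) (ket (basisSet l rho) |l| |l| : Kets (basisSet l rho)) := by
  rw [ofModule_V]
  exact h.isTower_repV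

end VTower

end Lorentz

/-! ### The two sl(2)-factors, and tensoring with a spin 1/2 doublet. -/

namespace Lorentz

namespace LadderRep

section Chiral

variable {W : Type*} [AddCommGroup W] [Module ℂ W] (r : LadderRep W) (c : ℂ)

/-- The operator `J₀ - c K₀`. -/
noncomputable def B₀ : Module.End ℂ W := r.J₀ - c • r.K₀
/-- The operator `J₊ - c K₊`. -/
noncomputable def Bp : Module.End ℂ W := r.Jp - c • r.Kp
/-- The operator `J₋ - c K₋`. -/
noncomputable def Bm : Module.End ℂ W := r.Jm - c • r.Km

/-- The operator `C₂ - 2c C₁`. For `c² = -1` it is four times the Casimir operator of one of the two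
`sl(2)`-factors. -/
noncomputable def chiral : Module.End ℂ W := r.cas₂ - (2 * c) • r.cas₁

variable {c} (w : W)

theorem B₀_apply : r.B₀ c w = r.J₀ w - c • r.K₀ w := rfl
theorem Bp_apply : r.Bp c w = r.Jp w - c • r.Kp w := rfl
theorem Bm_apply : r.Bm c w = r.Jm w - c • r.Km w := rfl
theorem chiral_apply : r.chiral c w = r.cas₂ w - (2 * c) • r.cas₁ w := rfl

/-- The Casimir of the triple B₀, B₊, B₋ in normal order. The condition on c makes this triple close
under brackets, with structure constants twice the usual ones. -/
theorem chiral_eq (hc : c * c = -1) :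
    r.chiral c w = r.B₀ c (r.B₀ c w) + (2 : ℂ) • r.B₀ c w + r.Bm c (r.Bp c w) := by
  simp only [chiral_apply, cas₁_apply, cas₂_apply, B₀_apply, Bp_apply, Bm_apply, map_sub, map_smul,
    smul_sub, smul_smul, hc, J₀_K₀_apply]
  module

theorem B₀_Bp (hc : c * c = -1) : r.B₀ c (r.Bp c w) = r.Bp c (r.B₀ c w) + (2 : ℂ) • r.Bp c w := by
  have h := r.K₀_eq
  simp only [B₀_apply, Bp_apply, map_sub, map_smul, smul_sub, smul_smul, hc, J₀_Jp_apply,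
    J₀_Kp_apply, K₀_Kp_apply, Jp_K₀_apply]
  module

theorem Bp_Bm (hc : c * c = -1) : r.Bp c (r.Bm c w) = r.Bm c (r.Bp c w) + (4 : ℂ) • r.B₀ c w := by
  simp only [B₀_apply, Bp_apply, Bm_apply, map_sub, map_smul, Jp_Jm_apply, Jp_Km_apply, Kp_Jm_apply,
    Kp_Km_apply]
  match_scalars
  all_goals first | ring1 | linear_combination (-2) * hc

theorem B₀_Bm (hc : c * c = -1) : r.B₀ c (r.Bm c w) = r.Bm c (r.B₀ c w) - (2 : ℂ) • r.Bm c w := by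
  simp only [B₀_apply, Bm_apply, map_sub, map_smul, smul_sub, smul_smul, hc, J₀_Jm_apply,
    J₀_Km_apply, K₀_Km_apply, K₀_Jm_apply]
  module

theorem intertwines_chiral : Intertwines r r (r.chiral c) := by
  constructor <;> intro w <;>
  simp only [chiral_apply, map_sub, map_smul, r.intertwines_cas₁.J₀, r.intertwines_cas₂.J₀,
    r.intertwines_cas₁.Jp, r.intertwines_cas₂.Jp, r.intertwines_cas₁.Jm, r.intertwines_cas₂.Jm,
    r.intertwines_cas₁.K₀, r.intertwines_cas₂.K₀,
    r.intertwines_cas₁.Kp, r.intertwines_cas₂.Kp, r.intertwines_cas₁.Km, r.intertwines_cas₂.Km]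

theorem chiral_B₀ : r.chiral c (r.B₀ c w) = r.B₀ c (r.chiral c w) := by
  rw [B₀_apply, B₀_apply, map_sub, map_smul, r.intertwines_chiral.J₀, r.intertwines_chiral.K₀]

theorem chiral_Bp : r.chiral c (r.Bp c w) = r.Bp c (r.chiral c w) := by
  rw [Bp_apply, Bp_apply, map_sub, map_smul, r.intertwines_chiral.Jp, r.intertwines_chiral.Kp]

theorem chiral_Bm : r.chiral c (r.Bm c w) = r.Bm c (r.chiral c w) := by
  rw [Bm_apply, Bm_apply, map_sub, map_smul, r.intertwines_chiral.Jm, r.intertwines_chiral.Km]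

/-- Maps `M₊, M₋ : W → W'` that form a doublet for the `sl(2)`-factor with parameter `c`, like the
multiplication by the two basis vectors of the spin `1/2` representation. -/
structure IsDoublet {W' : Type*} [AddCommGroup W'] [Module ℂ W'] (r : LadderRep W)
    (r' : LadderRep W') (c : ℂ) (Mp Mm : W →ₗ[ℂ] W') : Prop where
  B₀_Mp : ∀ w, r'.B₀ c (Mp w) = Mp (r.B₀ c w) + Mp w
  B₀_Mm : ∀ w, r'.B₀ c (Mm w) = Mm (r.B₀ c w) - Mm w
  Bp_Mp : ∀ w, r'.Bp c (Mp w) = Mp (r.Bp c w)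
  Bp_Mm : ∀ w, r'.Bp c (Mm w) = Mm (r.Bp c w) + (2 : ℂ) • Mp w
  Bm_Mp : ∀ w, r'.Bm c (Mp w) = Mp (r.Bm c w) + (2 : ℂ) • Mm w
  Bm_Mm : ∀ w, r'.Bm c (Mm w) = Mm (r.Bm c w)

variable {W' : Type*} [AddCommGroup W'] [Module ℂ W'] {r}
    {r' : LadderRep W'} {Mp Mm : W →ₗ[ℂ] W'}

theorem IsDoublet.chiral_Mp (h : IsDoublet r r' c Mp Mm) (hc : c * c = -1) (w : W) :
    r'.chiral c (Mp w) = Mp (r.chiral c w) + (3 : ℂ) • Mp w + (2 : ℂ) • Mp (r.B₀ c w)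
      + (2 : ℂ) • Mm (r.Bp c w) := by
  simp only [chiral_eq _ _ hc, h.B₀_Mp, h.Bp_Mp, h.Bm_Mp, map_add, map_smul]
  module

theorem IsDoublet.chiral_Mm (h : IsDoublet r r' c Mp Mm) (hc : c * c = -1) (w : W) :
    r'.chiral c (Mm w) = Mm (r.chiral c w) + (3 : ℂ) • Mm w - (2 : ℂ) • Mm (r.B₀ c w)
      + (2 : ℂ) • Mp (r.Bm c w) := by
  simp only [chiral_eq _ _ hc, h.B₀_Mm, h.Bp_Mm, h.Bm_Mm, h.Bm_Mp, map_add, map_sub, map_smul]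
  module

/-- Lagrange interpolation for the polynomial (X - a)(X - b), which kills x. -/
theorem mem_sup_eigenspace {T : Module.End ℂ W} {a b : ℂ} (hab : a ≠ b) {x : W}
    (h : T (T x) = (a + b) • T x - (a * b) • x) : x ∈ T.eigenspace a ⊔ T.eigenspace b := by
  have hx : x = (a - b)⁻¹ • (T x - b • x) + (-(a - b)⁻¹) • (T x - a • x) := by
    have : a - b ≠ 0 := sub_ne_zero.2 hab
    match_scalars <;> field_simp <;> ring
  rw [hx]
  refine Submodule.add_mem_sup (Submodule.smul_mem _ _ ?_) (Submodule.smul_mem _ _ ?_) <;>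
  rw [Module.End.mem_eigenspace_iff, map_sub, map_smul, h] <;> module

/-- Clebsch-Gordan for spin 1/2: on M₊w and M₋w the operator `chiral` satisfies the quadratic
equation with the roots (t ± 1)² - 1. Their difference is 4t, so t ≠ 0 is what is needed to split.
-/
theorem IsDoublet.mem_sup (h : IsDoublet r r' c Mp Mm) (hc : c * c = -1) {t : ℂ} (ht : t ≠ 0) {w : W}
    (hw : r.chiral c w = (t ^ 2 - 1) • w) :
    Mp w ∈ (r'.chiral c).eigenspace ((t + 1) ^ 2 - 1) ⊔ (r'.chiral c).eigenspace ((t - 1) ^ 2 - 1) ∧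
    Mm w ∈ (r'.chiral c).eigenspace ((t + 1) ^ 2 - 1) ⊔
      (r'.chiral c).eigenspace ((t - 1) ^ 2 - 1) := by
  have hne : (t + 1) ^ 2 - 1 ≠ (t - 1) ^ 2 - 1 := fun e => ht (by linear_combination e / 4)
  have hB : r.B₀ c (r.B₀ c w) = (t ^ 2 - 1) • w - (2 : ℂ) • r.B₀ c w - r.Bm c (r.Bp c w) := by
    rw [← hw, chiral_eq _ _ hc]; module
  constructor
  · refine mem_sup_eigenspace hne ?_
    simp only [h.chiral_Mp hc, h.chiral_Mm hc, map_add, map_sub, map_smul, hw, chiral_B₀, chiral_Bp,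
      hB, B₀_Bp _ _ hc]
    module
  · refine mem_sup_eigenspace hne ?_
    simp only [h.chiral_Mp hc, h.chiral_Mm hc, map_add, map_sub, map_smul, hw, chiral_B₀,
      chiral_Bm, hB, B₀_Bm _ _ hc, Bp_Bm _ _ hc]
    module

end Chiral

end LadderRep

open LadderRep

/-! ### A basis of F^A_γ adapted to J₋. -/

section FBasis

variable {A : ℤˣ} {n : ℕ}

theorem top_mem_spinSet (n : ℕ) : ((n : ℤ), (n : ℤ)) ∈ spinSet n :=
  ⟨rfl, by simp, le_rfl, by simp⟩

/-- The vectors `J₋ᵏ |γ, γ⟩` of `F^A_γ`, `γ = n/2`. -/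
noncomputable def fvec (A : ℤˣ) (n k : ℕ) : F A n :=
  ((ofModule (F A n)).Jm ^ k) (ket (spinSet n) n n : Kets (spinSet n))

theorem locNilpotent_F (A : ℤˣ) (n : ℕ) : (ofModule (F A n)).LocNilpotent := by
  rw [ofModule_F]
  exact ⟨opJp_nilpotent (weightClosed_spinSet n), opJm_nilpotent (weightClosed_spinSet n)⟩

theorem fvec_zero_mem_hw (A : ℤˣ) (n : ℕ) : fvec A n 0 ∈ (ofModule (F A n)).hw ((n : ℂ) / 2) := by
  rw [ofModule_F]
  exact mem_hw.2 (ket_top_mem_hw (spinSet n) n)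

theorem fvec_eq_pow (k : ℕ) : fvec A n k = ((ofModule (F A n)).Jm ^ k) (fvec A n 0) := rfl

theorem J₀_fvec (k : ℕ) : (ofModule (F A n)).J₀ (fvec A n k) = ((n : ℂ) / 2 - k) • fvec A n k :=
  J₀_Jm_pow (mem_hw.1 (fvec_zero_mem_hw A n)).1 k

theorem Jm_fvec (k : ℕ) : (ofModule (F A n)).Jm (fvec A n k) = fvec A n (k + 1) := by
  rw [fvec, fvec, pow_succ']
  rfl

theorem Jp_fvec_zero : (ofModule (F A n)).Jp (fvec A n 0) = 0 := (mem_hw.1 (fvec_zero_mem_hw A n)).2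

theorem Jp_fvec_succ (k : ℕ) : (ofModule (F A n)).Jp (fvec A n (k + 1)) =
    (((k : ℂ) + 1) * (n - k)) • fvec A n k := by
  rw [fvec_eq_pow, Jp_Jm_pow_of_hw (fvec_zero_mem_hw A n), ← fvec_eq_pow]
  congr 2
  ring

theorem fvec_eq_zero {k : ℕ} (h : n < k) : fvec A n k = 0 :=
  Jm_pow_eq_zero (locNilpotent_F A n) (fvec_zero_mem_hw A n) h

theorem fvec_ne_zero {k : ℕ} (h : k ≤ n) : fvec A n k ≠ 0 :=
  Jm_pow_ne_zero (fvec_zero_mem_hw A n) (ket_ne_zero (top_mem_spinSet n)) k fun i hi e => by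
    have : (n : ℂ) = i := by linear_combination e
    have : n = i := by exact_mod_cast this
    omega

theorem fvec_linearIndependent (A : ℤˣ) (n : ℕ) :
    LinearIndependent ℂ fun k : Fin (n + 1) => fvec A n k := by
  refine Module.End.eigenvectors_linearIndependent' (ofModule (F A n)).J₀
    (fun k : Fin (n + 1) => (n : ℂ) / 2 - k) ?_ _ fun k =>
      ⟨Module.End.mem_eigenspace_iff.2 (J₀_fvec k), fvec_ne_zero (by omega)⟩
  intro a b e
  dsimp only at e
  have : ((a : ℕ) : ℂ) = (b : ℕ) := by linear_combination -e
  exact Fin.ext (by exact_mod_cast this)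

theorem span_fvec (A : ℤˣ) (n : ℕ) :
    ⊤ ≤ Submodule.span ℂ (Set.range fun k : Fin (n + 1) => fvec A n k) := by
  have h : (⊤ : Submodule ℂ (F A n)) = Submodule.span ℂ {x : F A n | ∃ n' q,
      (n', q) ∈ spinSet n ∧ x = (ket (spinSet n) n' q : Kets (spinSet n))} := span_ket.symm
  rw [h, Submodule.span_le]
  rintro _ ⟨n', q, hnq, rfl⟩
  obtain ⟨h0, h1, h2, k, hk⟩ := hnq
  dsimp only at h0 h1 h2 hk
  subst h0
  lift k to ℕ using by omega
  obtain ⟨c, hc, e⟩ := opJm_pow_ket_top (weightClosed_spinSet n) (top_mem_spinSet n) (k := k)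
    (by omega)
  have hq : q = n - 2 * k := by omega
  subst hq
  have hf : fvec A n k = c • (show F A n from ket (spinSet n) n (n - 2 * k)) := by
    refine Eq.trans ?_ e
    simp only [fvec, ofModule_F]
    rfl
  have hm : fvec A n k ∈ Submodule.span ℂ (Set.range fun k : Fin (n + 1) => fvec A n k) :=
    Submodule.subset_span ⟨⟨k, by omega⟩, rfl⟩
  rw [hf] at hm
  exact (Submodule.smul_mem_iff _ hc).1 hm

/-- The basis `J₋ᵏ |γ, γ⟩`, `0 ≤ k ≤ 2γ`, of `F^A_γ`. -/
noncomputable def fBasis (A : ℤˣ) (n : ℕ) : Module.Basis (Fin (n + 1)) ℂ (F A n) :=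
  Module.Basis.mk (fvec_linearIndependent A n) (span_fvec A n)

theorem fBasis_apply (k : Fin (n + 1)) : fBasis A n k = fvec A n k := by simp [fBasis]

theorem K_F (w : F A n) : (ofModule (F A n)).K₀ w = (Complex.I * (A : ℤ)) • (ofModule (F A n)).J₀ w ∧
    (ofModule (F A n)).Kp w = (Complex.I * (A : ℤ)) • (ofModule (F A n)).Jp w ∧
    (ofModule (F A n)).Km w = (Complex.I * (A : ℤ)) • (ofModule (F A n)).Jm w := by
  rw [ofModule_F]
  exact ⟨rfl, rfl, rfl⟩

end FBasis

end Lorentz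

/-! ### F ⊗ X for an arbitrary module X: diagonalising `chiral (iA)`. -/

namespace Lorentz

open LadderRep

section Tensor

variable {A : ℤˣ} {n : ℕ}

/-- The number `iA`, by which `J` is multiplied to give the action of `K` on `F^A_γ`. -/
noncomputable def iA (A : ℤˣ) : ℂ := Complex.I * (A : ℤ)

theorem iA_mul_iA (A : ℤˣ) : iA A * iA A = -1 := by
  rcases Int.units_eq_one_or A with rfl | rfl <;> simp [iA]

theorem neg_iA_mul_neg_iA (A : ℤˣ) : -iA A * -iA A = -1 := by rw [neg_mul_neg, iA_mul_iA]

variable {X : Type*} [AddCommGroup X] [Module ℂ X] [LieRingModule Spin31 X] [LieModule ℂ Spin31 X]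

section General

variable {Y : Type*} [AddCommGroup Y] [Module ℂ Y] [LieRingModule Spin31 Y] [LieModule ℂ Spin31 Y]
  (x : X) (y : Y)

theorem J₀_tmul : (ofModule (X ⊗[ℂ] Y)).J₀ (x ⊗ₜ y) =
    (ofModule X).J₀ x ⊗ₜ y + x ⊗ₜ (ofModule Y).J₀ y := TensorProduct.LieModule.lie_tmul_right _ _ _
theorem Jp_tmul : (ofModule (X ⊗[ℂ] Y)).Jp (x ⊗ₜ y) =
    (ofModule X).Jp x ⊗ₜ y + x ⊗ₜ (ofModule Y).Jp y := TensorProduct.LieModule.lie_tmul_right _ _ _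
theorem Jm_tmul : (ofModule (X ⊗[ℂ] Y)).Jm (x ⊗ₜ y) =
    (ofModule X).Jm x ⊗ₜ y + x ⊗ₜ (ofModule Y).Jm y := TensorProduct.LieModule.lie_tmul_right _ _ _
theorem K₀_tmul : (ofModule (X ⊗[ℂ] Y)).K₀ (x ⊗ₜ y) =
    (ofModule X).K₀ x ⊗ₜ y + x ⊗ₜ (ofModule Y).K₀ y := TensorProduct.LieModule.lie_tmul_right _ _ _
theorem Kp_tmul : (ofModule (X ⊗[ℂ] Y)).Kp (x ⊗ₜ y) =
    (ofModule X).Kp x ⊗ₜ y + x ⊗ₜ (ofModule Y).Kp y := TensorProduct.LieModule.lie_tmul_right _ _ _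
theorem Km_tmul : (ofModule (X ⊗[ℂ] Y)).Km (x ⊗ₜ y) =
    (ofModule X).Km x ⊗ₜ y + x ⊗ₜ (ofModule Y).Km y := TensorProduct.LieModule.lie_tmul_right _ _ _

/-- By the Leibniz rule each application of U lowers one of the two nilpotency orders by one. -/
theorem pow_tmul_eq_zero {S : Module.End ℂ X} {T : Module.End ℂ Y} {U : Module.End ℂ (X ⊗[ℂ] Y)}
    (hU : ∀ x y, U (x ⊗ₜ y) = S x ⊗ₜ y + x ⊗ₜ T y) (N : ℕ) :
    ∀ (a b : ℕ) (x : X) (y : Y), a + b ≤ N → (S ^ a) x = 0 → (T ^ b) y = 0 →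
      (U ^ N) (x ⊗ₜ y) = 0 := by
  induction N with
  | zero =>
    intro a b x y h hx _
    obtain rfl : a = 0 := by omega
    have : x = 0 := by simpa using hx
    simp [this]
  | succ N ih =>
    intro a b x y h hx hy
    rcases a with _ | a
    · have : x = 0 := by simpa using hx
      simp [this]
    rcases b with _ | b
    · have : y = 0 := by simpa using hy
      simp [this]
    rw [pow_succ, Module.End.mul_apply, hU, map_add,
      ih a (b + 1) (S x) y (by omega) (by rw [← Module.End.mul_apply, ← pow_succ, hx]) hy,
      ih (a + 1) b x (T y) (by omega) hx (by rw [← Module.End.mul_apply, ← pow_succ, hy]), add_zero]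

theorem LadderRep.LocNilpotent.tensor (hX : (ofModule X).LocNilpotent)
    (hY : (ofModule Y).LocNilpotent) : (ofModule (X ⊗[ℂ] Y)).LocNilpotent := by
  constructor <;> intro w <;>
    refine exists_pow_eq_zero_of_span (TensorProduct.span_tmul_eq_top ℂ X Y) ?_ w <;>
    rintro _ ⟨x, y, rfl⟩
  · obtain ⟨a, ha⟩ := hX.Jp x
    obtain ⟨b, hb⟩ := hY.Jp y
    exact ⟨a + b, pow_tmul_eq_zero Jp_tmul _ a b x y le_rfl ha hb⟩
  · obtain ⟨a, ha⟩ := hX.Jm x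
    obtain ⟨b, hb⟩ := hY.Jm y
    exact ⟨a + b, pow_tmul_eq_zero Jm_tmul _ a b x y le_rfl ha hb⟩

end General

theorem B_tmul (f : F A n) (x : X) :
    (ofModule (F A n ⊗[ℂ] X)).B₀ (iA A) (f ⊗ₜ x) =
      (2 : ℂ) • ((ofModule (F A n)).J₀ f ⊗ₜ x) + f ⊗ₜ (ofModule X).B₀ (iA A) x ∧
    (ofModule (F A n ⊗[ℂ] X)).Bp (iA A) (f ⊗ₜ x) =
      (2 : ℂ) • ((ofModule (F A n)).Jp f ⊗ₜ x) + f ⊗ₜ (ofModule X).Bp (iA A) x ∧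
    (ofModule (F A n ⊗[ℂ] X)).Bm (iA A) (f ⊗ₜ x) =
      (2 : ℂ) • ((ofModule (F A n)).Jm f ⊗ₜ x) + f ⊗ₜ (ofModule X).Bm (iA A) x := by
  obtain ⟨h1, h2, h3⟩ := K_F f
  have hc := iA_mul_iA A
  refine ⟨?_, ?_, ?_⟩
  · rw [B₀_apply, B₀_apply, J₀_tmul, K₀_tmul, h1, ← iA, TensorProduct.tmul_sub,
      TensorProduct.tmul_smul, ← TensorProduct.smul_tmul', smul_add, smul_smul, hc]
    module
  · rw [Bp_apply, Bp_apply, Jp_tmul, Kp_tmul, h2, ← iA, TensorProduct.tmul_sub,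
      TensorProduct.tmul_smul, ← TensorProduct.smul_tmul', smul_add, smul_smul, hc]
    module
  · rw [Bm_apply, Bm_apply, Jm_tmul, Km_tmul, h3, ← iA, TensorProduct.tmul_sub,
      TensorProduct.tmul_smul, ← TensorProduct.smul_tmul', smul_add, smul_smul, hc]
    module

/-- On F^A_γ the operator J + iAK is J - J = 0, so the second sl(2)-factor sees only X. In `B_tmul`,
by contrast, J - iAK = 2J. -/
theorem B_neg_tmul (f : F A n) (x : X) :
    (ofModule (F A n ⊗[ℂ] X)).B₀ (-iA A) (f ⊗ₜ x) = f ⊗ₜ (ofModule X).B₀ (-iA A) x ∧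
    (ofModule (F A n ⊗[ℂ] X)).Bp (-iA A) (f ⊗ₜ x) = f ⊗ₜ (ofModule X).Bp (-iA A) x ∧
    (ofModule (F A n ⊗[ℂ] X)).Bm (-iA A) (f ⊗ₜ x) = f ⊗ₜ (ofModule X).Bm (-iA A) x := by
  obtain ⟨h1, h2, h3⟩ := K_F f
  have hc := iA_mul_iA A
  refine ⟨?_, ?_, ?_⟩
  · rw [B₀_apply, B₀_apply, J₀_tmul, K₀_tmul, h1, ← iA, TensorProduct.tmul_sub,
      TensorProduct.tmul_smul, ← TensorProduct.smul_tmul', smul_add, smul_smul, neg_mul, hc]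
    module
  · rw [Bp_apply, Bp_apply, Jp_tmul, Kp_tmul, h2, ← iA, TensorProduct.tmul_sub,
      TensorProduct.tmul_smul, ← TensorProduct.smul_tmul', smul_add, smul_smul, neg_mul, hc]
    module
  · rw [Bm_apply, Bm_apply, Jm_tmul, Km_tmul, h3, ← iA, TensorProduct.tmul_sub,
      TensorProduct.tmul_smul, ← TensorProduct.smul_tmul', smul_add, smul_smul, neg_mul, hc]
    module

theorem chiral_neg_tmul (f : F A n) (x : X) :
    (ofModule (F A n ⊗[ℂ] X)).chiral (-iA A) (f ⊗ₜ x) = f ⊗ₜ (ofModule X).chiral (-iA A) x := by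
  rw [chiral_eq _ _ (neg_iA_mul_neg_iA A), chiral_eq _ _ (neg_iA_mul_neg_iA A)]
  simp only [(B_neg_tmul f _).1, (B_neg_tmul f _).2.1, (B_neg_tmul f _).2.2,
    TensorProduct.tmul_add, TensorProduct.tmul_smul]

theorem chiral_neg_tensor {e : ℂ} (he : ∀ x, (ofModule X).chiral (-iA A) x = e • x)
    (w : F A n ⊗[ℂ] X) : (ofModule (F A n ⊗[ℂ] X)).chiral (-iA A) w = e • w := by
  induction w using TensorProduct.induction_on with
  | zero => simp
  | tmul f x => rw [chiral_neg_tmul, he, TensorProduct.tmul_smul]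
  | add v w hv hw => rw [map_add, hv, hw, smul_add]

section Doublet

/-- In terms of homogeneous polynomials of degree `n`, the multiplication by the first variable. -/
noncomputable def mulFst (A : ℤˣ) (n : ℕ) : F A n →ₗ[ℂ] F A (n + 1) :=
  (fBasis A n).constr ℂ fun k => ((n : ℂ) + 1 - k) • fvec A (n + 1) k

/-- In terms of homogeneous polynomials of degree `n`, the multiplication by the second variable. -/
noncomputable def mulSnd (A : ℤˣ) (n : ℕ) : F A n →ₗ[ℂ] F A (n + 1) :=
  (fBasis A n).constr ℂ fun k => fvec A (n + 1) (k + 1)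

/-- With J₋ = z₂∂₁ the vector `fvec A n k` is n!/(n-k)! z₁^(n-k) z₂^k. Multiplication by z₁ and z₂,
both rescaled by n + 1, gives the coefficients n + 1 - k and 1. The formula persists for k > n: the
coefficient is 0 at k = n + 1, and beyond that the vectors are 0. -/
theorem mulFst_fvec (k : ℕ) : mulFst A n (fvec A n k) = ((n : ℂ) + 1 - k) • fvec A (n + 1) k := by
  rcases lt_or_ge n k with h | h
  · rw [fvec_eq_zero h, map_zero]
    rcases eq_or_ne k (n + 1) with rfl | h'
    · push_cast; rw [sub_self, zero_smul]
    · rw [fvec_eq_zero (by omega), smul_zero]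
  · have := (fBasis A n).constr_basis ℂ (fun k => ((n : ℂ) + 1 - k) • fvec A (n + 1) k)
      ⟨k, by omega⟩
    rwa [fBasis_apply] at this

theorem mulSnd_fvec (k : ℕ) : mulSnd A n (fvec A n k) = fvec A (n + 1) (k + 1) := by
  rcases lt_or_ge n k with h | h
  · rw [fvec_eq_zero h, map_zero, fvec_eq_zero (by omega)]
  · have := (fBasis A n).constr_basis ℂ (fun k => fvec A (n + 1) (k + 1)) ⟨k, by omega⟩
    rwa [fBasis_apply] at this

theorem eq_of_fvec {Z : Type*} [AddCommGroup Z] [Module ℂ Z] {S T : F A n →ₗ[ℂ] Z}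
    (h : ∀ k, S (fvec A n k) = T (fvec A n k)) : S = T :=
  (fBasis A n).ext fun k => by rw [fBasis_apply]; exact h k

theorem J₀_mulFst (f : F A n) : (ofModule (F A (n + 1))).J₀ (mulFst A n f) =
    mulFst A n ((ofModule (F A n)).J₀ f) + (1 / 2 : ℂ) • mulFst A n f := by
  refine LinearMap.congr_fun (f := (ofModule (F A (n + 1))).J₀ ∘ₗ mulFst A n)
    (g := mulFst A n ∘ₗ (ofModule (F A n)).J₀ + (1 / 2 : ℂ) • mulFst A n) (eq_of_fvec fun k => ?_) f
  simp only [LinearMap.comp_apply, LinearMap.add_apply, LinearMap.smul_apply, mulFst_fvec, map_smul,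
    J₀_fvec]
  push_cast
  module

theorem J₀_mulSnd (f : F A n) : (ofModule (F A (n + 1))).J₀ (mulSnd A n f) =
    mulSnd A n ((ofModule (F A n)).J₀ f) - (1 / 2 : ℂ) • mulSnd A n f := by
  refine LinearMap.congr_fun (f := (ofModule (F A (n + 1))).J₀ ∘ₗ mulSnd A n)
    (g := mulSnd A n ∘ₗ (ofModule (F A n)).J₀ - (1 / 2 : ℂ) • mulSnd A n) (eq_of_fvec fun k => ?_) f
  simp only [LinearMap.comp_apply, LinearMap.sub_apply, LinearMap.smul_apply, mulSnd_fvec, map_smul,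
    J₀_fvec]
  push_cast
  module

theorem Jp_mulFst (f : F A n) : (ofModule (F A (n + 1))).Jp (mulFst A n f) =
    mulFst A n ((ofModule (F A n)).Jp f) := by
  refine LinearMap.congr_fun (f := (ofModule (F A (n + 1))).Jp ∘ₗ mulFst A n)
    (g := mulFst A n ∘ₗ (ofModule (F A n)).Jp) (eq_of_fvec fun k => ?_) f
  rcases k with _ | k
  · simp only [LinearMap.comp_apply, mulFst_fvec, map_smul, Jp_fvec_zero, map_zero, smul_zero]
  · simp only [LinearMap.comp_apply, mulFst_fvec, map_smul, Jp_fvec_succ]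
    push_cast
    module

theorem Jp_mulSnd (f : F A n) : (ofModule (F A (n + 1))).Jp (mulSnd A n f) =
    mulSnd A n ((ofModule (F A n)).Jp f) + mulFst A n f := by
  refine LinearMap.congr_fun (f := (ofModule (F A (n + 1))).Jp ∘ₗ mulSnd A n)
    (g := mulSnd A n ∘ₗ (ofModule (F A n)).Jp + mulFst A n) (eq_of_fvec fun k => ?_) f
  rcases k with _ | k
  · simp only [LinearMap.comp_apply, LinearMap.add_apply, mulSnd_fvec, mulFst_fvec, Jp_fvec_zero,
      map_zero, Jp_fvec_succ]
    push_cast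
    module
  · simp only [LinearMap.comp_apply, LinearMap.add_apply, mulSnd_fvec, mulFst_fvec, map_smul,
      Jp_fvec_succ]
    push_cast
    module

theorem Jm_mulFst (f : F A n) : (ofModule (F A (n + 1))).Jm (mulFst A n f) =
    mulFst A n ((ofModule (F A n)).Jm f) + mulSnd A n f := by
  refine LinearMap.congr_fun (f := (ofModule (F A (n + 1))).Jm ∘ₗ mulFst A n)
    (g := mulFst A n ∘ₗ (ofModule (F A n)).Jm + mulSnd A n) (eq_of_fvec fun k => ?_) f
  simp only [LinearMap.comp_apply, LinearMap.add_apply, mulSnd_fvec, mulFst_fvec, map_smul, Jm_fvec]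
  push_cast
  module

theorem Jm_mulSnd (f : F A n) : (ofModule (F A (n + 1))).Jm (mulSnd A n f) =
    mulSnd A n ((ofModule (F A n)).Jm f) := by
  refine LinearMap.congr_fun (f := (ofModule (F A (n + 1))).Jm ∘ₗ mulSnd A n)
    (g := mulSnd A n ∘ₗ (ofModule (F A n)).Jm) (eq_of_fvec fun k => ?_) f
  simp only [LinearMap.comp_apply, mulSnd_fvec, Jm_fvec]

theorem eq_of_tmul {Y Z Z' : Type*} [AddCommGroup Y] [Module ℂ Y] [AddCommGroup Z] [Module ℂ Z]
    [AddCommGroup Z'] [Module ℂ Z'] {S T : Y ⊗[ℂ] Z →ₗ[ℂ] Z'}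
    (h : ∀ y z, S (y ⊗ₜ z) = T (y ⊗ₜ z)) (w : Y ⊗[ℂ] Z) : S w = T w :=
  LinearMap.congr_fun (TensorProduct.ext' h) w

variable (A n X) in
theorem isDoublet_mul : IsDoublet (ofModule (F A n ⊗[ℂ] X)) (ofModule (F A (n + 1) ⊗[ℂ] X)) (iA A)
    ((mulFst A n).rTensor X) ((mulSnd A n).rTensor X) where
  B₀_Mp := by
    refine eq_of_tmul (S := (ofModule _).B₀ (iA A) ∘ₗ (mulFst A n).rTensor X)
      (T := (mulFst A n).rTensor X ∘ₗ (ofModule _).B₀ (iA A) + (mulFst A n).rTensor X) fun f x => ?_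
    simp only [LinearMap.comp_apply, LinearMap.add_apply, LinearMap.rTensor_tmul, (B_tmul _ _).1,
      map_add, map_smul, J₀_mulFst, TensorProduct.add_tmul, ← TensorProduct.smul_tmul']
    module
  B₀_Mm := by
    refine eq_of_tmul (S := (ofModule _).B₀ (iA A) ∘ₗ (mulSnd A n).rTensor X)
      (T := (mulSnd A n).rTensor X ∘ₗ (ofModule _).B₀ (iA A) - (mulSnd A n).rTensor X) fun f x => ?_
    simp only [LinearMap.comp_apply, LinearMap.sub_apply, LinearMap.rTensor_tmul, (B_tmul _ _).1,
      map_add, map_smul, J₀_mulSnd, TensorProduct.sub_tmul, ← TensorProduct.smul_tmul']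
    module
  Bp_Mp := by
    refine eq_of_tmul (S := (ofModule _).Bp (iA A) ∘ₗ (mulFst A n).rTensor X)
      (T := (mulFst A n).rTensor X ∘ₗ (ofModule _).Bp (iA A)) fun f x => ?_
    simp only [LinearMap.comp_apply, LinearMap.rTensor_tmul, (B_tmul _ _).2.1,
      map_add, map_smul, Jp_mulFst]
  Bp_Mm := by
    refine eq_of_tmul (S := (ofModule _).Bp (iA A) ∘ₗ (mulSnd A n).rTensor X)
      (T := (mulSnd A n).rTensor X ∘ₗ (ofModule _).Bp (iA A) + (2 : ℂ) • (mulFst A n).rTensor X)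
      fun f x => ?_
    simp only [LinearMap.comp_apply, LinearMap.add_apply, LinearMap.smul_apply,
      LinearMap.rTensor_tmul, (B_tmul _ _).2.1, map_add, map_smul, Jp_mulSnd,
      TensorProduct.add_tmul]
    module
  Bm_Mp := by
    refine eq_of_tmul (S := (ofModule _).Bm (iA A) ∘ₗ (mulFst A n).rTensor X)
      (T := (mulFst A n).rTensor X ∘ₗ (ofModule _).Bm (iA A) + (2 : ℂ) • (mulSnd A n).rTensor X)
      fun f x => ?_
    simp only [LinearMap.comp_apply, LinearMap.add_apply, LinearMap.smul_apply,
      LinearMap.rTensor_tmul, (B_tmul _ _).2.2, map_add, map_smul, Jm_mulFst,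
      TensorProduct.add_tmul]
    module
  Bm_Mm := by
    refine eq_of_tmul (S := (ofModule _).Bm (iA A) ∘ₗ (mulSnd A n).rTensor X)
      (T := (mulSnd A n).rTensor X ∘ₗ (ofModule _).Bm (iA A)) fun f x => ?_
    simp only [LinearMap.comp_apply, LinearMap.rTensor_tmul, (B_tmul _ _).2.2,
      map_add, map_smul, Jm_mulSnd]

end Doublet

/-- The sum of the eigenspaces of `C₂ - 2iA C₁` with the expected eigenvalues. -/
noncomputable def chiralSum (A : ℤˣ) (n : ℕ) (X : Type*) [AddCommGroup X] [Module ℂ X]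
    [LieRingModule Spin31 X] [LieModule ℂ Spin31 X] (s : ℂ) : Submodule ℂ (F A n ⊗[ℂ] X) :=
  ⨆ v : weights n, ((ofModule (F A n ⊗[ℂ] X)).chiral (iA A)).eigenspace ((s + (v : ℤ)) ^ 2 - 1)

theorem eigenspace_le_chiralSum {s : ℂ} {v : ℤ} (hv : v ∈ weights n) :
    ((ofModule (F A n ⊗[ℂ] X)).chiral (iA A)).eigenspace ((s + v) ^ 2 - 1) ≤ chiralSum A n X s :=
  le_iSup (fun v : weights n => ((ofModule (F A n ⊗[ℂ] X)).chiral (iA A)).eigenspace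
    ((s + (v : ℤ)) ^ 2 - 1)) ⟨v, hv⟩

/-- The doublet moves the label v to v ± 1. Since |v| ≤ n, the hypothesis on s excludes t = s + v =
0. -/
theorem chiralSum_step {s : ℂ} (hs : ∀ k : ℤ, -(n + 1 : ℤ) < k → k < n + 1 → s ≠ k)
    {y : F A n ⊗[ℂ] X} (hy : y ∈ chiralSum A n X s) :
    (mulFst A n).rTensor X y ∈ chiralSum A (n + 1) X s ∧
      (mulSnd A n).rTensor X y ∈ chiralSum A (n + 1) X s := by
  suffices h : chiralSum A n X s ≤ (chiralSum A (n + 1) X s).comap ((mulFst A n).rTensor X) ⊓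
      (chiralSum A (n + 1) X s).comap ((mulSnd A n).rTensor X) from h hy
  refine iSup_le fun v y hy => ?_
  obtain ⟨v, h1, h2, h3⟩ := v
  have ht : s + v ≠ 0 := fun e => hs (-v) (by omega) (by omega) (by
    push_cast; linear_combination e)
  have hle : ((ofModule (F A (n + 1) ⊗[ℂ] X)).chiral (iA A)).eigenspace ((s + v + 1) ^ 2 - 1) ⊔
      ((ofModule (F A (n + 1) ⊗[ℂ] X)).chiral (iA A)).eigenspace ((s + v - 1) ^ 2 - 1) ≤
        chiralSum A (n + 1) X s := by
    refine sup_le ?_ ?_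
    · have := eigenspace_le_chiralSum (A := A) (n := n + 1) (X := X) (s := s) (v := v + 1)
        ⟨by push_cast; omega, by push_cast; omega, by push_cast; omega⟩
      push_cast at this
      rwa [← add_assoc] at this
    · have := eigenspace_le_chiralSum (A := A) (n := n + 1) (X := X) (s := s) (v := v - 1)
        ⟨by push_cast; omega, by push_cast; omega, by push_cast; omega⟩
      push_cast at this
      rwa [← add_sub_assoc] at this
  obtain ⟨e1, e2⟩ := (isDoublet_mul A n X).mem_sup (iA_mul_iA A) ht
    (Module.End.mem_eigenspace_iff.1 hy)
  exact ⟨hle e1, hle e2⟩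

/-- Induction on 2γ: every basis vector of F_{γ+1/2} is, up to a non-zero factor, a product of a
basis vector of F_γ with z₁ or z₂. For γ = 0 all J act by zero. -/
theorem tmul_mem_chiralSum {s : ℂ} {x : X} (hx : (ofModule X).chiral (iA A) x = (s ^ 2 - 1) • x)
    (n : ℕ) (hs : ∀ k : ℤ, -(n : ℤ) < k → k < n → s ≠ k) (k : ℕ) :
    fvec A n k ⊗ₜ x ∈ chiralSum A n X s := by
  induction n generalizing k with
  | zero =>
    rcases k with _ | k
    · have h0 : ∀ w : F A 0, (ofModule (F A 0)).J₀ w = 0 ∧ (ofModule (F A 0)).Jp w = 0 ∧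
          (ofModule (F A 0)).Jm w = 0 := by
        intro w
        have key : ∀ T : Module.End ℂ (F A 0), T (fvec A 0 0) = 0 → T w = 0 := by
          intro T hT
          refine LinearMap.congr_fun (f := T) (g := 0) ((fBasis A 0).ext fun k => ?_) w
          rw [fBasis_apply, show (k : ℕ) = 0 by omega]
          exact hT
        exact ⟨key _ (by simp [J₀_fvec]), key _ Jp_fvec_zero,
          key _ (by rw [Jm_fvec, fvec_eq_zero (by norm_num)])⟩
      have e : (ofModule (F A 0 ⊗[ℂ] X)).chiral (iA A) (fvec A 0 0 ⊗ₜ x) =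
          fvec A 0 0 ⊗ₜ (ofModule X).chiral (iA A) x := by
        rw [chiral_eq _ _ (iA_mul_iA A), chiral_eq _ _ (iA_mul_iA A)]
        simp only [(B_tmul _ _).1, (B_tmul _ _).2.1, (B_tmul _ _).2.2, (h0 _).1, (h0 _).2.1,
          (h0 _).2.2, TensorProduct.zero_tmul, smul_zero, zero_add, TensorProduct.tmul_add,
          TensorProduct.tmul_smul]
      refine eigenspace_le_chiralSum (v := 0) ⟨by simp, by simp, by simp⟩ ?_
      rw [Module.End.mem_eigenspace_iff, e, hx, TensorProduct.tmul_smul]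
      simp
    · rw [fvec_eq_zero (by omega), TensorProduct.zero_tmul]
      exact Submodule.zero_mem _
  | succ n ih =>
    push_cast at hs
    have ih' := ih fun k h1 h2 => hs k (by omega) (by omega)
    rcases k with _ | k
    · have h := (chiralSum_step hs (ih' 0)).1
      rw [LinearMap.rTensor_tmul, mulFst_fvec, ← TensorProduct.smul_tmul'] at h
      refine (Submodule.smul_mem_iff _ ?_).1 h
      simpa using Nat.cast_add_one_ne_zero n
    · have h := (chiralSum_step hs (ih' k)).2
      rwa [LinearMap.rTensor_tmul, mulSnd_fvec] at h

/-- The operator `C₂ - 2iA C₁` is diagonalisable on `F^A_γ ⊗ X`, outside of the resonances. -/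
theorem chiralSum_eq_top {s : ℂ} (hX : ∀ x, (ofModule X).chiral (iA A) x = (s ^ 2 - 1) • x)
    (hs : ∀ k : ℤ, -(n : ℤ) < k → k < n → s ≠ k) : chiralSum A n X s = ⊤ := by
  rw [eq_top_iff, ← TensorProduct.span_tmul_eq_top, Submodule.span_le]
  rintro _ ⟨f, x, rfl⟩
  have : f ∈ (chiralSum A n X s).comap ((TensorProduct.mk ℂ (F A n) X).flip x) := by
    refine (?_ : (⊤ : Submodule ℂ (F A n)) ≤ _) trivial
    refine (span_fvec A n).trans (Submodule.span_le.2 ?_)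
    rintro _ ⟨k, rfl⟩
    exact tmul_mem_chiralSum (hX x) n hs k
  exact this

end Tensor

end Lorentz

/-! ### Ket coefficients, and injectivity of K₊ and J₊ - iAK₊ on V_{λ,ρ}. -/

namespace Lorentz

open LadderRep

section Coefficients

variable {S : Set (ℤ × ℤ)} {n q : ℤ}

/-- The coefficient of `|j, m⟩`, `j = n/2`, `m = q/2`. -/
noncomputable def coef (S : Set (ℤ × ℤ)) (n q : ℤ) : Kets S →ₗ[ℂ] ℂ :=
  open Classical in if h : (n, q) ∈ S then (ketBasis S).coord ⟨(n, q), h⟩ else 0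

theorem coef_of_notMem (h : (n, q) ∉ S) : coef S n q = 0 := by rw [coef, dif_neg h]

theorem mem_of_coef_ne_zero {y : Kets S} (h : coef S n q y ≠ 0) : (n, q) ∈ S := by
  by_contra h'
  exact h (by rw [coef_of_notMem h', LinearMap.zero_apply])

theorem coef_ket {a b : ℤ} (h : (n, q) ∈ S ∨ (a, b) ∈ S) :
    coef S n q (ket S a b) = if n = a ∧ q = b then 1 else 0 := by
  split_ifs with e
  · obtain ⟨rfl, rfl⟩ := e
    rw [or_self] at h
    rw [coef, dif_pos h, ket, dif_pos h, Module.Basis.coord_apply, Module.Basis.repr_self,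
      Finsupp.single_eq_same]
  · by_cases h1 : (n, q) ∈ S
    · by_cases h2 : (a, b) ∈ S
      · rw [coef, dif_pos h1, ket, dif_pos h2, Module.Basis.coord_apply, Module.Basis.repr_self,
          Finsupp.single_eq_of_ne]
        intro e'
        rw [Subtype.mk.injEq, Prod.mk.injEq] at e'
        exact e ⟨e'.1, e'.2⟩
      · rw [ket_of_notMem h2, map_zero]
    · rw [coef_of_notMem h1, LinearMap.zero_apply]

/-- The transposed matrix of `ladder`: the coefficients are evaluated at the source kets, of spin
one below, equal and one above. -/
theorem coef_ladder {s : ℤ} {up mid down : ℂ → ℂ → ℂ} (h : (n, q + 2 * s) ∈ S) (y : Kets S) :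
    coef S n (q + 2 * s) (ladder S s up mid down y) =
      up (((n - 2 : ℤ) : ℂ) / 2) (q / 2) * coef S (n - 2) q y + mid (n / 2) (q / 2) * coef S n q y +
        down (((n + 2 : ℤ) : ℂ) / 2) (q / 2) * coef S (n + 2) q y := by
  refine LinearMap.congr_fun (f := coef S n (q + 2 * s) ∘ₗ ladder S s up mid down)
    (g := up (((n - 2 : ℤ) : ℂ) / 2) (q / 2) • coef S (n - 2) q + mid (n / 2) (q / 2) • coef S n q +
      down (((n + 2 : ℤ) : ℂ) / 2) (q / 2) • coef S (n + 2) q) ((ketBasis S).ext fun x => ?_) y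
  obtain ⟨⟨a, b⟩, hx⟩ := x
  rw [ketBasis_apply]
  simp only [LinearMap.comp_apply, LinearMap.add_apply, LinearMap.smul_apply, smul_eq_mul,
    ladder_ket hx, ladderKet, map_add, map_smul, coef_ket (Or.inl h), coef_ket (Or.inr hx)]
  by_cases hq : q = b
  · subst hq
    by_cases h1 : n = a + 2
    · subst h1
      simp [show ¬ a + 2 = a - 2 by omega, show ¬ a + 2 + 2 = a by omega]
    by_cases h2 : n = a
    · subst h2
      simp [show ¬ n = n - 2 by omega]
    by_cases h3 : n = a - 2
    · subst h3
      simp [show ¬ a - 2 = a + 2 by omega, show ¬ a - 2 - 2 = a by omega]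
    rw [if_neg (by omega), if_neg (by omega), if_neg (by omega), if_neg (by omega),
      if_neg (by omega), if_neg (by omega)]
    simp
  · rw [if_neg (by omega), if_neg (by omega), if_neg (by omega), if_neg (by omega),
      if_neg (by omega), if_neg (by omega)]
    simp

theorem coef_opJ₀ (y : Kets S) : coef S n q (opJ₀ S y) = ((q : ℂ) / 2) * coef S n q y := by
  by_cases h : (n, q) ∈ S
  · have := coef_ladder (q := q) (s := 0) (up := fun _ _ => 0) (mid := fun _ m => m)
      (down := fun _ _ => 0) (n := n) (by simpa using h) y
    simpa using this
  · simp [coef_of_notMem h]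

theorem coef_opJp (h : (n, q + 2) ∈ S) (y : Kets S) :
    coef S n (q + 2) (opJp S y) = Cp (n / 2) (q / 2) * coef S n q y := by
  have := coef_ladder (q := q) (s := 1) (up := fun _ _ => 0) (mid := Cp)
    (down := fun _ _ => 0) (n := n) (by simpa using h) y
  simpa using this

theorem mem_span_ket_of_coef {y : Kets S} {U : Submodule ℂ (Kets S)}
    (h : ∀ n q, coef S n q y ≠ 0 → ket S n q ∈ U) : y ∈ U := by
  refine (Submodule.span_le.2 ?_ : Submodule.span ℂ _ ≤ U) ((ketBasis S).mem_span_repr_support y)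
  rintro _ ⟨x, hx, rfl⟩
  rw [SetLike.mem_coe, ketBasis_apply]
  refine h _ _ ?_
  rw [coef, dif_pos x.2]
  exact Finsupp.mem_support_iff.1 hx

theorem exists_top_coef {y : Kets S} (hy : y ≠ 0) :
    ∃ n q, coef S n q y ≠ 0 ∧ ∀ n' q', n < n' → coef S n' q' y = 0 := by
  have hne : ((ketBasis S).repr y).support.Nonempty := by
    rw [Finsupp.support_nonempty_iff]
    simpa using hy
  obtain ⟨x, hx, hmax⟩ := Finset.exists_max_image _ (fun x : S => x.1.1) hne
  refine ⟨x.1.1, x.1.2, ?_, fun n' q' hlt => ?_⟩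
  · rw [coef, dif_pos x.2]
    exact Finsupp.mem_support_iff.1 hx
  · by_contra hc
    have hm := mem_of_coef_ne_zero hc
    rw [coef, dif_pos hm] at hc
    have := hmax ⟨(n', q'), hm⟩ (Finsupp.mem_support_iff.2 hc)
    dsimp only at this
    omega

/-- J₊ preserves the spin, and on a multiplet it is injective below the top weight. A ket of weight
q/2 therefore survives until it has climbed past n/2. -/
theorem coef_opJp_pow (hS : WeightClosed S) {k : ℕ} {y : Kets S} (hy : (opJp S ^ k) y = 0)
    (hc : coef S n q y ≠ 0) : n < q + 2 * k := by
  induction k generalizing y q with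
  | zero =>
    have : y = 0 := by simpa using hy
    simp [this] at hc
  | succ k ih =>
    have hm := mem_of_coef_ne_zero hc
    obtain ⟨⟨h1, h2, h3⟩, hw⟩ := hS n q hm
    rcases eq_or_lt_of_le h2 with rfl | h2
    · push_cast; omega
    · have := ih (y := opJp S y) (q := q + 2) (by rw [← Module.End.mul_apply, ← pow_succ, hy]) (by
        rw [coef_opJp (hw _ ⟨by omega, by omega, by omega⟩)]
        refine mul_ne_zero (mul_ne_zero (csqrt_ne_zero ?_) (csqrt_ne_zero ?_)) hc
        · intro e
          have : ((n - q : ℤ) : ℂ) = 0 := by push_cast; linear_combination 2 * e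
          have : n - q = 0 := by exact_mod_cast this
          omega
        · intro e
          have : ((n + q + 2 : ℤ) : ℂ) = 0 := by push_cast; linear_combination 2 * e
          have : n + q + 2 = 0 := by exact_mod_cast this
          omega)
      push_cast; omega

end Coefficients

section Injective

variable {l : ℤ} {rho : ℂ}

/-- In `V_{λ,ρ}`, the leading term of `K₊` raises the spin. -/
theorem Generic.add_smul_Kp_ne_zero (h : Generic l rho) {a b : ℂ} (hb : b ≠ 0)
    {y : Kets (basisSet l rho)} (hy : y ≠ 0) :
    a • opJp (basisSet l rho) y + b • opKp l rho y ≠ 0 := by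
  obtain ⟨n, q, hc, htop⟩ := exists_top_coef hy
  obtain ⟨⟨i, rfl⟩, h1, h2, h3⟩ := h.mem_basisSet.1 (mem_of_coef_ne_zero hc)
  -- The coefficient one spin above the largest spin of y is examined. Only the raising term of K₊
  -- reaches it, with a factor P⁺ that is non-zero.
  have hm : (|l| + 2 * i + 2, q + 2) ∈ basisSet l rho :=
    h.mem_basisSet.2 ⟨⟨i + 1, by push_cast; ring⟩, by omega, by omega, by omega⟩
  intro e
  have e1 := congrArg (coef (basisSet l rho) (|l| + 2 * i + 2) (q + 2)) e
  have e2 := coef_ladder (q := q) (s := 1) (n := |l| + 2 * i + 2)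
    (up := fun j m => -Pplus (l / 2) rho j * Complex.sqrt (j + m + 1) * Complex.sqrt (j + m + 2))
    (mid := fun j m => Pzero (l / 2) rho j * Cp j m)
    (down := fun j m => Pminus (l / 2) rho j * Complex.sqrt (j - m) * Complex.sqrt (j - m - 1))
    (by simpa using hm) y
  rw [htop (|l| + 2 * i + 2) q (by omega), htop (|l| + 2 * i + 2 + 2) q (by omega), mul_zero,
    mul_zero, add_zero, add_zero, add_sub_cancel_right] at e2
  rw [map_add, map_smul, map_smul, coef_opJp hm, htop _ _ (by omega), mul_zero, smul_zero, zero_add,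
    map_zero] at e1
  have e3 : coef (basisSet l rho) (|l| + 2 * i + 2) (q + 2) (opKp l rho y) = _ := e2
  rw [e3, smul_eq_mul] at e1
  have hz : ∀ c : ℤ, 0 < c → Complex.sqrt (((|l| + 2 * i : ℤ) : ℂ) / 2 + q / 2 + c) ≠ 0 := by
    intro c hc
    refine csqrt_ne_zero fun e => ?_
    have : ((|l| + 2 * i + q + 2 * c : ℤ) : ℂ) = 0 := by push_cast at e ⊢; linear_combination 2 * e
    have : |l| + 2 * i + q + 2 * c = 0 := by exact_mod_cast this
    omega
  have z1 := hz 1 (by norm_num)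
  have z2 := hz 2 (by norm_num)
  push_cast at z1 z2
  have := (Pplus_ne_zero_iff (l := l) (rho := rho) i).2 (h i)
  push_cast at this
  simp [hb, hc] at e1
  tauto

theorem Generic.Kp_ne_zero (h : Generic l rho) {y : V l rho} (hy : y ≠ 0) :
    (ofModule (V l rho)).Kp y ≠ 0 := by
  rw [ofModule_V]
  have := h.add_smul_Kp_ne_zero (a := 0) one_ne_zero hy
  rwa [zero_smul, one_smul, zero_add] at this

theorem Generic.Bp_ne_zero (h : Generic l rho) (A : ℤˣ) {y : V l rho} (hy : y ≠ 0) :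
    (ofModule (V l rho)).Bp (iA A) y ≠ 0 := by
  have hA : -iA A ≠ 0 := neg_ne_zero.2 fun e => by simpa [e] using iA_mul_iA A
  have := h.add_smul_Kp_ne_zero (a := 1) hA hy
  rw [Bp_apply, ofModule_V]
  rwa [one_smul, neg_smul, ← sub_eq_add_neg] at this

end Injective

/-! ### Components of a tensor along the basis `fvec` of F. -/

section Components

variable {A : ℤˣ} {n : ℕ}

/-- The coordinates with respect to the vectors `fvec A n k`. -/
noncomputable def fcoord (A : ℤˣ) (n k : ℕ) : F A n →ₗ[ℂ] ℂ :=
  (fBasis A n).constr ℂ fun i => if (i : ℕ) = k then 1 else 0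

theorem fcoord_fvec {k i : ℕ} (hi : i ≤ n) : fcoord A n k (fvec A n i) = if i = k then 1 else 0 := by
  have := (fBasis A n).constr_basis ℂ (fun i => if (i : ℕ) = k then (1 : ℂ) else 0) ⟨i, by omega⟩
  rwa [fBasis_apply] at this

theorem eq_of_fvec_le {Z : Type*} [AddCommGroup Z] [Module ℂ Z] {S T : F A n →ₗ[ℂ] Z}
    (h : ∀ k ≤ n, S (fvec A n k) = T (fvec A n k)) (f : F A n) : S f = T f :=
  LinearMap.congr_fun ((fBasis A n).ext fun k => by rw [fBasis_apply]; exact h k (by omega)) f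

theorem fcoord_J₀ (k : ℕ) (f : F A n) :
    fcoord A n k ((ofModule (F A n)).J₀ f) = ((n : ℂ) / 2 - k) * fcoord A n k f := by
  refine eq_of_fvec_le (S := fcoord A n k ∘ₗ (ofModule (F A n)).J₀)
    (T := ((n : ℂ) / 2 - k) • fcoord A n k) (fun i hi => ?_) f
  rw [LinearMap.comp_apply, J₀_fvec, map_smul, LinearMap.smul_apply, fcoord_fvec hi]
  split_ifs with e
  · rw [e]
  · simp

theorem fcoord_Jp (k : ℕ) (f : F A n) : fcoord A n k ((ofModule (F A n)).Jp f) =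
    ((k + 1 : ℂ) * (n - k)) * fcoord A n (k + 1) f := by
  refine eq_of_fvec_le (S := fcoord A n k ∘ₗ (ofModule (F A n)).Jp)
    (T := ((k + 1 : ℂ) * (n - k)) • fcoord A n (k + 1)) (fun i hi => ?_) f
  rw [LinearMap.comp_apply, LinearMap.smul_apply, fcoord_fvec hi]
  rcases i with _ | i
  · simp [Jp_fvec_zero]
  · rw [Jp_fvec_succ, map_smul, fcoord_fvec (by omega)]
    by_cases e : i = k
    · subst e; simp
    · rw [if_neg e, if_neg (by omega)]; simp

theorem fcoord_Jm {k : ℕ} (hk : k + 1 ≤ n) (f : F A n) :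
    fcoord A n (k + 1) ((ofModule (F A n)).Jm f) = fcoord A n k f := by
  rw [← LinearMap.comp_apply]
  refine eq_of_fvec_le (fun i hi => ?_) f
  rw [LinearMap.comp_apply, Jm_fvec, fcoord_fvec hi]
  rcases eq_or_lt_of_le hi with rfl | hi
  · rw [fvec_eq_zero (by omega), map_zero, if_neg (by omega)]
  · rw [fcoord_fvec (by omega)]
    simp

theorem fcoord_of_lt {k : ℕ} (hk : n < k) : fcoord A n k = 0 :=
  LinearMap.ext fun f => eq_of_fvec_le (T := 0) (fun i hi => by
    rw [fcoord_fvec hi, if_neg (by omega), LinearMap.zero_apply]) f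

variable (X : Type*) [AddCommGroup X] [Module ℂ X]

/-- The component `v_k` of `∑ k, fvec A n k ⊗ₜ v_k`. -/
noncomputable def comp (A : ℤˣ) (n k : ℕ) : F A n ⊗[ℂ] X →ₗ[ℂ] X :=
  TensorProduct.lid ℂ X ∘ₗ (fcoord A n k).rTensor X

variable {X}

theorem comp_tmul (k : ℕ) (f : F A n) (x : X) : comp X A n k (f ⊗ₜ x) = fcoord A n k f • x := rfl

theorem sum_comp (w : F A n ⊗[ℂ] X) :
    ∑ k ∈ Finset.range (n + 1), fvec A n k ⊗ₜ comp X A n k w = w := by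
  induction w using TensorProduct.induction_on with
  | zero => simp
  | add v w hv hw => simp only [map_add, TensorProduct.tmul_add, Finset.sum_add_distrib, hv, hw]
  | tmul f x =>
    simp only [comp_tmul, ← TensorProduct.smul_tmul, ← TensorProduct.sum_tmul]
    congr 1
    refine Eq.trans ?_ (eq_of_fvec_le
      (S := ∑ k ∈ Finset.range (n + 1), (fcoord A n k).smulRight (fvec A n k))
      (T := LinearMap.id) (fun i hi => ?_) f)
    · simp
    · simp only [LinearMap.sum_apply, LinearMap.smulRight_apply, fcoord_fvec hi, LinearMap.id_apply]
      rw [Finset.sum_eq_single i]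
      · simp
      · intro b _ hb
        rw [if_neg hb.symm, zero_smul]
      · intro h
        exact absurd (Finset.mem_range.2 (by omega)) h

theorem eq_zero_of_comp {w : F A n ⊗[ℂ] X} (h : ∀ k ≤ n, comp X A n k w = 0) : w = 0 := by
  rw [← sum_comp w]
  refine Finset.sum_eq_zero fun k hk => ?_
  rw [h k (by have := Finset.mem_range.1 hk; omega), TensorProduct.tmul_zero]

theorem comp_of_lt {k : ℕ} (hk : n < k) (w : F A n ⊗[ℂ] X) : comp X A n k w = 0 := by
  rw [comp, fcoord_of_lt hk, LinearMap.rTensor_zero, LinearMap.comp_zero, LinearMap.zero_apply]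

variable [LieRingModule Spin31 X] [LieModule ℂ Spin31 X]

theorem comp_J₀ (k : ℕ) (w : F A n ⊗[ℂ] X) : comp X A n k ((ofModule (F A n ⊗[ℂ] X)).J₀ w) =
    (ofModule X).J₀ (comp X A n k w) + ((n : ℂ) / 2 - k) • comp X A n k w := by
  refine eq_of_tmul (S := comp X A n k ∘ₗ (ofModule (F A n ⊗[ℂ] X)).J₀)
    (T := (ofModule X).J₀ ∘ₗ comp X A n k + ((n : ℂ) / 2 - k) • comp X A n k) (fun f x => ?_) w
  simp only [LinearMap.comp_apply, LinearMap.add_apply, LinearMap.smul_apply, J₀_tmul, map_add,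
    comp_tmul, fcoord_J₀, map_smul]
  module

theorem comp_Jp (k : ℕ) (w : F A n ⊗[ℂ] X) : comp X A n k ((ofModule (F A n ⊗[ℂ] X)).Jp w) =
    (ofModule X).Jp (comp X A n k w) + ((k + 1 : ℂ) * (n - k)) • comp X A n (k + 1) w := by
  refine eq_of_tmul (S := comp X A n k ∘ₗ (ofModule (F A n ⊗[ℂ] X)).Jp)
    (T := (ofModule X).Jp ∘ₗ comp X A n k + ((k + 1 : ℂ) * (n - k)) • comp X A n (k + 1))
    (fun f x => ?_) w
  simp only [LinearMap.comp_apply, LinearMap.add_apply, LinearMap.smul_apply, Jp_tmul, map_add,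
    comp_tmul, fcoord_Jp, map_smul]
  module

theorem comp_Kp (k : ℕ) (w : F A n ⊗[ℂ] X) : comp X A n k ((ofModule (F A n ⊗[ℂ] X)).Kp w) =
    (ofModule X).Kp (comp X A n k w) + (iA A * ((k + 1 : ℂ) * (n - k))) • comp X A n (k + 1) w := by
  refine eq_of_tmul (S := comp X A n k ∘ₗ (ofModule (F A n ⊗[ℂ] X)).Kp)
    (T := (ofModule X).Kp ∘ₗ comp X A n k + (iA A * ((k + 1 : ℂ) * (n - k))) • comp X A n (k + 1))
    (fun f x => ?_) w
  have hK : (ofModule (F A n)).Kp f = iA A • (ofModule (F A n)).Jp f := (K_F f).2.1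
  simp only [LinearMap.comp_apply, LinearMap.add_apply, LinearMap.smul_apply, Kp_tmul, map_add,
    comp_tmul, hK, fcoord_Jp, map_smul, smul_eq_mul]
  module

theorem comp_B₀ (k : ℕ) (w : F A n ⊗[ℂ] X) :
    comp X A n k ((ofModule (F A n ⊗[ℂ] X)).B₀ (iA A) w) =
      (ofModule X).B₀ (iA A) (comp X A n k w) + (n - 2 * k : ℂ) • comp X A n k w := by
  refine eq_of_tmul (S := comp X A n k ∘ₗ (ofModule (F A n ⊗[ℂ] X)).B₀ (iA A))
    (T := (ofModule X).B₀ (iA A) ∘ₗ comp X A n k + (n - 2 * k : ℂ) • comp X A n k)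
    (fun f x => ?_) w
  simp only [LinearMap.comp_apply, LinearMap.add_apply, LinearMap.smul_apply, (B_tmul f x).1, map_add,
    comp_tmul, fcoord_J₀, map_smul]
  module

theorem comp_Bp (k : ℕ) (w : F A n ⊗[ℂ] X) :
    comp X A n k ((ofModule (F A n ⊗[ℂ] X)).Bp (iA A) w) =
      (ofModule X).Bp (iA A) (comp X A n k w) +
        (2 * ((k + 1 : ℂ) * (n - k))) • comp X A n (k + 1) w := by
  refine eq_of_tmul (S := comp X A n k ∘ₗ (ofModule (F A n ⊗[ℂ] X)).Bp (iA A))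
    (T := (ofModule X).Bp (iA A) ∘ₗ comp X A n k +
      (2 * ((k + 1 : ℂ) * (n - k))) • comp X A n (k + 1)) (fun f x => ?_) w
  simp only [LinearMap.comp_apply, LinearMap.add_apply, LinearMap.smul_apply, (B_tmul f x).2.1,
    map_add, comp_tmul, fcoord_Jp, map_smul]
  module

theorem comp_Bm {k : ℕ} (hk : k + 1 ≤ n) (w : F A n ⊗[ℂ] X) :
    comp X A n (k + 1) ((ofModule (F A n ⊗[ℂ] X)).Bm (iA A) w) =
      (ofModule X).Bm (iA A) (comp X A n (k + 1) w) + (2 : ℂ) • comp X A n k w := by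
  refine eq_of_tmul (S := comp X A n (k + 1) ∘ₗ (ofModule (F A n ⊗[ℂ] X)).Bm (iA A))
    (T := (ofModule X).Bm (iA A) ∘ₗ comp X A n (k + 1) + (2 : ℂ) • comp X A n k) (fun f x => ?_) w
  simp only [LinearMap.comp_apply, LinearMap.add_apply, LinearMap.smul_apply, (B_tmul f x).2.2,
    map_add, comp_tmul, fcoord_Jm hk, map_smul]
  module

/-- Only B₋ moves a component to a higher index, so `chiral` extends the range of components by one.
The new leading component comes from B₋B₊. -/
theorem comp_chiral {k : ℕ} (hk : k + 1 ≤ n) {w : F A n ⊗[ℂ] X}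
    (hw : ∀ i, k < i → comp X A n i w = 0) :
    comp X A n (k + 1) ((ofModule (F A n ⊗[ℂ] X)).chiral (iA A) w) =
      (2 : ℂ) • (ofModule X).Bp (iA A) (comp X A n k w) := by
  rw [chiral_eq _ _ (iA_mul_iA A)]
  simp only [map_add, map_smul, comp_B₀, comp_Bm hk, comp_Bp, hw (k + 1) (by omega),
    hw (k + 1 + 1) (by omega), map_zero, smul_zero, zero_add, add_zero]

theorem comp_chiral_eq_zero {k : ℕ} {w : F A n ⊗[ℂ] X} (hw : ∀ i, k < i → comp X A n i w = 0)
    {i : ℕ} (hi : k + 1 < i) : comp X A n i ((ofModule (F A n ⊗[ℂ] X)).chiral (iA A) w) = 0 := by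
  rcases lt_or_ge n i with h | h
  · exact comp_of_lt h _
  obtain ⟨i, rfl⟩ : ∃ j, i = j + 1 := ⟨i - 1, by omega⟩
  rw [comp_chiral h fun t ht => hw t (by omega), hw i (by omega), map_zero, smul_zero]

/-- The shifts by z do not affect the leading component, so every polynomial of degree d ≤ n in
`chiral` of this form has the leading component 2^d B₊^d x. -/
theorem comp_prod_chiral (ω : List ℂ) (hn : ω.length ≤ n) (x : X) :
    comp X A n ω.length ((ω.map fun z => (ofModule (F A n ⊗[ℂ] X)).chiral (iA A) - z • 1).prod
        (fvec A n 0 ⊗ₜ x)) = (2 : ℂ) ^ ω.length • ((ofModule X).Bp (iA A) ^ ω.length) x ∧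
      ∀ i, ω.length < i → comp X A n i
        ((ω.map fun z => (ofModule (F A n ⊗[ℂ] X)).chiral (iA A) - z • 1).prod
          (fvec A n 0 ⊗ₜ x)) = 0 := by
  induction ω with
  | nil =>
    refine ⟨?_, fun i hi => ?_⟩
    · simp [comp_tmul, fcoord_fvec]
    · have : (0 : ℕ) ≠ i := by simp at hi; omega
      simp [comp_tmul, fcoord_fvec, this]
  | cons z ω ih =>
    rw [List.length_cons] at hn
    obtain ⟨h1, h2⟩ := ih (by omega)
    simp only [List.map_cons, List.prod_cons, Module.End.mul_apply, List.length_cons,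
      LinearMap.sub_apply, LinearMap.smul_apply, Module.End.one_apply, map_sub, map_smul]
    refine ⟨?_, fun i hi => ?_⟩
    · rw [comp_chiral hn h2, h2 (ω.length + 1) (by omega), h1, smul_zero, sub_zero, map_smul, smul_smul, pow_succ',
        pow_succ' (ofModule X |>.Bp (iA A)), Module.End.mul_apply]
    · rw [comp_chiral_eq_zero h2 hi, h2 _ (by omega), smul_zero, sub_zero]

end Components

end Lorentz

/-! ### Upper bound for the multiplicity of a spin in F ⊗ V. -/

namespace Lorentz

open LadderRep

section Multiplicity

variable {A : ℤˣ} {n : ℕ} {l : ℤ} {rho : ℂ}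

/-- K₊ acts on components as a triangular matrix with K₊ of V on the diagonal, which is injective.
The components vanish by descending induction on the index. -/
theorem Generic.Kp_tensor_ne_zero (h : Generic l rho) {w : F A n ⊗[ℂ] V l rho} (hw : w ≠ 0) :
    (ofModule (F A n ⊗[ℂ] V l rho)).Kp w ≠ 0 := by
  intro e
  refine hw (eq_zero_of_comp fun k _ => ?_)
  have key : ∀ i k : ℕ, n + 1 ≤ k + i → comp (V l rho) A n k w = 0 := by
    intro i
    induction i with
    | zero => exact fun k hk => comp_of_lt hk w
    | succ i ih =>
      intro k hk
      by_contra h0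
      refine h.Kp_ne_zero h0 ?_
      have := comp_Kp k w
      rwa [e, ih (k + 1) (by omega), smul_zero, add_zero, map_zero, eq_comm] at this
  exact key (n + 1) k (by omega)

theorem Generic.Kp_pow_tensor_ne_zero (h : Generic l rho) {w : F A n ⊗[ℂ] V l rho} (hw : w ≠ 0)
    (i : ℕ) : ((ofModule (F A n ⊗[ℂ] V l rho)).Kp ^ i) w ≠ 0 := by
  induction i with
  | zero => simpa using hw
  | succ i ih =>
    rw [pow_succ', Module.End.mul_apply]
    exact h.Kp_tensor_ne_zero ih

section General

variable {X : Type*} [AddCommGroup X] [Module ℂ X] [LieRingModule Spin31 X] [LieModule ℂ Spin31 X]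
  {j : ℂ} {w : F A n ⊗[ℂ] X}

theorem comp_succ_of_hw (hw : w ∈ (ofModule (F A n ⊗[ℂ] X)).hw j) (k : ℕ) :
    ((k + 1 : ℂ) * (n - k)) • comp X A n (k + 1) w = -(ofModule X).Jp (comp X A n k w) := by
  have := comp_Jp k w
  rw [(mem_hw.1 hw).2, map_zero] at this
  exact eq_neg_of_add_eq_zero_right this.symm

theorem Jp_pow_comp_zero (hw : w ∈ (ofModule (F A n ⊗[ℂ] X)).hw j) (k : ℕ) :
    ∃ c : ℂ, ((ofModule X).Jp ^ k) (comp X A n 0 w) = c • comp X A n k w := by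
  induction k with
  | zero => exact ⟨1, by simp⟩
  | succ k ih =>
    obtain ⟨c, hc⟩ := ih
    refine ⟨-(c * ((k + 1 : ℂ) * (n - k))), ?_⟩
    rw [pow_succ', Module.End.mul_apply, hc, map_smul, neg_smul, mul_smul, comp_succ_of_hw hw,
      smul_neg, neg_neg]

/-- J₊w = 0 determines each component from the preceding one, so a highest weight vector is fixed by
its component along the top vector of F. -/
theorem comp_zero_injOn (hw : w ∈ (ofModule (F A n ⊗[ℂ] X)).hw j) (h0 : comp X A n 0 w = 0) :
    w = 0 := by
  refine eq_zero_of_comp fun k hk => ?_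
  induction k with
  | zero => exact h0
  | succ k ih =>
    have := comp_succ_of_hw hw k
    rw [ih (by omega), map_zero, neg_zero] at this
    refine (smul_eq_zero.1 this).resolve_left (mul_ne_zero (Nat.cast_add_one_ne_zero k) ?_)
    rw [sub_ne_zero]
    exact fun e => by have : n = k := by exact_mod_cast e
                      omega

end General

/-- The labels `v = 2ν` such that the multiplet of spin `p/2` occurs in `V_{λ+ν,ρ+Aν}`. -/
noncomputable def labels (n : ℕ) (l : ℤ) (p : ℕ) : Finset ℤ :=
  (Finset.Icc (-(n : ℤ)) n).filter fun v => 2 ∣ n - v ∧ |l + v| ≤ p ∧ 2 ∣ p - (l + v)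

theorem mem_labels {p : ℕ} {v : ℤ} :
    v ∈ labels n l p ↔ v ∈ weights n ∧ |l + v| ≤ p ∧ 2 ∣ p - (l + v) := by
  simp only [labels, weights, Finset.mem_filter, Finset.mem_Icc, Set.mem_ofPred_eq]
  tauto

/-- A parametrisation of the spins in `V_{λ,ρ}` that contribute to the spin `p/2` in
`F^A_γ ⊗ V_{λ,ρ}`. -/
noncomputable def spinOfLabel (n : ℕ) (l : ℤ) (p : ℕ) (v : ℤ) : ℤ :=
  if 0 ≤ l then v + p + n - min (n : ℤ) (p - l) else -v + p + n - min (n : ℤ) (p + l)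

/-- The spins N with max(|l|, |p - n|) ≤ N ≤ p + n form a progression of step 2. It is matched with
the labels from its upper end: for l ≥ 0, N = p + n belongs to the largest label min(n, p - l). For
l < 0 the matching is reflected. -/
theorem exists_label {p : ℕ} {N : ℤ} {i : ℕ} (hN : N = |l| + 2 * i)
    (hq : (p : ℤ) - n ∈ weights N) (hp : N ≤ p + n) :
    ∃ v ∈ labels n l p, spinOfLabel n l p v = N := by
  obtain ⟨h1, h2, h3⟩ := hq
  rcases le_or_gt 0 l with h | h
  · rw [abs_of_nonneg h] at hN
    refine ⟨min (n : ℤ) (p - l) - (p + n - N), mem_labels.2 ⟨⟨?_, ?_, ?_⟩, abs_le.2 ⟨?_, ?_⟩, ?_⟩, ?_⟩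
    any_goals omega
    simp only [spinOfLabel, if_pos h]
    omega
  · rw [abs_of_neg h] at hN
    refine ⟨(p + n - N) - min (n : ℤ) (p + l), mem_labels.2 ⟨⟨?_, ?_, ?_⟩, abs_le.2 ⟨?_, ?_⟩, ?_⟩, ?_⟩
    any_goals omega
    simp only [spinOfLabel, if_neg (not_le.2 h)]
    omega

-- The component has weight (p - n)/2 and is killed by the power n + 1 of J₊. Only kets of this
-- weight with N < p + n + 2 can occur, and parity gives N ≤ p + n.
open Classical in
theorem Generic.comp_zero_mem_span (h : Generic l rho) {p : ℕ} {w : F A n ⊗[ℂ] V l rho}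
    (hw : w ∈ (ofModule (F A n ⊗[ℂ] V l rho)).hw ((p : ℂ) / 2)) :
    comp (V l rho) A n 0 w ∈ Submodule.span ℂ (((labels n l p).image fun v =>
      (ket (basisSet l rho) (spinOfLabel n l p v) (p - n) : Kets (basisSet l rho)) :
        Finset (Kets (basisSet l rho))) : Set (Kets (basisSet l rho))) := by
  have h0 : (ofModule (V l rho)).J₀ (comp (V l rho) A n 0 w) =
      (((p : ℂ) - n) / 2) • comp (V l rho) A n 0 w := by
    have := comp_J₀ 0 w
    rw [(mem_hw.1 hw).1, map_smul] at this
    linear_combination (norm := module) -this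
  have h1 : ((ofModule (V l rho)).Jp ^ (n + 1)) (comp (V l rho) A n 0 w) = 0 := by
    obtain ⟨c, hc⟩ := Jp_pow_comp_zero hw (n + 1)
    rw [hc, comp_of_lt (by omega), smul_zero]
  rw [ofModule_V] at h0 h1
  generalize comp (V l rho) A n 0 w = y at h0 h1
  refine mem_span_ket_of_coef (S := basisSet l rho) fun N q hc => ?_
  obtain ⟨⟨i, hi⟩, hwt⟩ := h.mem_basisSet.1 (mem_of_coef_ne_zero hc)
  have hq : q = p - n := by
    have e := congrArg (coef (basisSet l rho) N q) h0
    have e' : ((q : ℂ) / 2) * coef (basisSet l rho) N q y =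
        (((p : ℂ) - n) / 2) * coef (basisSet l rho) N q y :=
      (coef_opJ₀ _).symm.trans (e.trans (map_smul _ _ _))
    have e'' := mul_right_cancel₀ hc e'
    have : (q : ℂ) = ((p - n : ℤ) : ℂ) := by push_cast; linear_combination 2 * e''
    exact_mod_cast this
  subst hq
  have hN := coef_opJp_pow (weightClosed_basisSet l rho) h1 hc
  have hpar := hwt.2.2
  obtain ⟨v, hv, rfl⟩ := exists_label hi hwt (by push_cast at hN; omega)
  exact Submodule.subset_span (Finset.mem_coe.2 (Finset.mem_image_of_mem _ hv))

/-- The multiplicity of the spin `p/2` in `F^A_γ ⊗ V_{λ,ρ}` is bounded by the number of labels. -/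
theorem Generic.finrank_hw_le (h : Generic l rho) (A : ℤˣ) (n p : ℕ) :
    Module.Finite ℂ ((ofModule (F A n ⊗[ℂ] V l rho)).hw ((p : ℂ) / 2)) ∧
      Module.finrank ℂ ((ofModule (F A n ⊗[ℂ] V l rho)).hw ((p : ℂ) / 2)) ≤
        (labels n l p).card := by
  classical
  let s : Finset (V l rho) := (labels n l p).image fun v =>
    (ket (basisSet l rho) (spinOfLabel n l p v) (p - n) : Kets (basisSet l rho))
  let f : (ofModule (F A n ⊗[ℂ] V l rho)).hw ((p : ℂ) / 2) →ₗ[ℂ] Submodule.span ℂ (s : Set (V l rho)) :=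
    ((comp (V l rho) A n 0).domRestrict _).codRestrict _ fun w =>
      h.comp_zero_mem_span w.2
  have hf : Function.Injective f := by
    rw [injective_iff_map_eq_zero]
    intro w hw
    exact Subtype.ext (comp_zero_injOn w.2 (congrArg Subtype.val hw))
  have : Module.Finite ℂ (Submodule.span ℂ (s : Set (V l rho))) :=
    FiniteDimensional.span_finset ℂ s
  exact ⟨Module.Finite.of_injective f hf, (LinearMap.finrank_le_finrank_of_injective hf).trans
    ((finrank_span_finset_le_card s).trans Finset.card_image_le)⟩

end Multiplicity

/-! ### Every expected eigenvalue occurs. -/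

section Eigenvectors

variable {A : ℤˣ} {n : ℕ} {l : ℤ} {rho : ℂ}

theorem list_prod_apply {W : Type*} [AddCommGroup W] [Module ℂ W] {T : Module.End ℂ W} {μ : ℂ}
    {w : W} (hw : T w = μ • w) (ω : List ℂ) :
    (ω.map fun z => T - z • 1).prod w = (ω.map fun z => μ - z).prod • w := by
  induction ω with
  | nil => simp
  | cons z ω ih =>
    simp only [List.map_cons, List.prod_cons, Module.End.mul_apply, ih, map_smul,
      LinearMap.sub_apply, LinearMap.smul_apply, Module.End.one_apply, hw]
    module

theorem intertwines_list_prod {W : Type*} [AddCommGroup W] [Module ℂ W] (r : LadderRep W) (c : ℂ)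
    (ω : List ℂ) : Intertwines r r (ω.map fun z => r.chiral c - z • 1).prod := by
  induction ω with
  | nil => exact ⟨fun _ => rfl, fun _ => rfl, fun _ => rfl, fun _ => rfl, fun _ => rfl, fun _ => rfl⟩
  | cons z ω ih =>
    have h := intertwines_chiral (r := r) (c := c)
    constructor <;> intro w <;>
      simp only [List.map_cons, List.prod_cons, Module.End.mul_apply, LinearMap.sub_apply,
        LinearMap.smul_apply, Module.End.one_apply, ih.J₀, ih.Jp, ih.Jm, ih.K₀, ih.Kp, ih.Km, h.J₀,
        h.Jp, h.Jm, h.K₀, h.Kp, h.Km, map_sub, map_smul]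

theorem Generic.Bp_pow_ne_zero (h : Generic l rho) (A : ℤˣ) {y : V l rho} (hy : y ≠ 0) (i : ℕ) :
    ((ofModule (V l rho)).Bp (iA A) ^ i) y ≠ 0 := by
  induction i with
  | zero => simpa using hy
  | succ i ih =>
    rw [pow_succ', Module.End.mul_apply]
    exact h.Bp_ne_zero A ih

/-- Outside of the resonances, all the expected eigenvalues of `C₂ - 2iA C₁` occur, already among the
highest weight vectors of spin `γ + |λ|`. -/
theorem Generic.exists_hw_top (h : Generic l rho) {s : ℂ}
    (hs : chiralSum A n (V l rho) s = ⊤) {v : ℤ} (hv : v ∈ weights n) :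
    ∃ w : F A n ⊗[ℂ] V l rho, w ≠ 0 ∧
      w ∈ (ofModule (F A n ⊗[ℂ] V l rho)).hw (((n + l.natAbs : ℕ) : ℂ) / 2) ∧
      (ofModule (F A n ⊗[ℂ] V l rho)).chiral (iA A) w = ((s + v) ^ 2 - 1) • w := by
  set D := (ofModule (F A n ⊗[ℂ] V l rho)).chiral (iA A) with hD
  let x : V l rho := (ket (basisSet l rho) |l| |l| : Kets (basisSet l rho))
  have hx : x ≠ 0 := ket_ne_zero (by simpa using h.top_mem 0)
  obtain ⟨h1, h2, k₀, hk₀⟩ := hv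
  lift k₀ to ℕ using by omega
  let ev : ℕ → ℂ := fun k => (s + (n - 2 * k)) ^ 2 - 1
  -- All expected eigenvalues except that of v = n - 2k₀. There are n of them, so `comp_prod_chiral`
  -- can still see the top component of Q applied to the starting vector.
  let ω : List ℂ := ((Finset.range (n + 1)).erase k₀).toList.map ev
  have hω : ω.length = n := by
    rw [List.length_map, Finset.length_toList, Finset.card_erase_of_mem
      (Finset.mem_range.2 (by omega)), Finset.card_range, Nat.add_sub_cancel]
  let Q : Module.End ℂ (F A n ⊗[ℂ] V l rho) := (ω.map fun z => D - z • 1).prod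
  have hQ := intertwines_list_prod (ofModule (F A n ⊗[ℂ] V l rho)) (iA A) ω
  refine ⟨Q (fvec A n 0 ⊗ₜ x), ?_, ?_, ?_⟩
  · intro e
    have := (comp_prod_chiral (A := A) (n := n) ω hω.le x).1
    rw [← hD] at this
    change comp (V l rho) A n ω.length (Q (fvec A n 0 ⊗ₜ x)) = _ at this
    rw [e, map_zero] at this
    exact smul_ne_zero (pow_ne_zero _ two_ne_zero) (h.Bp_pow_ne_zero A hx _) this.symm
  · have e1 := mem_hw.1 (fvec_zero_mem_hw A n)
    have e2 : (ofModule (V l rho)).J₀ x = ((l.natAbs : ℂ) / 2) • x ∧ (ofModule (V l rho)).Jp x = 0 :=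
      mem_hw.1 h.isTower.mem_hw
    refine mem_hw.2 ⟨?_, ?_⟩
    · rw [← hQ.J₀, J₀_tmul, e1.1, e2.1, TensorProduct.tmul_smul, ← TensorProduct.smul_tmul',
        ← add_smul, map_smul]
      push_cast
      rw [add_div]
    · rw [← hQ.Jp, Jp_tmul, e1.2, e2.2, TensorProduct.tmul_zero, TensorProduct.zero_tmul, add_zero,
        map_zero]
  -- Q annihilates each of the other eigenspaces, and all eigenspaces together span, so the image of
  -- Q lies in the one with label v.
  · have key : ∀ w, D (Q w) = ((s + v) ^ 2 - 1) • Q w := by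
      intro w
      have hw : w ∈ chiralSum A n (V l rho) s := hs ▸ trivial
      suffices hle : chiralSum A n (V l rho) s ≤
          LinearMap.ker ((D - ((s + v) ^ 2 - 1) • (1 : Module.End ℂ (F A n ⊗[ℂ] V l rho))) * Q) by
        have := LinearMap.mem_ker.1 (hle hw)
        rwa [Module.End.mul_apply, LinearMap.sub_apply, LinearMap.smul_apply, Module.End.one_apply,
          sub_eq_zero] at this
      refine iSup_le fun v' y hy => ?_
      rw [Module.End.mem_eigenspace_iff] at hy
      have hy' := list_prod_apply hy ω
      rw [LinearMap.mem_ker, Module.End.mul_apply]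
      change (D - ((s + v) ^ 2 - 1) • (1 : Module.End ℂ (F A n ⊗[ℂ] V l rho))) (Q y) = 0
      rw [show Q y = _ from hy', map_smul, LinearMap.sub_apply, LinearMap.smul_apply,
        Module.End.one_apply, hy]
      obtain ⟨v', g1, g2, k, hk⟩ := v'
      lift k to ℕ using by omega
      have hv' : v' = n - 2 * k := by omega
      rcases eq_or_ne k k₀ with rfl | hne
      · obtain rfl : v = v' := by omega
        simp only [sub_self, smul_zero]
      · have : (ω.map fun z => (s + ((v' : ℤ) : ℂ)) ^ 2 - 1 - z).prod = 0 := by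
          refine List.prod_eq_zero (List.mem_map.2 ⟨ev k, List.mem_map.2 ⟨k, ?_, rfl⟩, ?_⟩)
          · rw [Finset.mem_toList, Finset.mem_erase, Finset.mem_range]
            exact ⟨hne, by omega⟩
          · simp only [ev]
            rw [hv']
            push_cast
            ring
        rw [this, zero_smul]
    exact key _

end Eigenvectors

end Lorentz

/-! ### Restriction to submodules, and arithmetic of the labels. -/

namespace Lorentz

open LadderRep

section Restriction

theorem map_pow_apply {X X' : Type*} [AddCommGroup X] [Module ℂ X] [AddCommGroup X'] [Module ℂ X']
    {f : X →ₗ[ℂ] X'}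
    {S : Module.End ℂ X} {T : Module.End ℂ X'} (h : ∀ x, f (S x) = T (f x)) (k : ℕ) (x : X) :
    f ((S ^ k) x) = (T ^ k) (f x) := by
  induction k with
  | zero => rfl
  | succ k ih => rw [pow_succ', pow_succ', Module.End.mul_apply, Module.End.mul_apply, h, ih]

variable {X : Type*} [AddCommGroup X] [Module ℂ X] [LieRingModule Spin31 X] [LieModule ℂ Spin31 X]

/-- A submodule that is generated by a highest weight vector, and by `K₊` and `J₋` from it. -/
theorem isTower_of_tower_eq {N : LieSubmodule ℂ Spin31 X} {p : ℕ} {c₁ c₂ : ℂ} {w : X} (hw : w ∈ N)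
    (hl : (ofModule X).LocNilpotent) (hhw : w ∈ (ofModule X).hw (p / 2))
    (hne : ∀ i, ((ofModule X).Kp ^ i) w ≠ 0) (ht : (ofModule X).tower w = N)
    (h₁ : ∀ x ∈ N, (ofModule X).cas₁ x = c₁ • x) (h₂ : ∀ x ∈ N, (ofModule X).cas₂ x = c₂ • x)
    (h₀ : p = 0 → c₁ = 0) : (ofModule N).IsTower p c₁ c₂ ⟨w, hw⟩ := by
  have hf : Intertwines (ofModule N) (ofModule X) (N.incl : N →ₗ[ℂ] X) :=
    intertwines_of_map_lie fun x w => N.incl.map_lie x w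
  have hinj : Function.Injective (N.incl : N →ₗ[ℂ] X) := Subtype.val_injective
  have hl' : (ofModule N).LocNilpotent := by
    refine ⟨fun x => ?_, fun x => ?_⟩
    · obtain ⟨k, hk⟩ := hl.Jp (x : X)
      exact ⟨k, hinj ((map_pow_apply hf.Jp k x).trans (hk.trans (map_zero _).symm))⟩
    · obtain ⟨k, hk⟩ := hl.Jm (x : X)
      exact ⟨k, hinj ((map_pow_apply hf.Jm k x).trans (hk.trans (map_zero _).symm))⟩
  have hhw' : (⟨w, hw⟩ : N) ∈ (ofModule N).hw (p / 2) := by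
    obtain ⟨e1, e2⟩ := mem_hw.1 hhw
    refine mem_hw.2 ⟨hinj ?_, hinj ?_⟩
    · exact (hf.J₀ _).trans e1
    · exact (hf.Jp _).trans (e2.trans (map_zero _).symm)
  have ht' : (ofModule N).tower ⟨w, hw⟩ = ⊤ := by
    rw [eq_top_iff]
    have hm : ((ofModule N).tower ⟨w, hw⟩).map (N.incl : N →ₗ[ℂ] X) = (ofModule X).tower w := by
      rw [tower, Submodule.map_span, tower, ← Set.range_comp]
      congr 2
      ext x
      exact (map_pow_apply hf.Jm _ _).trans (congrArg _ (map_pow_apply hf.Kp _ _))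
    rintro ⟨x, hx⟩ -
    have hx' : x ∈ (ofModule X).tower w := by rw [ht]; exact hx
    rw [← hm] at hx'
    obtain ⟨y, hy, e⟩ := hx'
    rwa [← show y = ⟨x, hx⟩ from hinj e]
  refine ⟨hl', hhw', fun i e => hne i ?_, ht', fun u hu => eq_zero_of_mem_hw_pred hl' hhw' ht' hu,
    fun x => hinj ?_, fun x => hinj ?_, h₀⟩
  · exact (map_pow_apply hf.Kp i ⟨w, hw⟩).symm.trans ((congrArg _ e).trans (map_zero _))
  · exact (hf.cas₁ x).trans (h₁ x x.2)
  · exact (hf.cas₂ x).trans (h₂ x x.2)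

/-- By the modular law, E i is U i plus the part of E i inside the sum of the other U j, which is
zero by independence. -/
theorem eq_of_le_of_iSup_eq_top {ι : Type*} {E U : ι → Submodule ℂ X} (hE : iSupIndep E)
    (hU : ∀ i, U i ≤ E i) (htop : ⨆ i, U i = ⊤) (i : ι) : U i = E i := by
  refine le_antisymm (hU i) ?_
  have h1 : E i ≤ U i ⊔ ⨆ (j) (_ : j ≠ i), U j := by
    rw [← iSup_split_single, htop]
    exact le_top
  calc E i = (U i ⊔ ⨆ (j) (_ : j ≠ i), U j) ⊓ E i := (inf_eq_right.2 h1).symm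
    _ = U i ⊔ (⨆ (j) (_ : j ≠ i), U j) ⊓ E i := sup_inf_assoc_of_le _ (hU i)
    _ ≤ U i := by
      refine sup_le le_rfl ?_
      have : (⨆ (j) (_ : j ≠ i), U j) ⊓ E i ≤ ⊥ :=
        ((hE i).mono_right (iSup₂_mono fun j _ => hU j)).le_bot.trans' (inf_comm _ _).le
      exact this.trans bot_le

end Restriction

section Chiral

variable {A : ℤˣ} {n : ℕ} {l : ℤ} {rho : ℂ}

theorem unit_mul_self (A : ℤˣ) : ((A : ℤ) : ℂ) * ((A : ℤ) : ℂ) = 1 := by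
  rcases Int.units_eq_one_or A with rfl | rfl <;> simp

theorem Generic.chiral_V (h : Generic l rho) (x : V l rho) :
    (ofModule (V l rho)).chiral (iA A) x =
      (((l : ℂ) / 2 + ((A : ℤ) : ℂ) * rho) ^ 2 - 1) • x ∧
    (ofModule (V l rho)).chiral (-iA A) x =
      (((l : ℂ) / 2 - ((A : ℤ) : ℂ) * rho) ^ 2 - 1) • x := by
  have hA := unit_mul_self A
  rw [chiral_apply, chiral_apply, h.isTower.cas₁, h.isTower.cas₂, smul_smul, smul_smul, ← sub_smul,
    ← sub_smul, iA]
  constructor <;> congr 1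
  · linear_combination (-(l : ℂ) * rho * (A : ℤ)) * Complex.I_mul_I - rho ^ 2 * hA
  · linear_combination ((l : ℂ) * rho * (A : ℤ)) * Complex.I_mul_I - rho ^ 2 * hA

/-- Since `C₂ + 2iA C₁` acts as a scalar, the Casimirs are determined by `C₂ - 2iA C₁`. -/
theorem Generic.casimirEigenspace_eq (h : Generic l rho) (v : ℤ) :
    casimirEigenspace (F A n ⊗[ℂ] V l rho) ((l : ℂ) / 2 + (v : ℂ) / 2)
        (rho + ((A : ℤ) : ℂ) * ((v : ℂ) / 2)) =
      ((ofModule (F A n ⊗[ℂ] V l rho)).chiral (iA A)).eigenspace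
        (((l : ℂ) / 2 + ((A : ℤ) : ℂ) * rho + v) ^ 2 - 1) := by
  have hA := unit_mul_self A
  have hc := iA_mul_iA A
  ext w
  rw [casimirEigenspace, Submodule.mem_inf, Module.End.mem_eigenspace_iff,
    Module.End.mem_eigenspace_iff, Module.End.mem_eigenspace_iff, casimir₁_eq, casimir₂_eq]
  constructor
  · rintro ⟨h1, h2⟩
    rw [chiral_apply, h1, h2, smul_smul, ← sub_smul, iA]
    congr 1
    linear_combination (-2 * ((l : ℂ) / 2 + (v : ℂ) / 2) * (A : ℤ) *
      (rho + ((A : ℤ) : ℂ) * ((v : ℂ) / 2))) * Complex.I_mul_I +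
      (-rho ^ 2 + (l : ℂ) * v / 2 + (v : ℂ) ^ 2 * (3 / 4 - 0)) * hA
  · intro h1
    -- The eigenvalue (λ - Aρ)² - 1 of C₂ + 2iA C₁ is independent of the label. Half the sum of both
    -- chiral operators is C₂, and their difference is 4iA C₁.
    have h2 := chiral_neg_tensor (n := n) (fun x => (h.chiral_V (A := A) x).2) w
    rw [chiral_apply] at h1 h2
    constructor
    · have e : (ofModule (F A n ⊗[ℂ] V l rho)).cas₁ w =
          (-(iA A / 4) * (4 * iA A)) • (ofModule (F A n ⊗[ℂ] V l rho)).cas₁ w := by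
        rw [show -(iA A / 4) * (4 * iA A) = 1 by linear_combination -hc, one_smul]
      rw [e, mul_smul, show (4 * iA A) • (ofModule (F A n ⊗[ℂ] V l rho)).cas₁ w =
        ((((l : ℂ) / 2 - ((A : ℤ) : ℂ) * rho) ^ 2 - 1) -
          ((((l : ℂ) / 2 + ((A : ℤ) : ℂ) * rho + v) ^ 2 - 1))) • w by
        linear_combination (norm := module) h2 - h1, smul_smul, iA]
      congr 1
      linear_combination (Complex.I * ((l : ℂ) * rho / 2 + v * rho / 2)) * hA
    · have e : (ofModule (F A n ⊗[ℂ] V l rho)).cas₂ w =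
          ((1 / 2 : ℂ) * ((((l : ℂ) / 2 - ((A : ℤ) : ℂ) * rho) ^ 2 - 1) +
            ((((l : ℂ) / 2 + ((A : ℤ) : ℂ) * rho + v) ^ 2 - 1)))) • w := by
        linear_combination (norm := module) (1 / 2 : ℂ) • h1 + (1 / 2 : ℂ) • h2
      rw [e]
      congr 1
      linear_combination (rho ^ 2 - (v : ℂ) ^ 2 / 4) * hA

end Chiral

section Labels

variable {A : ℤˣ} {n : ℕ} {l : ℤ} {rho : ℂ}

theorem ne_intCast_of_nonresonant (hres : ∀ k : ℤ, -(n : ℤ) < k → k < n →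
    rho + ((A : ℤ) : ℂ) * ((l : ℂ) / 2) ≠ k) (k : ℤ) (h1 : -(n : ℤ) < k) (h2 : k < n) :
    (l : ℂ) / 2 + ((A : ℤ) : ℂ) * rho ≠ k := by
  have hA := unit_mul_self A
  intro e
  have h3 : rho + ((A : ℤ) : ℂ) * ((l : ℂ) / 2) = ((A * k : ℤ) : ℂ) := by
    push_cast
    linear_combination ((A : ℤ) : ℂ) * e - rho * hA
  rcases Int.units_eq_one_or A with rfl | rfl
  · exact hres _ (by simpa using h1) (by simpa using h2) h3
  · refine hres _ ?_ ?_ h3 <;> push_cast <;> omega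

/-- Equal squares with v ≠ v' force s = -(v + v')/2. This is an integer, since v and v' have the
parity of n, and it lies strictly between -n and n. -/
theorem eigenvalue_injective {s : ℂ} (hs : ∀ k : ℤ, -(n : ℤ) < k → k < n → s ≠ k) :
    Function.Injective fun v : weights n => (s + ((v : ℤ) : ℂ)) ^ 2 - 1 := by
  rintro ⟨v, h1, h2, a, ha⟩ ⟨v', h1', h2', b, hb⟩ e
  have : ((v : ℂ) - v') * (2 * s + v + v') = 0 := by
    simp only at e
    linear_combination e
  refine Subtype.ext (?_ : v = v')
  rcases mul_eq_zero.1 this with e | e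
  · exact_mod_cast sub_eq_zero.1 e
  · by_contra hne
    have hk : ((v + v' : ℤ) : ℂ) = 2 * ((n - a - b : ℤ) : ℂ) := by
      rw [show v + v' = 2 * (n - a - b) by omega]
      push_cast
      ring
    refine hs (-(n - a - b)) (by omega) (by omega) ?_
    push_cast at hk ⊢
    linear_combination e / 2 - hk / 2

theorem eq_or_eq_neg_of_half_sq {x : ℂ} {a : ℤ} (h : ((a : ℂ) / 2 + 1) ^ 2 = x ^ 2) :
    2 * x = ((a + 2 : ℤ) : ℂ) ∨ 2 * x = ((-(a + 2) : ℤ) : ℂ) := by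
  rcases sq_eq_sq_iff_eq_or_eq_neg.1 h with e | e
  · left; push_cast; linear_combination -2 * e
  · right; push_cast; linear_combination 2 * e

/-- Suppose the module with label v is finite-dimensional. Then M = 2Aρ + v is an integer with |M| >
|l + v| and M = l + v + 2t, so s = l + t is an integer and |l + t| ≥ n by non-resonance. As V_{λ,ρ}
is infinite-dimensional, 2Aρ = l + 2t satisfies |l + 2t| ≤ |l|, that is t(l + t) ≤ 0. Since |v| ≤ n
≤ |l + t|, also t(l + t + v) ≤ 0, that is |M| ≤ |l + v|, a contradiction. -/
theorem Generic.shift (h : Generic l rho) (hn : 1 ≤ n)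
    (hs : ∀ k : ℤ, -(n : ℤ) < k → k < n → (l : ℂ) / 2 + ((A : ℤ) : ℂ) * rho ≠ k) {v : ℤ}
    (hv : v ∈ weights n) : Generic (l + v) (rho + ((A : ℤ) : ℂ) * ((v : ℂ) / 2)) := by
  have hA := unit_mul_self A
  obtain ⟨h1, h2, -⟩ := hv
  intro i e
  obtain ⟨M, hM, hMe⟩ : ∃ M : ℤ, (M = |l + v| + 2 * i + 2 ∨ M = -(|l + v| + 2 * i + 2)) ∧
      2 * (((A : ℤ) : ℂ) * rho) + v = M := by
    have hA' : ∀ x : ℂ, 2 * (rho + ((A : ℤ) : ℂ) * ((v : ℂ) / 2)) = x →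
        2 * (((A : ℤ) : ℂ) * rho) + v = (A : ℤ) * x := fun x hx => by
      linear_combination ((A : ℤ) : ℂ) * hx - (v : ℂ) * hA
    rcases eq_or_eq_neg_of_half_sq e with e | e <;> have e' := hA' _ e <;>
      rcases Int.units_eq_one_or A with rfl | rfl
    · exact ⟨_, Or.inl rfl, by simpa using e'⟩
    · exact ⟨_, Or.inr rfl, by rw [e']; push_cast; ring⟩
    · exact ⟨_, Or.inr rfl, by simpa using e'⟩
    · exact ⟨_, Or.inl rfl, by rw [e']; push_cast; ring⟩
  have hpar : 2 ∣ M - (l + v) := by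
    rcases hM with rfl | rfl <;> rcases abs_cases (l + v) with ⟨e, -⟩ | ⟨e, -⟩ <;> rw [e] <;> omega
  obtain ⟨t, ht⟩ := hpar
  have hst : (l : ℂ) / 2 + ((A : ℤ) : ℂ) * rho = ((l + t : ℤ) : ℂ) := by
    have : (M : ℂ) = ((l + v + 2 * t : ℤ) : ℂ) := by rw [← ht]; push_cast; ring
    push_cast at this ⊢
    linear_combination hMe / 2 + this / 2
  have hlt : l + t ≤ -n ∨ n ≤ l + t := by
    by_contra hcon
    push Not at hcon
    exact hs (l + t) (by omega) (by omega) hst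
  have hr : |l + 2 * t| ≤ |l| := by
    by_contra hcon
    push Not at hcon
    obtain ⟨k, hk⟩ : ∃ k : ℕ, |l + 2 * t| = |l| + 2 * k + 2 := by
      refine ⟨((|l + 2 * t| - |l| - 2) / 2).toNat, ?_⟩
      rcases abs_cases (l + 2 * t) with ⟨e1, g1⟩ | ⟨e1, g1⟩ <;>
        rcases abs_cases l with ⟨e2, g2⟩ | ⟨e2, g2⟩ <;> omega
    refine h k ?_
    have h1 : ((|l + 2 * t| : ℤ) : ℂ) ^ 2 = (l + 2 * t) ^ 2 := by
      have := sq_abs (l + 2 * t)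
      exact_mod_cast this
    have h2 : ((A : ℤ) : ℂ) * rho = l / 2 + t := by
      push_cast at hst; linear_combination hst
    have h3 : rho = ((A : ℤ) : ℂ) * (l / 2 + t) := by
      linear_combination ((A : ℤ) : ℂ) * h2 - rho * hA
    rw [hk] at h1
    push_cast at h1 ⊢
    rw [h3]
    linear_combination h1 / 4 - (l / 2 + t) ^ 2 * hA
  rcases abs_cases (l + 2 * t) with ⟨e1, g1⟩ | ⟨e1, g1⟩ <;>
    rcases abs_cases l with ⟨e2, g2⟩ | ⟨e2, g2⟩ <;>
    rcases abs_cases (l + v) with ⟨e3, g3⟩ | ⟨e3, g3⟩ <;> omega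

end Labels

end Lorentz

/-! ### The decomposition of F ⊗ V. -/

namespace Lorentz

open LadderRep

section Decomposition

variable {A : ℤˣ} {n : ℕ} {l : ℤ} {rho : ℂ}

theorem chiral_lower {W : Type*} [AddCommGroup W] [Module ℂ W] (r : LadderRep W) (c j : ℂ) (w : W) :
    r.chiral c (r.lower j w) = r.lower j (r.chiral c w) := by
  have h := intertwines_chiral (r := r) (c := c)
  simp only [lower_apply, map_sub, map_smul, h.Jm, h.K₀, h.Kp, h.Km]

theorem chiral_Kp_pow {W : Type*} [AddCommGroup W] [Module ℂ W] (r : LadderRep W) (c : ℂ) (i : ℕ)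
    (w : W) : r.chiral c ((r.Kp ^ i) w) = (r.Kp ^ i) (r.chiral c w) :=
  map_pow_apply (intertwines_chiral (r := r) (c := c)).Kp i w

theorem chiral_Jm_pow {W : Type*} [AddCommGroup W] [Module ℂ W] (r : LadderRep W) (c : ℂ) (i : ℕ)
    (w : W) : r.chiral c ((r.Jm ^ i) w) = (r.Jm ^ i) (r.chiral c w) :=
  map_pow_apply (intertwines_chiral (r := r) (c := c)).Jm i w

theorem Generic.cas_of_chiral (h : Generic l rho) {v : ℤ} {w : F A n ⊗[ℂ] V l rho}
    (hw : (ofModule (F A n ⊗[ℂ] V l rho)).chiral (iA A) w =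
      (((l : ℂ) / 2 + ((A : ℤ) : ℂ) * rho + v) ^ 2 - 1) • w) :
    (ofModule (F A n ⊗[ℂ] V l rho)).cas₁ w = (Complex.I * ((l : ℂ) / 2 + (v : ℂ) / 2) *
        (rho + ((A : ℤ) : ℂ) * ((v : ℂ) / 2))) • w ∧
      (ofModule (F A n ⊗[ℂ] V l rho)).cas₂ w = (((l : ℂ) / 2 + (v : ℂ) / 2) ^ 2 +
        (rho + ((A : ℤ) : ℂ) * ((v : ℂ) / 2)) ^ 2 - 1) • w := by
  have := Module.End.mem_eigenspace_iff.2 hw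
  rw [← h.casimirEigenspace_eq v, casimirEigenspace, Submodule.mem_inf,
    Module.End.mem_eigenspace_iff, Module.End.mem_eigenspace_iff, casimir₁_eq, casimir₂_eq] at this
  exact this

/-- The vector of lowest spin `|λ + ν|` with label `ν`. -/
theorem Generic.exists_hw_bot (h : Generic l rho) (hn : 1 ≤ n)
    (hs : ∀ k : ℤ, -(n : ℤ) < k → k < n → (l : ℂ) / 2 + ((A : ℤ) : ℂ) * rho ≠ k) {v : ℤ}
    (hv : v ∈ weights n) :
    ∃ w : F A n ⊗[ℂ] V l rho, w ≠ 0 ∧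
      w ∈ (ofModule (F A n ⊗[ℂ] V l rho)).hw (((l + v).natAbs : ℂ) / 2) ∧
      (ofModule (F A n ⊗[ℂ] V l rho)).chiral (iA A) w =
        (((l : ℂ) / 2 + ((A : ℤ) : ℂ) * rho + v) ^ 2 - 1) • w := by
  have hgen := h.shift hn hs hv
  -- Descent by `lower` from spin |λ + ν| + m. At every spin j > |λ + ν| on the way, j² ≠ Λ² holds
  -- by size and j² ≠ Ρ² by `Generic.shift`.
  have key : ∀ (m : ℕ) (w : F A n ⊗[ℂ] V l rho), w ≠ 0 →
      w ∈ (ofModule (F A n ⊗[ℂ] V l rho)).hw ((((l + v).natAbs + 2 * m : ℕ) : ℂ) / 2) →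
      (ofModule (F A n ⊗[ℂ] V l rho)).chiral (iA A) w =
        (((l : ℂ) / 2 + ((A : ℤ) : ℂ) * rho + v) ^ 2 - 1) • w →
      ∃ w : F A n ⊗[ℂ] V l rho, w ≠ 0 ∧
        w ∈ (ofModule (F A n ⊗[ℂ] V l rho)).hw (((l + v).natAbs : ℂ) / 2) ∧
        (ofModule (F A n ⊗[ℂ] V l rho)).chiral (iA A) w =
          (((l : ℂ) / 2 + ((A : ℤ) : ℂ) * rho + v) ^ 2 - 1) • w := by
    intro m
    induction m with
    | zero => exact fun w h0 h1 h2 => ⟨w, h0, by simpa using h1, h2⟩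
    | succ m ih =>
      intro w h0 h1 h2
      have hj : (((l + v).natAbs + 2 * (m + 1) : ℕ) : ℂ) / 2 =
          ((|l + v| + 2 * m : ℤ) : ℂ) / 2 + 1 := by
        have : ((l + v).natAbs : ℂ) = ((|l + v| : ℤ) : ℂ) := by
          rw [Int.abs_eq_natAbs, Int.cast_natCast]
        push_cast
        rw [this]
        ring
      obtain ⟨c1, c2⟩ := h.cas_of_chiral h2
      refine ih _ (lower_ne_zero h1 h0 c1 c2 ?_ ?_) ?_ ?_
      · rw [hj]
        have := succ_sq_ne (l + v) m
        rw [← add_div]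
        exact_mod_cast this
      · rw [hj]
        exact hgen m
      · have := lower_mem_hw h1
        convert this using 2
        push_cast
        ring
      · rw [chiral_lower, h2, map_smul]
  have htop := chiralSum_eq_top (n := n) (fun x => (h.chiral_V (A := A) x).1) hs
  obtain ⟨w, h0, h1, h2⟩ := h.exists_hw_top htop hv
  obtain ⟨g1, g2, g3⟩ := hv
  obtain ⟨m, hm⟩ : ∃ m : ℕ, n + l.natAbs = (l + v).natAbs + 2 * m :=
    ⟨(n + l.natAbs - (l + v).natAbs) / 2, by omega⟩
  rw [hm] at h1
  exact key m w h0 h1 h2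

theorem span_weight_tensor (U : Submodule ℂ (F A n ⊗[ℂ] V l rho))
    (hU : ∀ (q : ℤ) (w : F A n ⊗[ℂ] V l rho),
      (ofModule (F A n ⊗[ℂ] V l rho)).J₀ w = ((q : ℂ) / 2) • w → w ∈ U) : U = ⊤ := by
  rw [eq_top_iff, ← TensorProduct.span_tmul_eq_top, Submodule.span_le]
  rintro _ ⟨f, x, rfl⟩
  have key : ∀ N q : ℤ, ∀ f : F A n,
      f ⊗ₜ[ℂ] (show V l rho from ket (basisSet l rho) N q) ∈ U := by
    intro N q f
    have : f ∈ U.comap ((TensorProduct.mk ℂ (F A n) (V l rho)).flip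
        (show V l rho from ket (basisSet l rho) N q)) := by
      refine (?_ : (⊤ : Submodule ℂ (F A n)) ≤ _) trivial
      refine (span_fvec A n).trans (Submodule.span_le.2 ?_)
      rintro _ ⟨k, rfl⟩
      refine hU (n - 2 * k + q) _ ?_
      have e : (ofModule (V l rho)).J₀ (show V l rho from ket (basisSet l rho) N q) =
          ((q : ℂ) / 2) • (show V l rho from ket (basisSet l rho) N q) := by
        rw [ofModule_V]; exact opJ₀_ket
      rw [LinearMap.flip_apply, TensorProduct.mk_apply, J₀_tmul, J₀_fvec, e,
        TensorProduct.tmul_smul, ← TensorProduct.smul_tmul', ← add_smul]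
      congr 1
      push_cast
      ring
    exact this
  have : x ∈ U.comap (TensorProduct.mk ℂ (F A n) (V l rho) f) := by
    have htop : (⊤ : Submodule ℂ (V l rho)) ≤ U.comap (TensorProduct.mk ℂ (F A n) (V l rho) f) := by
      refine (span_ket (S := basisSet l rho)).ge.trans (Submodule.span_le.2 ?_)
      rintro _ ⟨N, q, -, rfl⟩
      exact key N q f
    exact htop trivial
  exact this

theorem locNilpotent_tensor (A : ℤˣ) (n : ℕ) (l : ℤ) (rho : ℂ) :
    (ofModule (F A n ⊗[ℂ] V l rho)).LocNilpotent :=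
  (locNilpotent_F A n).tensor (by rw [ofModule_V]; exact locNilpotent_repV l rho)

/-- By `mem_strings` it suffices to reach all highest weight vectors. In spin p/2 each label with |λ
+ ν| ≤ p/2 and the right parity contributes one vector K₊ⁱb_ν; these lie in different eigenspaces,
and their number is the upper bound for the multiplicity. -/
theorem Generic.iSup_tower_eq_top (h : Generic l rho)
    (hs : ∀ k : ℤ, -(n : ℤ) < k → k < n → (l : ℂ) / 2 + ((A : ℤ) : ℂ) * rho ≠ k)
    {b : weights n → F A n ⊗[ℂ] V l rho} (hb0 : ∀ v, b v ≠ 0)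
    (hb1 : ∀ v : weights n, b v ∈ (ofModule (F A n ⊗[ℂ] V l rho)).hw (((l + (v : ℤ)).natAbs : ℂ) / 2))
    (hb2 : ∀ v, (ofModule (F A n ⊗[ℂ] V l rho)).chiral (iA A) (b v) =
      (((l : ℂ) / 2 + ((A : ℤ) : ℂ) * rho + ((v : ℤ) : ℂ)) ^ 2 - 1) • b v) :
    ⨆ v, (ofModule (F A n ⊗[ℂ] V l rho)).tower (b v) = ⊤ := by
  refine span_weight_tensor _ fun q w hw => ?_
  refine (?_ : (ofModule (F A n ⊗[ℂ] V l rho)).strings q ≤ _)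
    (mem_strings (locNilpotent_tensor A n l rho) hw)
  refine Submodule.span_le.2 ?_
  rintro _ ⟨k, p, u, hu, -, rfl⟩
  have hi : ∀ v : labels n l p, ∃ i : ℕ, p = (l + (v : ℤ)).natAbs + 2 * i := by
    rintro ⟨v, hv⟩
    obtain ⟨h1, h2, h3⟩ := mem_labels.1 hv
    rw [Int.abs_eq_natAbs] at h2
    exact ⟨(p - (l + v).natAbs) / 2, by dsimp only; omega⟩
  choose i hi using hi
  let lab : labels n l p → weights n := fun v => ⟨v, (mem_labels.1 v.2).1⟩
  let g : labels n l p → F A n ⊗[ℂ] V l rho := fun v =>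
    ((ofModule (F A n ⊗[ℂ] V l rho)).Kp ^ i v) (b (lab v))
  have hg : ∀ v, g v ∈ (ofModule (F A n ⊗[ℂ] V l rho)).hw ((p : ℂ) / 2) := fun v => by
    have := Kp_pow_mem_hw (hb1 (lab v)) (i v)
    rwa [show (l + ((lab v : weights n) : ℤ)).natAbs + 2 * i v = p from (hi v).symm] at this
  have hli : LinearIndependent ℂ g := by
    refine Module.End.eigenvectors_linearIndependent'
      ((ofModule (F A n ⊗[ℂ] V l rho)).chiral (iA A))
      (fun v : labels n l p => ((l : ℂ) / 2 + ((A : ℤ) : ℂ) * rho + ((v : ℤ) : ℂ)) ^ 2 - 1)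
      (fun v v' e => ?_) _ fun v =>
        ⟨Module.End.mem_eigenspace_iff.2 ?_, h.Kp_pow_tensor_ne_zero (hb0 _) _⟩
    · have := eigenvalue_injective hs (a₁ := lab v) (a₂ := lab v') e
      exact Subtype.ext (congrArg (fun t : weights n => (t : ℤ)) this)
    · rw [chiral_Kp_pow, hb2, map_smul]
  obtain ⟨hfin, hrank⟩ := h.finrank_hw_le A n p
  let g' : labels n l p → (ofModule (F A n ⊗[ℂ] V l rho)).hw ((p : ℂ) / 2) := fun v => ⟨g v, hg v⟩
  have hli' : LinearIndependent ℂ g' := LinearIndependent.of_comp (Submodule.subtype _) hli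
  have hcard : Fintype.card (labels n l p) =
      Module.finrank ℂ ((ofModule (F A n ⊗[ℂ] V l rho)).hw ((p : ℂ) / 2)) :=
    le_antisymm hli'.fintype_card_le_finrank (by rwa [Fintype.card_coe])
  have hspan := hli'.span_eq_top_of_card_eq_finrank' hcard
  have hmem : (⟨u, hu⟩ : (ofModule (F A n ⊗[ℂ] V l rho)).hw ((p : ℂ) / 2)) ∈
      Submodule.span ℂ (Set.range g') := hspan ▸ trivial
  have hle : Submodule.span ℂ (Set.range g') ≤
      (⨆ v, (ofModule (F A n ⊗[ℂ] V l rho)).tower (b v)).comap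
        (((ofModule (F A n ⊗[ℂ] V l rho)).Jm ^ k) ∘ₗ Submodule.subtype _) := by
    refine Submodule.span_le.2 ?_
    rintro _ ⟨v, rfl⟩
    exact le_iSup (fun v => (ofModule (F A n ⊗[ℂ] V l rho)).tower (b v)) (lab v)
      (towerVec_mem (i v) k)
  exact hle hmem

theorem tower_le_eigenspace {W : Type*} [AddCommGroup W] [Module ℂ W] {r : LadderRep W} {c μ : ℂ}
    {w : W} (hw : r.chiral c w = μ • w) : r.tower w ≤ (r.chiral c).eigenspace μ := by
  refine Submodule.span_le.2 ?_
  rintro _ ⟨x, rfl⟩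
  rw [SetLike.mem_coe, Module.End.mem_eigenspace_iff, towerVec, chiral_Jm_pow, chiral_Kp_pow, hw,
    map_smul, map_smul]

/-- The joint eigenspaces of the Casimirs as submodules. -/
noncomputable def casimirSubmodule (W : Type*) [AddCommGroup W] [Module ℂ W] [LieRingModule Spin31 W]
    [LieModule ℂ Spin31 W] (Lam Rho : ℂ) : LieSubmodule ℂ Spin31 W where
  __ := casimirEigenspace W Lam Rho
  lie_mem := by
    rintro x w ⟨h1, h2⟩
    have e1 := Module.End.mem_eigenspace_iff.1 h1
    have e2 := Module.End.mem_eigenspace_iff.1 h2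
    rw [casimir₁_eq] at e1
    rw [casimir₂_eq] at e2
    refine ⟨Module.End.mem_eigenspace_iff.2 ?_, Module.End.mem_eigenspace_iff.2 ?_⟩
    · rw [casimir₁_eq, (ofModule W).intertwines_cas₁.map_lie, e1, lie_smul]
    · rw [casimir₂_eq, (ofModule W).intertwines_cas₂.map_lie, e2, lie_smul]

end Decomposition

end Lorentz

theorem mainTheorem2 (A : ℤˣ) (n : ℕ) (hn : 1 ≤ n) (l : ℤ) (rho : ℂ)
    (hV : ¬ FiniteDimensional ℂ (V l rho))
    (hres : ∀ k : ℤ, -(n : ℤ) < k → k < n → rho + ((A : ℤ) : ℂ) * ((l : ℂ) / 2) ≠ k) :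
    SimultaneouslyDiagonalisable
      (casimir₁ (F A n ⊗[ℂ] V l rho)) (casimir₂ (F A n ⊗[ℂ] V l rho)) ∧
    (∀ x y : ℂ,
      (∃ u : F A n ⊗[ℂ] V l rho, u ≠ 0 ∧
          casimir₁ (F A n ⊗[ℂ] V l rho) u = x • u ∧ casimir₂ (F A n ⊗[ℂ] V l rho) u = y • u) ↔
        ∃ v ∈ weights n, ∃ Lam Rho : ℂ,
          Lam = (l : ℂ) / 2 + (v : ℂ) / 2 ∧ Rho = rho + ((A : ℤ) : ℂ) * ((v : ℂ) / 2) ∧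
          x = Complex.I * Lam * Rho ∧ y = Lam ^ 2 + Rho ^ 2 - 1) ∧
    ∃ E : weights n → LieSubmodule ℂ Spin31 (F A n ⊗[ℂ] V l rho),
      (∀ v : weights n, (E v : Submodule ℂ (F A n ⊗[ℂ] V l rho)) =
        casimirEigenspace (F A n ⊗[ℂ] V l rho)
          ((l : ℂ) / 2 + ((v : ℤ) : ℂ) / 2) (rho + ((A : ℤ) : ℂ) * (((v : ℤ) : ℂ) / 2))) ∧
      DirectSum.IsInternal (fun v => (E v : Submodule ℂ (F A n ⊗[ℂ] V l rho))) ∧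
      ∀ v : weights n,
        GKModule.Iso (E v) (V (l + v) (rho + ((A : ℤ) : ℂ) * (((v : ℤ) : ℂ) / 2))) := by
  have h := generic_of_not_finiteDimensional hV
  have hs := ne_intCast_of_nonresonant hres
  choose b hb0 hb1 hb2 using fun v : weights n => h.exists_hw_bot hn hs v.2
  set D := (LadderRep.ofModule (F A n ⊗[ℂ] V l rho)).chiral (iA A) with hD
  let μ : weights n → ℂ := fun v => ((l : ℂ) / 2 + ((A : ℤ) : ℂ) * rho + ((v : ℤ) : ℂ)) ^ 2 - 1
  let E : weights n → LieSubmodule ℂ Spin31 (F A n ⊗[ℂ] V l rho) := fun v =>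
    casimirSubmodule (F A n ⊗[ℂ] V l rho)
      ((l : ℂ) / 2 + ((v : ℤ) : ℂ) / 2) (rho + ((A : ℤ) : ℂ) * (((v : ℤ) : ℂ) / 2))
  have hE : ∀ v, (E v : Submodule ℂ (F A n ⊗[ℂ] V l rho)) = D.eigenspace (μ v) :=
    fun v => h.casimirEigenspace_eq v
  have hcas : ∀ v, ∀ w ∈ E v, _ := fun v w hw =>
    h.cas_of_chiral (Module.End.mem_eigenspace_iff.1 ((hE v).le hw))
  have hind : iSupIndep fun v => D.eigenspace (μ v) :=
    D.eigenspaces_iSupIndep.comp (eigenvalue_injective hs)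
  -- The towers sit in independent eigenspaces and already span everything, so they fill them.
  have htower : ∀ v, (LadderRep.ofModule (F A n ⊗[ℂ] V l rho)).tower (b v) = D.eigenspace (μ v) :=
    eq_of_le_of_iSup_eq_top hind (fun v => tower_le_eigenspace (hb2 v))
      (h.iSup_tower_eq_top hs hb0 hb1 hb2)
  have htop : ⨆ v, D.eigenspace (μ v) = ⊤ := by
    simp only [← htower]
    exact h.iSup_tower_eq_top hs hb0 hb1 hb2
  have hint : DirectSum.IsInternal (fun v => (E v : Submodule ℂ (F A n ⊗[ℂ] V l rho))) := by
    simp only [hE]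
    exact DirectSum.isInternal_submodule_of_iSupIndep_of_iSup_eq_top hind htop
  refine ⟨?_, fun x y => ⟨?_, ?_⟩, E, fun v => rfl, hint, fun v => ?_⟩
  · refine ⟨_, hint.collectedBasis fun v => Module.Basis.ofVectorSpace ℂ _, fun i => ?_⟩
    have hm := hint.collectedBasis_mem (fun v => Module.Basis.ofVectorSpace ℂ _) i
    obtain ⟨e1, e2⟩ := hcas i.1 _ hm
    rw [casimir₁_eq, casimir₂_eq]
    exact ⟨_, _, e1, e2⟩
  · rintro ⟨u, hu, h1, h2⟩
    rw [casimir₁_eq] at h1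
    rw [casimir₂_eq] at h2
    have hDu : D u = (y - 2 * iA A * x) • u := by
      rw [hD, LadderRep.chiral_apply, h1, h2, smul_smul, sub_smul]
    -- An eigenspace for any other value would be independent of subspaces whose sum is everything.
    obtain ⟨v, hv⟩ : ∃ v, μ v = y - 2 * iA A * x := by
      by_contra hne
      push Not at hne
      have hd := D.eigenspaces_iSupIndep (y - 2 * iA A * x)
      have hle : (⊤ : Submodule ℂ (F A n ⊗[ℂ] V l rho)) ≤
          ⨆ (z) (_ : z ≠ y - 2 * iA A * x), D.eigenspace z := by
        rw [← htop]
        exact iSup_le fun v => le_iSup₂_of_le (μ v) (hne v) le_rfl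
      rw [top_le_iff.1 hle, disjoint_top] at hd
      exact hu ((Submodule.mem_bot ℂ).1 (hd ▸ Module.End.mem_eigenspace_iff.2 hDu))
    rw [← hv] at hDu
    obtain ⟨e1, e2⟩ := h.cas_of_chiral hDu
    exact ⟨v, v.2, _, _, rfl, rfl, smul_left_injective ℂ hu (h1.symm.trans e1),
      smul_left_injective ℂ hu (h2.symm.trans e2)⟩
  · rintro ⟨v, hv, _, _, rfl, rfl, rfl, rfl⟩
    rw [casimir₁_eq, casimir₂_eq]
    exact ⟨b ⟨v, hv⟩, hb0 _, h.cas_of_chiral (hb2 ⟨v, hv⟩)⟩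
  · have hm : b v ∈ E v := (hE v).ge (Module.End.mem_eigenspace_iff.2 (hb2 v))
    have ht := (h.shift hn hs v.2).isTower
    push_cast [add_div] at ht
    refine nonempty_lieModuleEquiv (isTower_of_tower_eq hm (locNilpotent_tensor A n l rho) (hb1 v)
      (h.Kp_pow_tensor_ne_zero (hb0 v)) ((htower v).trans (hE v).symm)
      (fun w hw => (hcas v w hw).1) (fun w hw => (hcas v w hw).2) fun h0 => ?_) ht
    -- If the lowest spin is 0, then Λ = λ + ν = 0, and the value iΛΡ of C₁ vanishes as `IsTower`
    -- requires.
    have h1 : l + (v : ℤ) = 0 := Int.natAbs_eq_zero.1 h0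
    have h2 : (l : ℂ) / 2 + ((v : ℤ) : ℂ) / 2 = ((l + (v : ℤ) : ℤ) : ℂ) / 2 := by push_cast; ring
    rw [h2, h1]
    simp
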